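/- Let $k$ be a field of characteristic zero, $q$ an indeterminate, and let $U=U_q(\mathfrak{sl}_4)$ be the quantised enveloping algebra over $k(q)$ with generators $E_i,F_i,K_i^{\pm1}$ ($i=1,2,3$) and the usual relations $K_iE_jK_i^{-1}=q^{a_{ij}}E_j$, $K_iF_jK_i^{-1}=q^{-a_{ij}}F_j$, $[E_i,F_j]=\delta_{ij}(K_i-K_i^{-1})/(q-q^{-1})$ and the quantum Serre relations, where $(\alpha_i,\alpha_j)=a_{ij}$ are the entries of the Cartan matrix. Let $u\mapsto\overline{u}$ be the bar involution of $U$ ($q\mapsto q^{-1}$, $E_i\mapsto E_i$, $F_i\mapsto F_i$, $K_i\mapsto K_i^{-1}$), let $U^+$ be the subalgebra generated by the $E_i$, with its weight spaces $U^+_\mu$, $\mu\in Q^+=\bigoplus_i\mathbb{N}_0\alpha_i$, and let $T_i$ be Lusztig's automorphism $T''_{i,1}$, so that $T_i(E_j)=E_iE_j-q^{-1}E_jE_i$ if $a_{ij}=-1$ and $T_i(E_j)=E_j$ if $a_{ij}=0$; write $T_{13}=T_1\circ T_3$. Consider the Satake diagram of type $AII_3$, that is $I=\{1,2,3\}$,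 $X=\{1,3\}$, $\tau=\mathrm{id}$. Put $\Theta=-s_1s_3$ on the root lattice and $2\rho_X=\alpha_1+\alpha_3$. Let $c_2\in k(q)^\times$ satisfy $c_2=q^{(\alpha_2,\Theta(\alpha_2)-2\rho_X)}\,\overline{c_2}$ (that is, $c_2=q^2\overline{c_2}$), and let $B_{\mathbf c}\subset U$ be the quantum symmetric pair coideal subalgebra generated by $\mathcal M_X=\langle E_i,F_i,K_i^{\pm1}\mid i\in X\rangle$, by the $K_\lambda$ with $\Theta(\lambda)=\lambda$, which generate a subalgebra $U^0_\Theta$, and by $B_2=F_2-c_2T_{13}(E_2)K_2^{-1}$. (For this diagram the second family of parameters $\mathbf s$ is necessarily zero.) Then $B_{\mathbf c}$ has a bar involution $b\mapsto\overline{b}^B$, i.e. a ring automorphism which agrees with the bar involution of $U$ on $\mathcal M_XU^0_\Theta$ and fixes $B_2$, and the quasi $K$-matrix $\mathfrak X$ of $B_{\mathbf c}$, i.e. the unique element $\mathfrak X=\sum_{\mu\in Q^+}\mathfrak X_\mu\in\prod_{\mu\in Q^+}U^+_\mu$ with $\mathfrak X_0=1$ such that $\overline{b}^B\,\mathfrak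 X=\mathfrak X\,\overline{b}$ for all $b\in B_{\mathbf c}$ (an equation in the algebra of natural endomorphisms of the forgetful functor from finite dimensional $U$-modules of type $1$ to vector spaces), exists and is given by $$\mathfrak X=\sum_{n\ge0}\frac{(qc_2)^n}{\{n\}!}\,[E_2,T_{13}(E_2)]_{q^{-2}}^{\,n},$$ where $[x,y]_a=xy-a\,yx$, $\{n\}=1+q^2+\dots+q^{2(n-1)}$ and $\{n\}!=\{1\}\{2\}\cdots\{n\}$; the $n$-th summand lies in $U^+_{n(\alpha_1+2\alpha_2+\alpha_3)}$. -/

import Mathlib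

namespace QSP

set_option linter.unusedSimpArgs false

section
variable {R A : Type*} [Field R] [Ring A] [Algebra R A]

theorem t_serre_far {q : R} (hq : q ≠ 0) (h2 : 1 + q ^ 2 ≠ 0) {x y z u : A}
    (hu : u = x * y - q⁻¹ • (y * x))
    (hS : x * x * y - (q + q⁻¹) • (x * y * x) + y * x * x = 0) (hxz : x * z = z * x)
    (hT : y * y * z - (q + q⁻¹) • (y * z * y) + z * y * y = 0) :
    u * u * z - (q + q⁻¹) • (u * z * u) + z * u * u = 0 := by
  have hxy : x * y = u + q⁻¹ • (y * x) := by rw [hu]; abel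
  have hxu : x * u = q • (u * x) := by
    rw [hu]
    simp only [mul_sub, sub_mul, smul_mul_assoc, mul_smul_comm, mul_assoc] at hS ⊢
    linear_combination (norm := (match_scalars <;> field_simp <;> ring)) hS
  have hxy' : ∀ t : A, x * (y * t) = u * t + q⁻¹ • (y * (x * t)) := fun t => by
    rw [← mul_assoc, hxy, add_mul, smul_mul_assoc, mul_assoc]
  have hxu' : ∀ t : A, x * (u * t) = q • (u * (x * t)) := fun t => by
    rw [← mul_assoc, hxu, smul_mul_assoc, mul_assoc]
  have hxz' : ∀ t : A, x * (z * t) = z * (x * t) := fun t => by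
    rw [← mul_assoc, hxz, mul_assoc]
  clear hu
  have h1 : u * (y * z) + q⁻¹ • (y * (u * z)) - (q + q⁻¹) • (u * (z * y) + q⁻¹ • (y * (z * u)))
      + (z * (u * y) + q⁻¹ • (z * (y * u))) = 0 := by
    have h3 := congrArg (x * ·) hT
    have h4 := congrArg (· * x) hT
    simp only [mul_add, mul_sub, add_mul, sub_mul, smul_mul_assoc, mul_smul_comm, mul_assoc, hxy, hxy', hxz,
      hxz', mul_zero, zero_mul, smul_add, smul_smul] at h3 h4 ⊢
    linear_combination (norm := (match_scalars <;> field_simp <;> ring)) h3 - (q⁻¹ * q⁻¹) • h4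
  have h3 := congrArg (x * ·) h1
  have h4 := congrArg (· * x) h1
  simp only [mul_add, mul_sub, add_mul, sub_mul, smul_mul_assoc, mul_smul_comm, mul_assoc, hxy, hxy', hxz,
      hxz', hxu, hxu', mul_zero, zero_mul, smul_add, smul_smul] at h3 h4 ⊢
  linear_combination (norm := (match_scalars <;> field_simp <;> ring)) (q * (1 + q ^ 2)⁻¹) • (h3 - h4)

theorem t_comm_near {q : R} (hq : q ≠ 0) (h2 : 1 + q ^ 2 ≠ 0) {x y z u w : A}
    (hu : u = y * x - q⁻¹ • (x * y)) (hw : w = y * z - q⁻¹ • (z * y)) (hxz : x * z = z * x)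
    (hS : y * y * x - (q + q⁻¹) • (y * x * y) + x * y * y = 0)
    (hT : y * y * z - (q + q⁻¹) • (y * z * y) + z * y * y = 0) : u * w = w * u := by
  have hyx : y * x = u + q⁻¹ • (x * y) := by rw [hu]; abel
  have hyz : y * z = w + q⁻¹ • (z * y) := by rw [hw]; abel
  have hyu : y * u = q • (u * y) := by
    rw [hu]
    simp only [mul_sub, sub_mul, smul_mul_assoc, mul_smul_comm, mul_assoc] at hS ⊢
    linear_combination (norm := (match_scalars <;> field_simp <;> ring)) hS
  have hyw : y * w = q • (w * y) := by
    rw [hw]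
    simp only [mul_sub, sub_mul, smul_mul_assoc, mul_smul_comm, mul_assoc] at hT ⊢
    linear_combination (norm := (match_scalars <;> field_simp <;> ring)) hT
  have hyx' : ∀ t : A, y * (x * t) = u * t + q⁻¹ • (x * (y * t)) := fun t => by
    rw [← mul_assoc, hyx, add_mul, smul_mul_assoc, mul_assoc]
  have hyz' : ∀ t : A, y * (z * t) = w * t + q⁻¹ • (z * (y * t)) := fun t => by
    rw [← mul_assoc, hyz, add_mul, smul_mul_assoc, mul_assoc]
  have hyu' : ∀ t : A, y * (u * t) = q • (u * (y * t)) := fun t => by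
    rw [← mul_assoc, hyu, smul_mul_assoc, mul_assoc]
  have hyw' : ∀ t : A, y * (w * t) = q • (w * (y * t)) := fun t => by
    rw [← mul_assoc, hyw, smul_mul_assoc, mul_assoc]
  clear hu hw
  have hxz' : x * z - z * x = 0 := by rw [hxz, sub_self]
  have h1 : u * z + q⁻¹ • (x * w) - w * x - q⁻¹ • (z * u) = 0 := by
    have h3 := congrArg (y * ·) hxz'
    have h4 := congrArg (· * y) hxz'
    simp only [mul_add, mul_sub, add_mul, sub_mul, smul_mul_assoc, mul_smul_comm, mul_assoc, hyx, hyx', hyz,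
      hyz', mul_zero, zero_mul, smul_add, smul_smul] at h3 h4 ⊢
    linear_combination (norm := (match_scalars <;> field_simp <;> ring)) h3 - (q⁻¹ * q⁻¹) • h4
  have h3 := congrArg (y * ·) h1
  have h4 := congrArg (· * y) h1
  simp only [mul_add, mul_sub, add_mul, sub_mul, smul_mul_assoc, mul_smul_comm, mul_assoc, hyx, hyx', hyz,
      hyz', hyu, hyu', hyw, hyw', mul_zero, zero_mul, smul_add, smul_smul] at h3 h4 ⊢
  linear_combination (norm := (match_scalars <;> field_simp <;> ring)) (q * (1 + q ^ 2)⁻¹) • (h3 - h4)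
end

/-- The Cartan matrix of `sl₄`. The nodes `1, 2, 3` of the Dynkin diagram are the elements `0, 1, 2`
of `Fin 3`. -/
def cartan : Matrix (Fin 3) (Fin 3) ℤ := !![2, -1, 0; -1, 2, -1; 0, -1, 2]

/-- The defining (Drinfeld-Jimbo) relations of `U_q(sl₄)`, for families `E i`, `F i`, `K i` and
`L i = (K i)⁻¹` in an algebra `A`. -/
structure DJRel {R A : Type*} [Field R] [Ring A] [Algebra R A] (q : R) (E F K L : Fin 3 → A) :
    Prop where
  KL : ∀ i, K i * L i = 1
  LK : ∀ i, L i * K i = 1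
  KK : ∀ i j, K i * K j = K j * K i
  KE : ∀ i j, K i * E j = q ^ cartan i j • (E j * K i)
  KF : ∀ i j, K i * F j = q ^ (-cartan i j) • (F j * K i)
  EF : ∀ i j, E i * F j - F j * E i = if i = j then (q - q⁻¹)⁻¹ • (K i - L i) else 0
  EE : ∀ i j, cartan i j = 0 → E i * E j = E j * E i
  EEE : ∀ i j, cartan i j = -1 →
    E i * E i * E j - (q + q⁻¹) • (E i * E j * E i) + E j * E i * E i = 0
  FF : ∀ i j, cartan i j = 0 → F i * F j = F j * F i
  FFF : ∀ i j, cartan i j = -1 →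
    F i * F i * F j - (q + q⁻¹) • (F i * F j * F i) + F j * F i * F i = 0

namespace DJRel
variable {R A : Type*} [Field R] [Ring A] [Algebra R A] {q : R} {E F K L : Fin 3 → A}

theorem LE (h : DJRel q E F K L) (hq : q ≠ 0) (i j : Fin 3) :
    L i * E j = q ^ (-cartan i j) • (E j * L i) := by
  have h1 := congrArg (fun t => q ^ (-cartan i j) • (L i * t * L i)) (h.KE i j)
  simp only [mul_smul_comm, smul_mul_assoc, smul_smul] at h1
  rw [← zpow_add₀ hq, neg_add_cancel, zpow_zero, one_smul, ← mul_assoc, h.LK, one_mul,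
    mul_assoc, mul_assoc, h.KL, mul_one] at h1
  exact h1.symm

theorem LF (h : DJRel q E F K L) (hq : q ≠ 0) (i j : Fin 3) :
    L i * F j = q ^ cartan i j • (F j * L i) := by
  have h1 := congrArg (fun t => q ^ (cartan i j) • (L i * t * L i)) (h.KF i j)
  simp only [mul_smul_comm, smul_mul_assoc, smul_smul] at h1
  rw [← zpow_add₀ hq, add_neg_cancel, zpow_zero, one_smul, ← mul_assoc, h.LK, one_mul,
    mul_assoc, mul_assoc, h.KL, mul_one] at h1
  exact h1.symm

theorem LK' (h : DJRel q E F K L) (i j : Fin 3) : L i * K j = K j * L i := by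
  have h1 := congrArg (fun t => L i * t * L i) (h.KK i j)
  beta_reduce at h1
  rw [← mul_assoc, h.LK, one_mul, mul_assoc, mul_assoc, h.KL, mul_one] at h1
  exact h1.symm

theorem LL (h : DJRel q E F K L) (i j : Fin 3) : L i * L j = L j * L i := by
  have h1 := congrArg (fun t => L j * t * L j) (h.LK' i j)
  beta_reduce at h1
  rw [mul_assoc (L j), mul_assoc (L i), h.KL, mul_one, ← mul_assoc (L j), h.LK, one_mul] at h1
  exact h1.symm

open MulOpposite in
theorem opp (h : DJRel q E F K L) (hq : q ≠ 0) :
    DJRel (A := Aᵐᵒᵖ) q⁻¹ (fun i => op (F i)) (fun i => op (E i)) (fun i => op (L i))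
      (fun i => op (K i)) where
  KL i := by rw [← op_mul, h.KL, op_one]
  LK i := by rw [← op_mul, h.LK, op_one]
  KK i j := by rw [← op_mul, ← op_mul, h.LL]
  KE i j := by
    rw [← op_mul, ← op_mul, ← op_smul, h.LF hq, smul_smul, inv_zpow', ← zpow_add₀ hq]; simp
  KF i j := by
    rw [← op_mul, ← op_mul, ← op_smul, h.LE hq, smul_smul, inv_zpow', ← zpow_add₀ hq]; simp
  EF i j := by
    rw [← op_mul, ← op_mul, ← op_sub, ← op_sub, h.EF j i]
    by_cases e : i = j
    · subst e
      simp only [if_true, ← op_smul, inv_inv]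
      rw [← neg_sub (K i), smul_neg, ← neg_smul, ← inv_neg, neg_sub]
    · rw [if_neg e, if_neg (Ne.symm e), op_zero]
  EE i j c := by rw [← op_mul, ← op_mul, h.FF i j c]
  EEE i j c := by
    have h1 := congrArg MulOpposite.op (h.FFF i j c)
    simp only [op_add, op_sub, op_smul, op_mul, op_zero, mul_assoc, inv_inv] at h1 ⊢
    rw [← h1, add_comm q]; abel
  FF i j c := by rw [← op_mul, ← op_mul, h.EE i j c]
  FFF i j c := by
    have h1 := congrArg MulOpposite.op (h.EEE i j c)
    simp only [op_add, op_sub, op_smul, op_mul, op_zero, mul_assoc, inv_inv] at h1 ⊢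
    rw [← h1, add_comm q]; abel

end DJRel

/-- The element `T_i (E_j)`, where `T_i = T''_{i,1}` is Lusztig's braid group automorphism:
`-F_i K_i` if `j = i`, `E_i E_j - q⁻¹ E_j E_i` if `a_{ij} = -1`, and `E_j` if `a_{ij} = 0`. -/
def tE {R A : Type*} [Field R] [Ring A] [Algebra R A] (q : R) (E F K : Fin 3 → A)
    (i j : Fin 3) : A :=
  if j = i then -(F i * K i)
  else if cartan i j = -1 then E i * E j - q⁻¹ • (E j * E i) else E j

/-- The element `T_i (F_j)`: `-K_i⁻¹ E_i` if `j = i`, `F_j F_i - q F_i F_j` if `a_{ij} = -1`, and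
`F_j` if `a_{ij} = 0`. -/
def tF {R A : Type*} [Field R] [Ring A] [Algebra R A] (q : R) (E F L : Fin 3 → A)
    (i j : Fin 3) : A :=
  if j = i then -(L i * E i)
  else if cartan i j = -1 then F j * F i - q • (F i * F j) else F j

/-- The element `T_i (K_j) = K_j K_i ^ (-a_{ij})` (and, with `K` and `L` exchanged, its inverse). -/
def tK {A : Type*} [Ring A] (K L : Fin 3 → A) (i j : Fin 3) : A :=
  if j = i then L i else if cartan i j = -1 then K j * K i else K j

namespace DJRel
variable {R A : Type*} [Field R] [Ring A] [Algebra R A] {q : R} {E F K L : Fin 3 → A}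

theorem tKE (h : DJRel q E F K L) (hq : q ≠ 0) (i j m : Fin 3) :
    tK K L i j * tE q E F K i m = q ^ cartan j m • (tE q E F K i m * tK K L i j) := by
  have a : ∀ (i j) (t : A), K i * (E j * t) = q ^ cartan i j • (E j * (K i * t)) := fun i j t => by
    rw [← mul_assoc, h.KE, smul_mul_assoc, mul_assoc]
  have b : ∀ (i j) (t : A), K i * (F j * t) = q ^ (-cartan i j) • (F j * (K i * t)) :=
    fun i j t => by rw [← mul_assoc, h.KF, smul_mul_assoc, mul_assoc]
  have c : ∀ (i j) (t : A), L i * (E j * t) = q ^ (-cartan i j) • (E j * (L i * t)) :=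
    fun i j t => by rw [← mul_assoc, h.LE hq, smul_mul_assoc, mul_assoc]
  have d : ∀ (i j) (t : A), L i * (F j * t) = q ^ (cartan i j) • (F j * (L i * t)) :=
    fun i j t => by rw [← mul_assoc, h.LF hq, smul_mul_assoc, mul_assoc]
  have k10 := h.KK 1 0
  have k20 := h.KK 2 0
  have k21 := h.KK 2 1
  have k : ∀ (i j) (t : A), K i * K j = K j * K i → K i * (K j * t) = K j * (K i * t) :=
    fun i j t e => by rw [← mul_assoc, e, mul_assoc]
  have k10' := fun t => k _ _ t k10
  have k20' := fun t => k _ _ t k20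
  have k21' := fun t => k _ _ t k21
  fin_cases i <;> fin_cases j <;> fin_cases m <;>
  simp [tK, tE, cartan, a, b, c, d, h.KE, h.KF, h.LE hq, h.LF hq, mul_assoc, mul_sub, sub_mul,
    smul_smul, smul_sub, h.LK, h.KL, k10, k20, k21, k10', k20', k21', h.LK'] <;>
  (match_scalars <;> field_simp)



theorem tKL (h : DJRel q E F K L) (i j : Fin 3) : tK K L i j * tK L K i j = 1 := by
  unfold tK
  split_ifs
  · exact h.LK _
  · rw [mul_assoc, ← mul_assoc (K i), ← h.LK', mul_assoc (L j), h.KL, mul_one, h.KL]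
  · exact h.KL _

theorem tKK (h : DJRel q E F K L) (i j m : Fin 3) :
    tK K L i j * tK K L i m = tK K L i m * tK K L i j := by
  have hK : ∀ i j, Commute (K i) (K j) := h.KK
  have hL : ∀ i j, Commute (L i) (L j) := h.LL
  have hLK : ∀ i j, Commute (L i) (K j) := h.LK'
  have hKL : ∀ i j, Commute (K i) (L j) := fun i j => (hLK j i).symm
  change Commute _ _
  unfold tK
  split_ifs <;> simp [Commute.mul_left, Commute.mul_right, hK, hL, hLK, hKL]

set_option maxHeartbeats 1000000 in
theorem tEF (h : DJRel q E F K L) (hq : q ≠ 0) (hq' : q ^ 2 - 1 ≠ 0) (i j m : Fin 3) :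
    tE q E F K i j * tF q E F L i m - tF q E F L i m * tE q E F K i j =
      if j = m then (q - q⁻¹)⁻¹ • (tK K L i j - tK L K i j) else 0 := by
  have hd : (q - q⁻¹)⁻¹ = q * (q ^ 2 - 1)⁻¹ := by field_simp
  have a : ∀ (i j) (t : A), K i * (E j * t) = q ^ cartan i j • (E j * (K i * t)) := fun i j t => by
    rw [← mul_assoc, h.KE, smul_mul_assoc, mul_assoc]
  have b : ∀ (i j) (t : A), K i * (F j * t) = q ^ (-cartan i j) • (F j * (K i * t)) :=
    fun i j t => by rw [← mul_assoc, h.KF, smul_mul_assoc, mul_assoc]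
  have c : ∀ (i j) (t : A), L i * (E j * t) = q ^ (-cartan i j) • (E j * (L i * t)) :=
    fun i j t => by rw [← mul_assoc, h.LE hq, smul_mul_assoc, mul_assoc]
  have d : ∀ (i j) (t : A), L i * (F j * t) = q ^ (cartan i j) • (F j * (L i * t)) :=
    fun i j t => by rw [← mul_assoc, h.LF hq, smul_mul_assoc, mul_assoc]
  have e1 : ∀ i, E i * F i = F i * E i + (q * (q ^ 2 - 1)⁻¹) • (K i - L i) := fun i => by
    have := h.EF i i
    rw [if_pos rfl, hd] at this
    rw [← this]; abel
  have e2 : ∀ i j, i ≠ j → E i * F j = F j * E i := fun i j n => by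
    have := h.EF i j
    rw [if_neg n] at this
    exact sub_eq_zero.mp this
  have e1' : ∀ (i) (t : A), E i * (F i * t) =
      F i * (E i * t) + (q * (q ^ 2 - 1)⁻¹) • (K i * t - L i * t) := fun i t => by
    rw [← mul_assoc, e1, add_mul, smul_mul_assoc, sub_mul, mul_assoc]
  have e2' : ∀ (i j) (t : A), i ≠ j → E i * (F j * t) = F j * (E i * t) := fun i j t n => by
    rw [← mul_assoc, e2 i j n, mul_assoc]
  have z1 := h.EE 2 0 rfl
  have z2 := h.FF 2 0 rfl
  have k : ∀ (x y t : A), x * y = y * x → x * (y * t) = y * (x * t) :=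
    fun x y t e => by rw [← mul_assoc, e, mul_assoc]
  have z1' := fun t => k _ _ t z1
  have z2' := fun t => k _ _ t z2
  have k10 := h.KK 1 0
  have k20 := h.KK 2 0
  have k21 := h.KK 2 1
  have l10 := h.LL 1 0
  have l20 := h.LL 2 0
  have l21 := h.LL 2 1
  have KL' : ∀ (i) (t : A), K i * (L i * t) = t := fun i t => by rw [← mul_assoc, h.KL, one_mul]
  have LK' : ∀ (i) (t : A), L i * (K i * t) = t := fun i t => by rw [← mul_assoc, h.LK, one_mul]
  have sF : ∀ i m, cartan i m = -1 → ∀ t : A, F m * (F i * (F i * t)) =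
      (q + q⁻¹) • (F i * (F m * (F i * t))) - F i * (F i * (F m * t)) := fun i m e t => by
    have s := congrArg (· * t) (h.FFF i m e)
    simp only [add_mul, sub_mul, smul_mul_assoc, mul_assoc, zero_mul] at s
    linear_combination (norm := abel) s
  have sE : ∀ i m, cartan i m = -1 → ∀ t : A, E m * (E i * (E i * t)) =
      (q + q⁻¹) • (E i * (E m * (E i * t))) - E i * (E i * (E m * t)) := fun i m e t => by
    have s := congrArg (· * t) (h.EEE i m e)
    simp only [add_mul, sub_mul, smul_mul_assoc, mul_assoc, zero_mul] at s
    linear_combination (norm := abel) s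
  have sF01 := sF 0 1 rfl
  have sF10 := sF 1 0 rfl
  have sF12 := sF 1 2 rfl
  have sF21 := sF 2 1 rfl
  have sE01 := sE 0 1 rfl
  have sE10 := sE 1 0 rfl
  have sE12 := sE 1 2 rfl
  have sE21 := sE 2 1 rfl
  rw [hd]
  fin_cases i <;> fin_cases j <;> fin_cases m <;>
  simp [tK, tE, tF, cartan, a, b, c, d, h.KE, h.KF, h.LE hq, h.LF hq, mul_assoc, mul_sub, sub_mul,
    mul_add, add_mul, smul_add, e1, e2, e1', e2', z1, z2, z1', z2',
    smul_smul, smul_sub, h.LK, h.KL, KL', LK', k10, k20, k21, l10, l20, l21, h.LK',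
    sF01, sF10, sF12, sF21, sE01, sE10, sE12, sE21] <;>
  (match_scalars <;> field_simp <;> ring)


theorem tEE (h : DJRel q E F K L) (hq : q ≠ 0) (h2 : 1 + q ^ 2 ≠ 0) (i j m : Fin 3)
    (hc : cartan j m = 0) :
    tE q E F K i j * tE q E F K i m = tE q E F K i m * tE q E F K i j := by
  have far : ∀ i m, i ≠ m → cartan i m = 0 →
      F i * K i * E m = E m * (F i * K i) := fun i m n e => by
    have h1 := h.EF m i
    rw [if_neg n.symm] at h1
    rw [mul_assoc, h.KE, e, zpow_zero, one_smul, ← mul_assoc, ← sub_eq_zero.mp h1, mul_assoc]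
  have near := t_comm_near (u := E 1 * E 0 - q⁻¹ • (E 0 * E 1))
    (w := E 1 * E 2 - q⁻¹ • (E 2 * E 1)) hq h2 rfl rfl (h.EE 0 2 rfl) (h.EEE 1 0 rfl)
    (h.EEE 1 2 rfl)
  have f02 := far 0 2 (by decide) rfl
  have f20 := far 2 0 (by decide) rfl
  fin_cases i <;> fin_cases j <;> fin_cases m <;> first
    | exact absurd hc (by decide)
    | simp [tE, cartan, f02, f20, near]

set_option maxHeartbeats 1000000 in
theorem tEEE (h : DJRel q E F K L) (hq : q ≠ 0) (h2 : 1 + q ^ 2 ≠ 0) (hq' : q ^ 2 - 1 ≠ 0)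
    (i j m : Fin 3) (hc : cartan j m = -1) :
    tE q E F K i j * tE q E F K i j * tE q E F K i m -
      (q + q⁻¹) • (tE q E F K i j * tE q E F K i m * tE q E F K i j) +
      tE q E F K i m * tE q E F K i j * tE q E F K i j = 0 := by
  have hd : (q - q⁻¹)⁻¹ = q * (q ^ 2 - 1)⁻¹ := by field_simp
  have cii : ∀ i, cartan i i = 2 := by decide
  have ki : ∀ i, K i * E i = q ^ 2 • (E i * K i) := fun i => by rw [h.KE, cii]; simp only [zpow_ofNat]
  have li : ∀ i, L i * E i = (q⁻¹) ^ 2 • (E i * L i) := fun i => by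
    rw [h.LE hq, cii, zpow_neg, inv_pow]; simp only [zpow_ofNat]
  have kf : ∀ i, K i * F i = (q⁻¹) ^ 2 • (F i * K i) := fun i => by
    rw [h.KF, cii, zpow_neg, inv_pow]; simp only [zpow_ofNat]
  have e1 : ∀ i, E i * F i = F i * E i + (q * (q ^ 2 - 1)⁻¹) • (K i - L i) := fun i => by
    have := h.EF i i
    rw [if_pos rfl, hd] at this
    rw [← this]; abel
  have far : ∀ i j m, i ≠ m → cartan i j = -1 → cartan j m = -1 → cartan m j = -1 →
      cartan i m = 0 →
      (E i * E j - q⁻¹ • (E j * E i)) * (E i * E j - q⁻¹ • (E j * E i)) * E m -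
      (q + q⁻¹) • ((E i * E j - q⁻¹ • (E j * E i)) * E m * (E i * E j - q⁻¹ • (E j * E i))) +
      E m * (E i * E j - q⁻¹ • (E j * E i)) * (E i * E j - q⁻¹ • (E j * E i)) = 0 ∧
      E m * E m * (E i * E j - q⁻¹ • (E j * E i)) -
      (q + q⁻¹) • (E m * (E i * E j - q⁻¹ • (E j * E i)) * E m) +
      (E i * E j - q⁻¹ • (E j * E i)) * E m * E m = 0 := fun i j m n c1 c2 c3 c4 => by
    refine ⟨t_serre_far hq h2 rfl (h.EEE i j c1) (h.EE i m c4) (h.EEE j m c2), ?_⟩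
    have s := h.EEE m j c3
    have z := h.EE i m c4
    have z' : ∀ t : A, E i * (E m * t) = E m * (E i * t) := fun t => by
      rw [← mul_assoc, z, mul_assoc]
    have s1 := congrArg (E i * ·) s
    have s2 := congrArg (· * E i) s
    simp only [mul_add, mul_sub, add_mul, sub_mul, smul_mul_assoc, mul_smul_comm, mul_assoc, z, z',
      mul_zero, zero_mul, smul_sub, smul_smul] at s1 s2 ⊢
    linear_combination (norm := (match_scalars <;> field_simp <;> ring)) s1 - q⁻¹ • s2
  have near : ∀ i m, i ≠ m → cartan i m = -1 → cartan m i = -1 →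
      (F i * K i) * (F i * K i) * (E i * E m - q⁻¹ • (E m * E i)) -
      (q + q⁻¹) • ((F i * K i) * (E i * E m - q⁻¹ • (E m * E i)) * (F i * K i)) +
      (E i * E m - q⁻¹ • (E m * E i)) * (F i * K i) * (F i * K i) = 0 ∧
      (E i * E m - q⁻¹ • (E m * E i)) * (E i * E m - q⁻¹ • (E m * E i)) * -(F i * K i) -
      (q + q⁻¹) • ((E i * E m - q⁻¹ • (E m * E i)) * -(F i * K i) *
        (E i * E m - q⁻¹ • (E m * E i))) +
      -(F i * K i) * (E i * E m - q⁻¹ • (E m * E i)) * (E i * E m - q⁻¹ • (E m * E i)) = 0 :=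
    fun i m n c1 c2 => by
    have e2 : E m * F i = F i * E m := by
      have := h.EF m i
      rw [if_neg n.symm] at this
      exact sub_eq_zero.mp this
    have km : K i * E m = q⁻¹ • (E m * K i) := by rw [h.KE, c1, zpow_neg_one]
    have lm : L i * E m = q • (E m * L i) := by rw [h.LE hq, c1, neg_neg, zpow_one]
    have s := h.EEE i m c1
    have s' := h.EEE m i c2
    have ki := ki i
    have li := li i
    have kf := kf i
    have e1 := e1 i
    have kl := h.KL i
    have lk := h.LK i
    generalize E i = x at *
    generalize E m = y at *
    generalize F i = f at *
    generalize K i = k at *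
    generalize L i = l at *
    have ki' : ∀ t, k * (x * t) = q ^ 2 • (x * (k * t)) := fun t => by
      rw [← mul_assoc, ki, smul_mul_assoc, mul_assoc]
    have li' : ∀ t, l * (x * t) = (q⁻¹) ^ 2 • (x * (l * t)) := fun t => by
      rw [← mul_assoc, li, smul_mul_assoc, mul_assoc]
    have kf' : ∀ t, k * (f * t) = (q⁻¹) ^ 2 • (f * (k * t)) := fun t => by
      rw [← mul_assoc, kf, smul_mul_assoc, mul_assoc]
    have km' : ∀ t, k * (y * t) = q⁻¹ • (y * (k * t)) := fun t => by
      rw [← mul_assoc, km, smul_mul_assoc, mul_assoc]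
    have lm' : ∀ t, l * (y * t) = q • (y * (l * t)) := fun t => by
      rw [← mul_assoc, lm, smul_mul_assoc, mul_assoc]
    have e1' : ∀ t, x * (f * t) = f * (x * t) + (q * (q ^ 2 - 1)⁻¹) • (k * t - l * t) := fun t => by
      rw [← mul_assoc, e1, add_mul, smul_mul_assoc, sub_mul, mul_assoc]
    have e2' : ∀ t, y * (f * t) = f * (y * t) := fun t => by rw [← mul_assoc, e2, mul_assoc]
    have lk' : ∀ t, l * (k * t) = t := fun t => by rw [← mul_assoc, lk, one_mul]
    have lf : l * f = q ^ 2 • (f * l) := by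
      have h1 := congrArg (fun t => q ^ 2 • (l * t * l)) kf
      simp only [mul_smul_comm, smul_mul_assoc, smul_smul] at h1
      rw [inv_pow, mul_inv_cancel₀ (pow_ne_zero 2 hq), one_smul, ← mul_assoc, lk, one_mul,
        mul_assoc, mul_assoc, kl, mul_one] at h1
      exact h1.symm
    have lf' : ∀ t, l * (f * t) = q ^ 2 • (f * (l * t)) := fun t => by
      rw [← mul_assoc, lf, smul_mul_assoc, mul_assoc]
    constructor
    · simp only [mul_add, mul_sub, add_mul, sub_mul, smul_add, smul_sub, smul_mul_assoc,
        mul_smul_comm, smul_smul, mul_assoc, ki, ki', li, li', kf, kf', km, km', lm, lm', e1, e1',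
        e2, e2', lk, lk', kl, lf, lf', mul_one]
      match_scalars <;> field_simp <;> ring
    · have s2 : ∀ t, y * (y * (x * t)) = (q + q⁻¹) • (y * (x * (y * t))) - x * (y * (y * t)) :=
        fun t => by
          have s := congrArg (· * t) s'
          simp only [add_mul, sub_mul, smul_mul_assoc, mul_assoc, zero_mul] at s
          linear_combination (norm := abel) s
      have s3 := s2 1
      simp only [mul_one] at s3
      simp only [s2, s3, mul_neg, neg_mul, smul_neg, mul_add, mul_sub, add_mul, sub_mul, smul_add, smul_sub, smul_mul_assoc,
        mul_smul_comm, smul_smul, mul_assoc, ki, ki', li, li', kf, kf', km, km', lm, lm', e1, e1',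
        e2, e2', lk, lk', kl, lf, lf', mul_one]
      match_scalars <;> field_simp <;> ring
  have f01 := far 0 1 2 (by decide) rfl rfl rfl rfl
  have f21 := far 2 1 0 (by decide) rfl rfl rfl rfl
  have n01 := near 0 1 (by decide) rfl rfl
  have n10 := near 1 0 (by decide) rfl rfl
  have n12 := near 1 2 (by decide) rfl rfl
  have n21 := near 2 1 (by decide) rfl rfl
  fin_cases i <;> fin_cases j <;> fin_cases m <;> first
    | exact absurd hc (by decide)
    | simpa [tE, cartan] using f01.1
    | simpa [tE, cartan] using f01.2
    | simpa [tE, cartan] using f21.1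
    | simpa [tE, cartan] using f21.2
    | simpa [tE, cartan] using n01.1
    | simpa [tE, cartan] using n01.2
    | simpa [tE, cartan] using n10.1
    | simpa [tE, cartan] using n10.2
    | simpa [tE, cartan] using n12.1
    | simpa [tE, cartan] using n12.2
    | simpa [tE, cartan] using n21.1
    | simpa [tE, cartan] using n21.2


open MulOpposite in
theorem tE_op (i j : Fin 3) :
    tE q⁻¹ (fun i => op (F i)) (fun i => op (E i)) (fun i => op (L i)) i j =
      op (tF q E F L i j) := by
  unfold tE tF
  split_ifs <;> simp

open MulOpposite in
theorem tK_op (i j : Fin 3) (h : DJRel q E F K L) :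
    tK (fun i => op (L i)) (fun i => op (K i)) i j = op (tK L K i j) := by
  unfold tK
  split_ifs
  · rfl
  · rw [← op_mul, h.LL]
  · rfl

open MulOpposite in
theorem t (h : DJRel q E F K L) (hq : q ≠ 0) (h2 : 1 + q ^ 2 ≠ 0) (hq' : q ^ 2 - 1 ≠ 0)
    (i : Fin 3) :
    DJRel q (tE q E F K i) (tF q E F L i) (tK K L i) (tK L K i) := by
  have hi : q⁻¹ ≠ 0 := inv_ne_zero hq
  have hi2 : 1 + q⁻¹ ^ 2 ≠ 0 := by
    have : 1 + q⁻¹ ^ 2 = (1 + q ^ 2) / q ^ 2 := by field_simp; ring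
    rw [this]; exact div_ne_zero h2 (pow_ne_zero 2 hq)
  have hi' : q⁻¹ ^ 2 - 1 ≠ 0 := by
    have : q⁻¹ ^ 2 - 1 = -(q ^ 2 - 1) / q ^ 2 := by field_simp; ring
    rw [this]; exact div_ne_zero (neg_ne_zero.mpr hq') (pow_ne_zero 2 hq)
  have ho := h.opp hq
  have LK : ∀ j, tK L K i j * tK K L i j = 1 := fun j => by
    have := congrArg unop (ho.tKL i j)
    have e : tK (fun i => op (K i)) (fun i => op (L i)) i j = op (tK K L i j) := by
      unfold tK
      split_ifs
      · rfl
      · rw [← op_mul, h.KK]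
      · rfl
    rw [tK_op i j h, e, ← op_mul, op_mul, unop_mul, unop_op, unop_op, unop_one] at this
    unfold tK at *
    split_ifs
    · exact h.KL _
    · rw [mul_assoc, ← mul_assoc (L i), h.LK', mul_assoc (K j), h.LK, mul_one, h.LK]
    · exact h.LK _
  refine ⟨h.tKL i, LK, h.tKK i, h.tKE hq i, fun j m => ?_, h.tEF hq hq' i, h.tEE hq h2 i,
    h.tEEE hq h2 hq' i, fun j m c => ?_, fun j m c => ?_⟩
  · have h1 := congrArg unop (ho.tKE hi i j m)
    rw [tE_op, tK_op i j h] at h1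
    simp only [unop_mul, unop_smul, unop_op, inv_zpow'] at h1
    have h3 := congrArg (fun t => tK K L i j * t * tK K L i j) h1
    beta_reduce at h3
    rw [mul_assoc, mul_assoc, LK, mul_one, mul_smul_comm, ← mul_assoc, h.tKL, one_mul,
      smul_mul_assoc] at h3
    exact h3
  · have h1 := congrArg unop (ho.tEE hi hi2 i j m c)
    rw [tE_op, tE_op] at h1
    simpa using h1.symm
  · have h1 := congrArg unop (ho.tEEE hi hi2 hi' i j m c)
    rw [tE_op, tE_op] at h1
    simp only [unop_add, unop_sub, unop_smul, unop_mul, unop_op, unop_zero, inv_inv] at h1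
    simp only [mul_assoc, add_comm q⁻¹] at h1 ⊢
    rw [← h1]; abel

end DJRel

/-! ### The quantised enveloping algebra `U_q(sl₄)` over `k(q)` -/

universe u

section
variable (k : Type u) [Field k]

/-- The indeterminate `q` of the field `k(q)`. -/
noncomputable abbrev q : RatFunc k := RatFunc.X

/-- The generators `E_i, F_i, K_i, K_i⁻¹`. -/
inductive Gen
  | E (i : Fin 3)
  | F (i : Fin 3)
  | K (i : Fin 3)
  | L (i : Fin 3)

/-- The free `k(q)`-algebra on the generators. -/
abbrev FreeU := FreeAlgebra (RatFunc k) Gen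

/-- A generator as an element of the free algebra. -/
noncomputable abbrev gen (x : Gen) : FreeU k := FreeAlgebra.ι (RatFunc k) x

open Gen in
/-- The defining relations of `U_q(sl₄)`. -/
inductive Rel : FreeU k → FreeU k → Prop
  | KL (i) : Rel (gen k (K i) * gen k (L i)) 1
  | LK (i) : Rel (gen k (L i) * gen k (K i)) 1
  | KK (i j) : Rel (gen k (K i) * gen k (K j)) (gen k (K j) * gen k (K i))
  | KE (i j) : Rel (gen k (K i) * gen k (E j)) (q k ^ cartan i j • (gen k (E j) * gen k (K i)))
  | KF (i j) : Rel (gen k (K i) * gen k (F j)) (q k ^ (-cartan i j) • (gen k (F j) * gen k (K i)))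
  | EF (i j) : Rel (gen k (E i) * gen k (F j) - gen k (F j) * gen k (E i))
      (if i = j then (q k - (q k)⁻¹)⁻¹ • (gen k (K i) - gen k (L i)) else 0)
  | EE (i j) (h : cartan i j = 0) : Rel (gen k (E i) * gen k (E j)) (gen k (E j) * gen k (E i))
  | EEE (i j) (h : cartan i j = -1) :
      Rel (gen k (E i) * gen k (E i) * gen k (E j)
        - (q k + (q k)⁻¹) • (gen k (E i) * gen k (E j) * gen k (E i))
        + gen k (E j) * gen k (E i) * gen k (E i)) 0
  | FF (i j) (h : cartan i j = 0) : Rel (gen k (F i) * gen k (F j)) (gen k (F j) * gen k (F i))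
  | FFF (i j) (h : cartan i j = -1) :
      Rel (gen k (F i) * gen k (F i) * gen k (F j)
        - (q k + (q k)⁻¹) • (gen k (F i) * gen k (F j) * gen k (F i))
        + gen k (F j) * gen k (F i) * gen k (F i)) 0

/-- The quantised enveloping algebra `U = U_q(sl₄)` over `k(q)`. -/
def Uq : Type u := RingQuot (Rel k)

noncomputable instance : Ring (Uq k) := inferInstanceAs (Ring (RingQuot (Rel k)))

noncomputable instance : Algebra (RatFunc k) (Uq k) :=
  inferInstanceAs (Algebra (RatFunc k) (RingQuot (Rel k)))

namespace Uq

/-- The projection from the free algebra. -/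
noncomputable def mk : FreeU k →ₐ[RatFunc k] Uq k := RingQuot.mkAlgHom (RatFunc k) (Rel k)

/-- The generator `E_i` of `U`. -/
noncomputable def E (i : Fin 3) : Uq k := mk k (gen k (Gen.E i))
/-- The generator `F_i` of `U`. -/
noncomputable def F (i : Fin 3) : Uq k := mk k (gen k (Gen.F i))
/-- The generator `K_i` of `U`. -/
noncomputable def K (i : Fin 3) : Uq k := mk k (gen k (Gen.K i))
/-- The generator `K_i⁻¹` of `U`. -/
noncomputable def Kinv (i : Fin 3) : Uq k := mk k (gen k (Gen.L i))

variable {k} in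
theorem mk_rel {x y : FreeU k} (h : Rel k x y) : mk k x = mk k y := RingQuot.mkAlgHom_rel _ h

theorem rel : DJRel (q k) (E k) (F k) (K k) (Kinv k) where
  KL i := by simpa [E, F, K, Kinv] using mk_rel (Rel.KL (k := k) i)
  LK i := by simpa [E, F, K, Kinv] using mk_rel (Rel.LK (k := k) i)
  KK i j := by simpa [E, F, K, Kinv] using mk_rel (Rel.KK (k := k) i j)
  KE i j := by simpa [E, F, K, Kinv] using mk_rel (Rel.KE (k := k) i j)
  KF i j := by simpa [E, F, K, Kinv] using mk_rel (Rel.KF (k := k) i j)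
  EF i j := by
    have h := mk_rel (Rel.EF (k := k) i j)
    split_ifs at h ⊢ <;> simpa [E, F, K, Kinv] using h
  EE i j h := by simpa [E, F, K, Kinv] using mk_rel (Rel.EE (k := k) i j h)
  EEE i j h := by simpa [E, F, K, Kinv] using mk_rel (Rel.EEE (k := k) i j h)
  FF i j h := by simpa [E, F, K, Kinv] using mk_rel (Rel.FF (k := k) i j h)
  FFF i j h := by simpa [E, F, K, Kinv] using mk_rel (Rel.FFF (k := k) i j h)

section
variable {k} {A : Type*} [Ring A] [Algebra (RatFunc k) A] {e f x y : Fin 3 → A}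

/-- The values of a homomorphism on the generators. -/
def genVal (e f x y : Fin 3 → A) : Gen → A
  | .E i => e i
  | .F i => f i
  | .K i => x i
  | .L i => y i

/-- The universal property of `U`. -/
noncomputable def lift (h : DJRel (q k) e f x y) : Uq k →ₐ[RatFunc k] A :=
  RingQuot.liftAlgHom (RatFunc k) ⟨FreeAlgebra.lift (RatFunc k) (genVal e f x y), by
    intro a b r
    cases r with
    | KL i => simpa [genVal] using h.KL i
    | LK i => simpa [genVal] using h.LK i
    | KK i j => simpa [genVal] using h.KK i j
    | KE i j => simpa [genVal] using h.KE i j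
    | KF i j => simpa [genVal] using h.KF i j
    | EF i j =>
      have := h.EF i j
      split_ifs at this ⊢ <;> simpa [genVal] using this
    | EE i j c => simpa [genVal] using h.EE i j c
    | EEE i j c => simpa [genVal] using h.EEE i j c
    | FF i j c => simpa [genVal] using h.FF i j c
    | FFF i j c => simpa [genVal] using h.FFF i j c⟩

theorem lift_mk (h : DJRel (q k) e f x y) (g : Gen) :
    lift h (mk k (gen k g)) = genVal e f x y g := by
  unfold lift mk gen
  erw [RingQuot.liftAlgHom_mkAlgHom_apply]
  simp

end

theorem q_facts : q k ≠ 0 ∧ 1 + q k ^ 2 ≠ 0 ∧ q k ^ 2 - 1 ≠ 0 := by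
  refine ⟨RatFunc.X_ne_zero, ?_, ?_⟩
  · have : (1 + q k ^ 2 : RatFunc k) =
        algebraMap (Polynomial k) (RatFunc k) (Polynomial.X ^ 2 + Polynomial.C 1) := by
      simp [add_comm]
    rw [this]
    exact RatFunc.algebraMap_ne_zero (Polynomial.X_pow_add_C_ne_zero (by norm_num) _)
  · have : (q k ^ 2 - 1 : RatFunc k) =
        algebraMap (Polynomial k) (RatFunc k) (Polynomial.X ^ 2 - Polynomial.C 1) := by
      simp
    rw [this]
    exact RatFunc.algebraMap_ne_zero (Polynomial.X_pow_sub_C_ne_zero (by norm_num) _)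

/-- Lusztig's braid group automorphism `T_i = T''_{i,1}` of `U`. -/
noncomputable def T (i : Fin 3) : Uq k →ₐ[RatFunc k] Uq k :=
  lift ((rel k).t (q_facts k).1 (q_facts k).2.1 (q_facts k).2.2 i)

theorem T_E (i j : Fin 3) : T k i (E k j) = tE (q k) (E k) (F k) (K k) i j := lift_mk _ _
theorem T_F (i j : Fin 3) : T k i (F k j) = tF (q k) (E k) (F k) (Kinv k) i j := lift_mk _ _
theorem T_K (i j : Fin 3) : T k i (K k j) = tK (K k) (Kinv k) i j := lift_mk _ _

end Uq

/-! ### The bar involutions of `k(q)` and of `U` -/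

/-- The bar involution of `k(q)`: the `k`-algebra automorphism with `q ↦ q⁻¹`. -/
noncomputable def barQ : RatFunc k →+* RatFunc k :=
  RatFunc.liftRingHom (Polynomial.aeval (q k)⁻¹ : Polynomial k →ₐ[k] RatFunc k).toRingHom
    (nonZeroDivisors_le_comap_nonZeroDivisors_of_injective _ (by
      have h : Transcendental k (q k)⁻¹ := fun h =>
        RatFunc.transcendental_X (IsAlgebraic.inv_iff.mp h)
      exact transcendental_iff_injective.mp h))

theorem barQ_q : barQ k (q k) = (q k)⁻¹ := by
  unfold barQ q
  rw [RatFunc.liftRingHom_X]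
  simp

theorem barQ_C (a : k) : barQ k (RatFunc.C a) = RatFunc.C a := by
  unfold barQ q
  rw [RatFunc.liftRingHom_C]
  simp

/-- The ring `U`, with the `k(q)`-algebra structure twisted by the bar involution of `k(q)`. -/
def BarUq : Type u := Uq k

noncomputable instance : Ring (BarUq k) := inferInstanceAs (Ring (Uq k))

noncomputable instance : Algebra (RatFunc k) (BarUq k) :=
  Algebra.compHom (Uq k) (barQ k)

theorem barSmul (a : RatFunc k) (x : BarUq k) :
    a • x = (show BarUq k from (barQ k a • (show Uq k from x) : Uq k)) := rfl

theorem barRel :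
    DJRel (A := BarUq k) (q k) (Uq.E k) (Uq.F k) (Uq.Kinv k) (Uq.K k) := by
  have h := Uq.rel k
  have hq := (Uq.q_facts k).1
  refine ⟨h.LK, h.KL, h.LL, fun i j => ?_, fun i j => ?_, fun i j => ?_, h.EE,
    fun i j c => ?_, h.FF, fun i j c => ?_⟩
  · rw [barSmul, map_zpow₀, barQ_q, inv_zpow']
    exact h.LE hq i j
  · rw [barSmul, map_zpow₀, barQ_q, inv_zpow', neg_neg]
    exact h.LF hq i j
  · refine (h.EF i j).trans ?_
    split_ifs
    · rw [barSmul, map_inv₀, map_sub, map_inv₀, barQ_q, inv_inv, ← neg_sub (q k), inv_neg]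
      change _ = -(q k - (q k)⁻¹)⁻¹ • (Uq.Kinv k i - Uq.K k i)
      rw [neg_smul, ← smul_neg, neg_sub]
    · rfl
  · rw [barSmul, map_add, map_inv₀, barQ_q, inv_inv, add_comm (q k)⁻¹]
    exact h.EEE i j c
  · rw [barSmul, map_add, map_inv₀, barQ_q, inv_inv, add_comm (q k)⁻¹]
    exact h.FFF i j c

/-- The bar involution `u ↦ ū` of `U`: the ring homomorphism with `E_i ↦ E_i`, `F_i ↦ F_i`,
`K_i ↦ K_i⁻¹` that restricts to the bar involution on `k(q)`. -/
noncomputable def barU : Uq k →+* Uq k := (Uq.lift (barRel k)).toRingHom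

theorem barU_E (i : Fin 3) : barU k (Uq.E k i) = Uq.E k i := Uq.lift_mk (barRel k) _
theorem barU_F (i : Fin 3) : barU k (Uq.F k i) = Uq.F k i := Uq.lift_mk (barRel k) _
theorem barU_K (i : Fin 3) : barU k (Uq.K k i) = Uq.Kinv k i := Uq.lift_mk (barRel k) _
theorem barU_smul (a : RatFunc k) (x : Uq k) : barU k (a • x) = barQ k a • barU k x :=
  map_smul (Uq.lift (barRel k)) a x

end

/-! ### The Satake diagram `AII₃`: nodes `1, 2, 3` with `X = {1, 3}` and `τ = id` -/

/-- The bilinear form `(-,-)` on the root lattice `Q = ℤα₁ ⊕ ℤα₂ ⊕ ℤα₃`. -/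
def form (l m : Fin 3 → ℤ) : ℤ := ∑ i, ∑ j, l i * cartan i j * m j

/-- The simple root `α_i`. -/
def simpleRoot (i : Fin 3) : Fin 3 → ℤ := Pi.single i 1

/-- The simple reflection `s_i` on `Q`. -/
def refl (i : Fin 3) (l : Fin 3 → ℤ) : Fin 3 → ℤ := l - form l (simpleRoot i) • simpleRoot i

/-- The involution `Θ = -w_X ∘ τ` of `Q`, where `w_X = s₁ s₃` and `τ = id`. -/
def Theta (l : Fin 3 → ℤ) : Fin 3 → ℤ := -refl 0 (refl 2 l)

/-- `2ρ_X`, the sum `α₁ + α₃` of the positive roots of the root system of `X`. -/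
def twoRhoX : Fin 3 → ℤ := simpleRoot 0 + simpleRoot 2

section
variable (k : Type u) [Field k]

/-- `K_i` as a unit of `U`. -/
noncomputable def Kunit (i : Fin 3) : (Uq k)ˣ :=
  ⟨Uq.K k i, Uq.Kinv k i, (Uq.rel k).KL i, (Uq.rel k).LK i⟩

/-- `K_λ = K₁^{λ₁} K₂^{λ₂} K₃^{λ₃}` for `λ` in `Q`. -/
noncomputable def Klam (l : Fin 3 → ℤ) : Uq k :=
  ↑(Kunit k 0 ^ l 0 * Kunit k 1 ^ l 1 * Kunit k 2 ^ l 2)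

/-- The subalgebra `M_X` of `U`, generated by `E_i, F_i, K_i, K_i⁻¹` for `i` in `X`. -/
noncomputable def MX : Subalgebra (RatFunc k) (Uq k) :=
  Algebra.adjoin (RatFunc k)
    {x | ∃ i : Fin 3, (i = 0 ∨ i = 2) ∧
      (x = Uq.E k i ∨ x = Uq.F k i ∨ x = Uq.K k i ∨ x = Uq.Kinv k i)}

/-- The subalgebra `U_Θ⁰`, generated by the `K_λ` with `Θ(λ) = λ`. -/
noncomputable def UTheta : Subalgebra (RatFunc k) (Uq k) :=
  Algebra.adjoin (RatFunc k) {x | ∃ l : Fin 3 → ℤ, Theta l = l ∧ x = Klam k l}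

/-- The element `T_{w_X}(E₂) = T₁₃(E₂)`, where `T₁₃ = T₁ ∘ T₃`. -/
noncomputable def T13E2 : Uq k := Uq.T k 0 (Uq.T k 2 (Uq.E k 1))

variable {k}

/-- The generator `B₂ = F₂ - c₂ T_{w_X}(E₂) K₂⁻¹`. -/
noncomputable def B2 (c : RatFunc k) : Uq k := Uq.F k 1 - c • (T13E2 k * Uq.Kinv k 1)

/-- The quantum symmetric pair coideal subalgebra `B_c` of `U`, generated by `M_X`, `U_Θ⁰`
and `B₂`. -/
noncomputable def Bc (c : RatFunc k) : Subalgebra (RatFunc k) (Uq k) :=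
  Algebra.adjoin (RatFunc k) (↑(MX k) ∪ ↑(UTheta k) ∪ {B2 c})

/-- `β` is the bar involution of `B_c`: it agrees with the bar involution of `U` on the subalgebra
`M_X U_Θ⁰` (which contains the scalars `k(q)`; so `β` is `k`-linear and maps `q` to `q⁻¹`), and it
fixes `B₂`. -/
structure IsBarInvolution (c : RatFunc k) (β : Bc c ≃+* Bc c) : Prop where
  on_MU : ∀ b : Bc c, (b : Uq k) ∈ MX k ⊔ UTheta k → (β b : Uq k) = barU k b
  on_B : ∀ b : Bc c, (b : Uq k) = B2 c → (β b : Uq k) = B2 c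

/-! ### The completion and the quasi `K`-matrix -/

variable (k) in
/-- The subalgebra `U⁺`, generated by the `E_i`. -/
noncomputable def Uplus : Subalgebra (RatFunc k) (Uq k) :=
  Algebra.adjoin (RatFunc k) (Set.range (Uq.E k))

variable (k) in
/-- `x` lies in the weight space `U⁺_μ`, where `μ = μ₁α₁ + μ₂α₂ + μ₃α₃` is in `Q⁺`: `x ∈ U⁺` and
`K_i x K_i⁻¹ = q^{(μ, α_i)} x` for all `i`. -/
def IsUplusWeight (μ : Fin 3 → ℕ) (x : Uq k) : Prop :=
  x ∈ Uplus k ∧ ∀ i, Uq.K k i * x * Uq.Kinv k i =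
    q k ^ form (fun j => (μ j : ℤ)) (simpleRoot i) • x

section
variable (M : Type*) [AddCommGroup M] [Module (RatFunc k) M] [Module (Uq k) M]
  [IsScalarTower (RatFunc k) (Uq k) M]

/-- The weight space of a `U`-module on which every `K_i` acts by `q ^ n i`; the weights `λ` of
`sl₄` correspond to the vectors `n` of integers through `n i = (λ, α_i)`. -/
def weightSpace (n : Fin 3 → ℤ) : Submodule (RatFunc k) M where
  carrier := {m | ∀ i, Uq.K k i • m = q k ^ n i • m}
  zero_mem' i := by simp
  add_mem' ha hb i := by rw [smul_add, smul_add, ha i, hb i]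
  smul_mem' a m hm i := by
    have : SMulCommClass (Uq k) (RatFunc k) M := IsScalarTower.to_smulCommClass'
    rw [smul_comm, hm i, smul_comm]

/-- `M` is a finite dimensional `U`-module of type `1`: it is the (direct) sum of its weight
spaces for the weights in the weight lattice. -/
structure IsTypeOne : Prop where
  finite : Module.Finite (RatFunc k) M
  iSup_weightSpace : ⨆ n : Fin 3 → ℤ, weightSpace (k := k) M n = (⊤ : Submodule (RatFunc k) M)

end

/-- The action on a finite dimensional module of type `1` of the element `∑_μ X_μ` of the completion
`∏_μ U⁺_μ` of `U⁺`. All but finitely many of the `X_μ` act on such a module by zero. -/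
noncomputable def act {M : Type*} [AddCommGroup M] [Module (Uq k) M] (X : (Fin 3 → ℕ) → Uq k)
    (m : M) : M := ∑ᶠ μ, X μ • m

/-- The element `X = ∑_μ X_μ` with `X_μ ∈ U⁺_μ` is the quasi `K`-matrix of `B_c`: `X_0 = 1`, and
`β(b) X = X b̄` for all `b` in `B_c`, where `β` is the bar involution of `B_c`. The last equation is
one in the algebra of natural endomorphisms of the forgetful functor from finite dimensional
`U`-modules of type `1` to vector spaces: both sides act equally on all these modules. -/
def IsQuasiK (c : RatFunc k) (X : (Fin 3 → ℕ) → Uq k) : Prop :=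
  (∀ μ, IsUplusWeight k μ (X μ)) ∧ X 0 = 1 ∧
  ∃ β : Bc c ≃+* Bc c, IsBarInvolution c β ∧
    ∀ (M : Type u) [AddCommGroup M] [Module (RatFunc k) M] [Module (Uq k) M]
      [IsScalarTower (RatFunc k) (Uq k) M], IsTypeOne (k := k) M →
      ∀ (b : Bc c) (m : M), (β b : Uq k) • act X m = act X (barU k b • m)

variable (k) in
/-- `{n} = q^{n-1} [n] = 1 + q² + ⋯ + q^{2(n-1)}`. -/
noncomputable def qnum (n : ℕ) : RatFunc k := ∑ j ∈ Finset.range n, q k ^ (2 * j)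

variable (k) in
/-- `{n}! = {1} {2} ⋯ {n}`. -/
noncomputable def qfact (n : ℕ) : RatFunc k := ∏ j ∈ Finset.range n, qnum k (j + 1)

/-- The `a`-commutator `[x, y]_a = x y - a y x`. -/
noncomputable def qcomm (x y : Uq k) (a : RatFunc k) : Uq k := x * y - a • (y * x)

end

end QSP

open QSP

/-!
Write `e = [E₂, T₁₃(E₂)]_{q⁻²}` and let `quasiK c` be the family given by the formula, with members
multiples of the powers of `e`.

The formula solves the intertwining equations. With `Y = T₁₃(E₂) = [E₁, [E₃, E₂]]`, the quantum
Serre relations show that `e` commutes with `E₁`, `E₃`, `Y` and the bar conjugate of `Y`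
(`SerreTriple.mul_core`, `SerreTriple.core_mul`, `SerreTriple.core_mul_bar`), and `e` also commutes
with `F₁` and `F₃`, so that it commutes with all of `M_X`. The commutator of `F₂` with `e` is a
combination of `Y K₂⁻¹` and of its bar conjugate. As `e` commutes with `Y` and its bar conjugate,
and commutes with `K₂` up to `q ^ 2`, the commutator of `F₂` with `e ^ n` acquires the factor `{n}`
(`DJRel.F_one_mul_core_pow`), and the equation for `B₂` becomes the recursion that the coefficients
`(q c)ⁿ / {n}!` satisfy (`defect_quasiK`).

The bar involution of `B_c` exists. On a finite dimensional module of type `1` the element `e` acts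
nilpotently, so the operator given by the formula is bijective (`bijective_act_quasiK`). Hence
conjugation by this operator turns the bar involution of `U` into a bar involution of `B_c`
(`exists_ringEquiv_intertwines`), as soon as finite dimensional modules of type `1` separate the
elements of `U` (`eq_zero_of_isTypeOne`).

The solution is unique. An equation between operators on all modules of type `1` splits into weight
components, each of which is an equation in `U` (`Homog.eq_zero`). Thus the components of a quasi
`K`-matrix commute with `F₁` and `F₃`, while their commutators with `F₂` are determined by
components of lower height. The difference of two solutions therefore has a lowest component that
commutes with all `F_i`, and an element of `U⁺` of nonzero weight with this property is zero
(`eq_zero_of_commute_F`, `eq_of_defect`).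

The last statement and the separation property rest on the Poincaré-Birkhoff-Witt theorem for `U`.
The monomials `F^a K_λ E^b` span `U` by the commutation rules between root vectors (`span_fullPBW`).
Their independence comes from an explicit action: `U` acts on Laurent polynomials in four variables
by `q`-difference operators, and in the tensor cube of this representation the monomials `E^b` map
`x₄^A ⊗ x₃^B ⊗ x₂^C` to nonzero multiples of distinct basis vectors (`lau3_pbw`). Tensoring the cube
with its twist by the automorphism `ω`, which exchanges the `E_i` with the `F_i`, one reads off the
leading terms of the action of `F^a K_λ E^b` (`exists_lead_fullPBW`) and separates the `K_λ` by
varying `A, B, C` (`eq_zero_of_lau6_eq_zero`). The vectors used lie in finite dimensional submodules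
of type `1`, which also gives the separation property. The skew derivations of `U⁺`, evaluated on
the basis, then show that only scalars in `U⁺` commute with all `F_i`.
-/

set_option linter.unusedSimpArgs false
set_option linter.unnecessarySeqFocus false

namespace QSP

open scoped TensorProduct

universe w

/-! ### The element `[E₂, T₁₃(E₂)]_{q⁻²}` -/

section
variable {R A : Type*} [Field R] [Ring A] [Algebra R A] {q : R}

/-- The `q`-commutator `x y - q⁻¹ y x`, written `[x, y]` in the comments. -/
def qbr (q : R) (x y : A) : A := x * y - q⁻¹ • (y * x)

theorem mul_eq_qbr_add (q : R) (x y : A) : x * y = qbr q x y + q⁻¹ • (y * x) := by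
  unfold qbr; abel

/-- The quantum Serre relation for `x, x, y` says that `x` and `[x, y]` commute up to `q`. -/
theorem mul_qbr_of_serre (hq : q ≠ 0) {x y : A}
    (h : x * x * y - (q + q⁻¹) • (x * y * x) + y * x * x = 0) :
    x * qbr q x y = q • (qbr q x y * x) := by
  unfold qbr
  simp only [mul_sub, sub_mul, smul_mul_assoc, mul_smul_comm, mul_assoc] at h ⊢
  linear_combination (norm := (match_scalars <;> field_simp <;> ring)) h

/-- The quantum Serre relation for `y, y, x` says that `[x, y]` and `y` commute up to `q`. -/
theorem qbr_mul_of_serre (hq : q ≠ 0) {x y : A}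
    (h : y * y * x - (q + q⁻¹) • (y * x * y) + x * y * y = 0) :
    qbr q x y * y = q • (y * qbr q x y) := by
  unfold qbr
  simp only [mul_sub, sub_mul, smul_mul_assoc, mul_smul_comm, mul_assoc] at h ⊢
  linear_combination (norm := (match_scalars <;> field_simp <;> ring)) h

/-- The element `[y, Y]_{q⁻²}`, where `Y = [x, [z, y]]`. For the generators `E₁, E₂, E₃` the element
`Y` is `T₁₃(E₂)`. -/
def core (q : R) (x y z : A) : A :=
  y * qbr q x (qbr q z y) - (q⁻¹ * q⁻¹) • (qbr q x (qbr q z y) * y)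

theorem qbr_inv (hq : q ≠ 0) (x y : A) : qbr q⁻¹ x y = qbr q x y + (q⁻¹ - q) • (y * x) := by
  unfold qbr; match_scalars <;> field_simp <;> ring

/-- `x, y, z` satisfy the relations of the generators `E₁, E₂, E₃` of `U⁺`. -/
structure SerreTriple (q : R) (x y z : A) : Prop where
  comm : x * z = z * x
  xxy : x * x * y - (q + q⁻¹) • (x * y * x) + y * x * x = 0
  yyx : y * y * x - (q + q⁻¹) • (y * x * y) + x * y * y = 0
  zzy : z * z * y - (q + q⁻¹) • (z * y * z) + y * z * z = 0
  yyz : y * y * z - (q + q⁻¹) • (y * z * y) + z * y * y = 0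

namespace SerreTriple
variable {x y z : A}

theorem symm (h : SerreTriple q x y z) : SerreTriple q z y x :=
  ⟨h.comm.symm, h.zzy, h.yyz, h.xxy, h.yyx⟩

theorem qbr_qbr_comm (h : SerreTriple q x y z) : qbr q x (qbr q z y) = qbr q z (qbr q x y) := by
  have hxz' : ∀ t : A, z * (x * t) = x * (z * t) := fun t => by
    rw [← mul_assoc, ← h.comm, mul_assoc]
  unfold qbr
  simp only [mul_sub, sub_mul, smul_mul_assoc, mul_smul_comm, mul_assoc, h.comm, hxz', smul_sub]
  abel

theorem qbr_comm (h : SerreTriple q x y z) (hq : q ≠ 0) (h2 : 1 + q ^ 2 ≠ 0) :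
    qbr q x y * qbr q z y = qbr q z y * qbr q x y := by
  have hi2 : 1 + q⁻¹ ^ 2 ≠ 0 := by
    have : 1 + q⁻¹ ^ 2 = (1 + q ^ 2) / q ^ 2 := by field_simp; ring
    rw [this]; exact div_ne_zero h2 (pow_ne_zero 2 hq)
  have key := t_comm_near (q := q⁻¹) (x := x) (y := y) (z := z) (inv_ne_zero hq) hi2 rfl rfl h.comm
    (by simpa [add_comm] using h.yyx) (by simpa [add_comm] using h.yyz)
  have e1 : ∀ u v : A, qbr q u v = -q⁻¹ • (v * u - q⁻¹⁻¹ • (u * v)) := fun u v => by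
    unfold qbr; match_scalars <;> field_simp
  rw [e1, e1, smul_mul_smul_comm, smul_mul_smul_comm, key]

theorem mul_qbr_qbr (h : SerreTriple q x y z) (hq : q ≠ 0) :
    x * qbr q x (qbr q z y) = q • (qbr q x (qbr q z y) * x) := by
  have s := mul_qbr_of_serre hq h.xxy
  rw [h.qbr_qbr_comm]
  generalize qbr q x y = a at s
  have hxz' : ∀ t : A, x * (z * t) = z * (x * t) := fun t => by
    rw [← mul_assoc, h.comm, mul_assoc]
  have s' : ∀ t, x * (a * t) = q • (a * (x * t)) := fun t => by
    rw [← mul_assoc, s, smul_mul_assoc, mul_assoc]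
  unfold qbr
  simp only [mul_sub, sub_mul, smul_mul_assoc, mul_smul_comm, mul_assoc, hxz', smul_sub,
    s, s', h.comm]
  match_scalars <;> field_simp

/-- With the next lemma, one of the rules that bring words in `y, [x, y], [z, y], [x, [z, y]], x, z`
into this order. -/
theorem qbr_mul_qbr_qbr (h : SerreTriple q x y z) (hq : q ≠ 0) (h2 : 1 + q ^ 2 ≠ 0) :
    qbr q x (qbr q z y) * qbr q z y = q • (qbr q z y * qbr q x (qbr q z y)) := by
  have c := h.qbr_comm hq h2
  have s := qbr_mul_of_serre hq h.yyx
  have s2 := qbr_mul_of_serre hq h.yyz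
  have s3 := mul_qbr_of_serre hq h.zzy
  rw [h.qbr_qbr_comm]
  generalize qbr q x y = a at *
  generalize qbr q z y = b at *
  have c' : ∀ t, a * (b * t) = b * (a * t) := fun t => by rw [← mul_assoc, c, mul_assoc]
  have s3' : ∀ t, z * (b * t) = q • (b * (z * t)) := fun t => by
    rw [← mul_assoc, s3, smul_mul_assoc, mul_assoc]
  unfold qbr
  simp only [mul_sub, sub_mul, smul_mul_assoc, mul_smul_comm, mul_assoc, smul_sub,
    c, c', s3, s3']
  try (match_scalars <;> field_simp)

theorem qbr_qbr_mul (h : SerreTriple q x y z) (hq : q ≠ 0) (h2 : 1 + q ^ 2 ≠ 0) :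
    qbr q x (qbr q z y) * y =
      y * qbr q x (qbr q z y) + (q - q⁻¹) • (qbr q x y * qbr q z y) := by
  have c := h.qbr_comm hq h2
  have s2 := qbr_mul_of_serre hq h.yyz
  have e := mul_eq_qbr_add q x y
  generalize qbr q x y = a at *
  generalize qbr q z y = b at *
  have e' : ∀ t, x * (y * t) = a * t + q⁻¹ • (y * (x * t)) := fun t => by
    rw [← mul_assoc, e, add_mul, smul_mul_assoc, mul_assoc]
  have s2' : ∀ t, b * (y * t) = q • (y * (b * t)) := fun t => by
    rw [← mul_assoc, s2, smul_mul_assoc, mul_assoc]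
  unfold qbr
  simp only [mul_sub, sub_mul, smul_mul_assoc, mul_smul_comm, mul_assoc, mul_add,
    c, s2, s2', e, e']
  match_scalars <;> field_simp

/-- Normal form of `core`: a multiple of `y Y - q⁻¹ [x, y] [z, y]`. -/
theorem core_eq (h : SerreTriple q x y z) (hq : q ≠ 0) (h2 : 1 + q ^ 2 ≠ 0) :
    core q x y z = (1 - q⁻¹ * q⁻¹) •
      (y * qbr q x (qbr q z y) - q⁻¹ • (qbr q x y * qbr q z y)) := by
  rw [core, h.qbr_qbr_mul hq h2]
  match_scalars <;> field_simp

theorem core_symm (h : SerreTriple q x y z) : core q z y x = core q x y z := by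
  unfold core
  rw [h.qbr_qbr_comm]

theorem mul_core (h : SerreTriple q x y z) (hq : q ≠ 0) (h2 : 1 + q ^ 2 ≠ 0) :
    x * core q x y z = core q x y z * x := by
  have s := mul_qbr_of_serre hq h.xxy
  have s1 := h.mul_qbr_qbr hq
  have s2 := (h.symm.qbr_mul_qbr_qbr hq h2)
  rw [← h.qbr_qbr_comm] at s2
  have e := mul_eq_qbr_add q x y
  have e2 := mul_eq_qbr_add q x (qbr q z y)
  rw [h.core_eq hq h2]
  generalize qbr q x (qbr q z y) = Y at *
  generalize qbr q x y = a at *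
  generalize qbr q z y = b at *
  have s' : ∀ t, x * (a * t) = q • (a * (x * t)) := fun t => by
    rw [← mul_assoc, s, smul_mul_assoc, mul_assoc]
  have e' : ∀ t, x * (y * t) = a * t + q⁻¹ • (y * (x * t)) := fun t => by
    rw [← mul_assoc, e, add_mul, smul_mul_assoc, mul_assoc]
  simp only [mul_sub, sub_mul, smul_mul_assoc, mul_smul_comm, mul_assoc, smul_sub, smul_add,
    mul_add, e', s', s1, e2]
  match_scalars <;> field_simp <;> ring

theorem core_mul (h : SerreTriple q x y z) (hq : q ≠ 0) (h2 : 1 + q ^ 2 ≠ 0) :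
    core q x y z * qbr q x (qbr q z y) = qbr q x (qbr q z y) * core q x y z := by
  have s1 := h.qbr_mul_qbr_qbr hq h2
  have s2 := (h.symm.qbr_mul_qbr_qbr hq h2)
  have s3 := h.qbr_qbr_mul hq h2
  rw [← h.qbr_qbr_comm] at s2
  rw [h.core_eq hq h2]
  generalize qbr q x (qbr q z y) = Y at *
  generalize qbr q x y = a at *
  generalize qbr q z y = b at *
  have s2' : ∀ t, Y * (a * t) = q • (a * (Y * t)) := fun t => by
    rw [← mul_assoc, s2, smul_mul_assoc, mul_assoc]
  have s3' : ∀ t, Y * (y * t) = y * (Y * t) + (q - q⁻¹) • (a * (b * t)) := fun t => by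
    rw [← mul_assoc, s3, add_mul, smul_mul_assoc, mul_assoc, mul_assoc]
  simp only [mul_sub, sub_mul, smul_mul_assoc, mul_smul_comm, mul_assoc, smul_sub, smul_add,
    mul_add, s1, s2', s3']
  match_scalars <;> field_simp <;> ring

/-- The normal form of the element obtained from `[x, [z, y]]` by inverting `q`, that is, of its
image under the bar involution. -/
theorem qbr_inv_qbr_inv (h : SerreTriple q x y z) (hq : q ≠ 0) :
    qbr q⁻¹ x (qbr q⁻¹ z y) = qbr q x (qbr q z y) + (q⁻¹ - q) • (qbr q z y * x)
      + (q⁻¹ - q) • (qbr q x y * z) + ((q⁻¹ - q) * (q⁻¹ - q)) • (y * (x * z)) := by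
  have e := mul_eq_qbr_add q x y
  have e2 := mul_eq_qbr_add q x (qbr q z y)
  rw [qbr_inv hq x, qbr_inv hq z, show ∀ t, qbr q x t = x * t - q⁻¹ • (t * x) from fun _ => rfl]
  generalize qbr q x (qbr q z y) = Y at *
  have e' : ∀ t, x * (y * t) = qbr q x y * t + q⁻¹ • (y * (x * t)) := fun t => by
    rw [← mul_assoc, e, add_mul, smul_mul_assoc, mul_assoc]
  generalize qbr q x y = a at *
  generalize qbr q z y = b at *
  simp only [mul_sub, sub_mul, smul_mul_assoc, mul_smul_comm, mul_assoc, smul_sub, smul_add,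
    mul_add, add_mul, e', e2, h.comm]
  match_scalars <;> field_simp <;> ring

/-- `core` also commutes with the bar conjugate of `Y`. -/
theorem core_mul_bar (h : SerreTriple q x y z) (hq : q ≠ 0) (h2 : 1 + q ^ 2 ≠ 0) :
    core q x y z * qbr q⁻¹ x (qbr q⁻¹ z y) = qbr q⁻¹ x (qbr q⁻¹ z y) * core q x y z := by
  have cx := h.mul_core hq h2
  have cz := h.symm.mul_core hq h2
  rw [h.core_symm] at cz
  -- modulo the centraliser of `core`, the claim is that `core` commutes with this combination
  have key : core q x y z * (qbr q z y * x + qbr q x y * z + (q⁻¹ - q) • (y * (x * z))) =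
      (qbr q z y * x + qbr q x y * z + (q⁻¹ - q) • (y * (x * z))) * core q x y z := by
    have s := mul_qbr_of_serre hq h.xxy
    have t := mul_qbr_of_serre hq h.zzy
    have e := mul_eq_qbr_add q x y
    have f := mul_eq_qbr_add q z y
    have e2 := mul_eq_qbr_add q x (qbr q z y)
    have f2 := mul_eq_qbr_add q z (qbr q x y)
    rw [← h.qbr_qbr_comm] at f2
    have u1 := h.qbr_mul_qbr_qbr hq h2
    have u2 := (h.symm.qbr_mul_qbr_qbr hq h2)
    have u3 := h.qbr_qbr_mul hq h2
    have u4 := h.mul_qbr_qbr hq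
    have u5 := h.symm.mul_qbr_qbr hq
    have c := h.qbr_comm hq h2
    have ay := qbr_mul_of_serre hq h.yyx
    have cy := qbr_mul_of_serre hq h.yyz
    have hxz := h.comm
    rw [← h.qbr_qbr_comm] at u2 u5
    rw [h.core_eq hq h2]
    generalize qbr q x (qbr q z y) = Y at *
    generalize qbr q x y = a at *
    generalize qbr q z y = b at *
    clear cx cz h
    have sm : ∀ {u v w : A} {r : R}, u * v = r • w → ∀ t, u * (v * t) = r • (w * t) :=
      fun e t => by rw [← mul_assoc, e, smul_mul_assoc]
    have ad : ∀ {u v w w' : A} {r : R}, u * v = w + r • w' →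
        ∀ t, u * (v * t) = w * t + r • (w' * t) :=
      fun e t => by rw [← mul_assoc, e, add_mul, smul_mul_assoc]
    have cc : ∀ {u v w : A}, u * v = w → ∀ t, u * (v * t) = w * t :=
      fun e t => by rw [← mul_assoc, e]
    simp only [mul_sub, sub_mul, smul_mul_assoc, mul_smul_comm, mul_assoc, smul_sub, smul_add,
      mul_add, add_mul, s, t, e, f, e2, f2, u1, u2, u3, u4, u5, c, ay, cy, hxz.symm, sm s, sm t,
      ad e, ad f, ad e2, ad f2, sm u1, sm u2, ad u3, sm u4, sm u5, cc c, sm ay, sm cy, cc hxz.symm]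
    match_scalars <;> field_simp <;> ring
  have c0 := h.core_mul hq h2
  rw [h.qbr_inv_qbr_inv hq]
  have : qbr q x (qbr q z y) + (q⁻¹ - q) • (qbr q z y * x)
      + (q⁻¹ - q) • (qbr q x y * z) + ((q⁻¹ - q) * (q⁻¹ - q)) • (y * (x * z)) =
      qbr q x (qbr q z y) + (q⁻¹ - q) • (qbr q z y * x + qbr q x y * z +
        (q⁻¹ - q) • (y * (x * z))) := by
    match_scalars <;> ring
  rw [this, mul_add, add_mul, c0, mul_smul_comm, smul_mul_assoc, key]

end SerreTriple

theorem DJRel.serreTriple {E F K L : Fin 3 → A} (h : DJRel q E F K L) :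
    SerreTriple q (E 0) (E 1) (E 2) :=
  ⟨h.EE 0 2 rfl, h.EEE 0 1 rfl, h.EEE 1 0 rfl, h.EEE 2 1 rfl, h.EEE 1 2 rfl⟩

namespace DJRel
variable {E F K L : Fin 3 → A}

theorem commute_EF (h : DJRel q E F K L) {i j : Fin 3} (hij : i ≠ j) : E i * F j = F j * E i := by
  have := h.EF i j
  rw [if_neg hij] at this
  exact sub_eq_zero.mp this

/-- `F₁` commutes with `[E₂, T₁₃(E₂)]_{q⁻²}`. -/
theorem F_zero_mul_core (h : DJRel q E F K L) (hq : q ≠ 0) (hq' : q ^ 2 - 1 ≠ 0) :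
    core q (E 0) (E 1) (E 2) * F 0 = F 0 * core q (E 0) (E 1) (E 2) := by
  have s2 := qbr_mul_of_serre hq h.serreTriple.yyz
  have e1 : E 0 * F 0 = F 0 * E 0 + (q - q⁻¹)⁻¹ • (K 0 - L 0) := by
    have := h.EF 0 0
    rw [if_pos rfl] at this
    rw [← this]; abel
  have hd : (q - q⁻¹)⁻¹ = q * (q ^ 2 - 1)⁻¹ := by field_simp
  rw [hd] at e1
  have f1 : E 1 * F 0 = F 0 * E 1 := h.commute_EF (by decide)
  have f2 : qbr q (E 2) (E 1) * F 0 = F 0 * qbr q (E 2) (E 1) := by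
    have : E 2 * F 0 = F 0 * E 2 := h.commute_EF (by decide)
    unfold qbr
    simp only [sub_mul, smul_mul_assoc, mul_assoc, f1, this, mul_sub, mul_smul_comm]
    simp only [← mul_assoc, f1, this]
  have k1 : K 0 * E 1 = q⁻¹ • (E 1 * K 0) := by simpa [cartan] using h.KE 0 1
  have k2 : K 0 * qbr q (E 2) (E 1) = q⁻¹ • (qbr q (E 2) (E 1) * K 0) := by
    have : K 0 * E 2 = E 2 * K 0 := by simpa [cartan] using h.KE 0 2
    have k1' : ∀ t, K 0 * (E 1 * t) = q⁻¹ • (E 1 * (K 0 * t)) := fun t => by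
      rw [← mul_assoc, k1, smul_mul_assoc, mul_assoc]
    have this' : ∀ t, K 0 * (E 2 * t) = E 2 * (K 0 * t) := fun t => by
      rw [← mul_assoc, this, mul_assoc]
    unfold qbr
    simp only [mul_sub, sub_mul, mul_smul_comm, smul_mul_assoc, mul_assoc, k1, k1', this, this']
    match_scalars <;> field_simp
  have l1 : L 0 * E 1 = q • (E 1 * L 0) := by simpa [cartan] using h.LE hq 0 1
  have l2 : L 0 * qbr q (E 2) (E 1) = q • (qbr q (E 2) (E 1) * L 0) := by
    have : L 0 * E 2 = E 2 * L 0 := by simpa [cartan] using h.LE hq 0 2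
    have l1' : ∀ t, L 0 * (E 1 * t) = q • (E 1 * (L 0 * t)) := fun t => by
      rw [← mul_assoc, l1, smul_mul_assoc, mul_assoc]
    have this' : ∀ t, L 0 * (E 2 * t) = E 2 * (L 0 * t) := fun t => by
      rw [← mul_assoc, this, mul_assoc]
    unfold qbr
    simp only [mul_sub, sub_mul, mul_smul_comm, smul_mul_assoc, mul_assoc, l1, l1', this, this']
    match_scalars <;> field_simp
  unfold core
  rw [show qbr q (E 0) (qbr q (E 2) (E 1)) = E 0 * qbr q (E 2) (E 1) -
    q⁻¹ • (qbr q (E 2) (E 1) * E 0) from rfl]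
  generalize qbr q (E 2) (E 1) = b at *
  have sm : ∀ {u v w : A} {r : R}, u * v = r • w → ∀ t, u * (v * t) = r • (w * t) :=
    fun e t => by rw [← mul_assoc, e, smul_mul_assoc]
  have cc : ∀ {u v w : A}, u * v = w → ∀ t, u * (v * t) = w * t :=
    fun e t => by rw [← mul_assoc, e]
  simp only [mul_sub, sub_mul, mul_add, add_mul, smul_sub, smul_add, smul_mul_assoc,
    mul_smul_comm, mul_assoc, e1, f1, f2, k1, k2, l1, l2, cc e1, cc f1, cc f2, sm k1, sm k2,
    sm l1, sm l2, s2, sm s2]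
  match_scalars <;> field_simp <;> ring

theorem F_two_mul_core (h : DJRel q E F K L) (hq : q ≠ 0) (hq' : q ^ 2 - 1 ≠ 0) :
    core q (E 0) (E 1) (E 2) * F 2 = F 2 * core q (E 0) (E 1) (E 2) := by
  rw [← h.serreTriple.core_symm]
  -- the diagram automorphism exchanges the nodes `1` and `3`
  have hr : DJRel q (fun i => E i.rev) (fun i => F i.rev) (fun i => K i.rev)
      (fun i => L i.rev) := by
    have hc : ∀ i j : Fin 3, cartan i j = cartan i.rev j.rev := by
      intro i j; fin_cases i <;> fin_cases j <;> rfl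
    refine ⟨fun i => h.KL _, fun i => h.LK _, fun i j => h.KK _ _, fun i j => ?_, fun i j => ?_,
      fun i j => ?_, fun i j c => h.EE _ _ (hc i j ▸ c), fun i j c => h.EEE _ _ (hc i j ▸ c),
      fun i j c => h.FF _ _ (hc i j ▸ c), fun i j c => h.FFF _ _ (hc i j ▸ c)⟩
    · rw [hc]; exact h.KE _ _
    · rw [hc]; exact h.KF _ _
    · rw [h.EF]; simp only [Fin.rev_inj]
  exact hr.F_zero_mul_core hq hq'

/-- The commutator of `F₂` with `[E₂, T₁₃(E₂)]_{q⁻²}`: it only involves `T₁₃(E₂) K₂⁻¹` and its bar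
conjugate, the terms of `B₂` and of its bar conjugate. -/
theorem F_one_mul_core (h : DJRel q E F K L) (hq : q ≠ 0) (hq' : q ^ 2 - 1 ≠ 0) :
    F 1 * core q (E 0) (E 1) (E 2) - core q (E 0) (E 1) (E 2) * F 1 =
      q⁻¹ • (qbr q (E 0) (qbr q (E 2) (E 1)) * L 1 -
        (q⁻¹ * q⁻¹) • (qbr q⁻¹ (E 0) (qbr q⁻¹ (E 2) (E 1)) * K 1)) := by
  have e1 : E 1 * F 1 = F 1 * E 1 + (q - q⁻¹)⁻¹ • (K 1 - L 1) := by
    have := h.EF 1 1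
    rw [if_pos rfl] at this
    rw [← this]; abel
  have hd : (q - q⁻¹)⁻¹ = q * (q ^ 2 - 1)⁻¹ := by field_simp
  rw [hd] at e1
  have f0 : E 0 * F 1 = F 1 * E 0 := h.commute_EF (by decide)
  have f2 : E 2 * F 1 = F 1 * E 2 := h.commute_EF (by decide)
  have k0 : K 1 * E 0 = q⁻¹ • (E 0 * K 1) := by simpa [cartan] using h.KE 1 0
  have k2 : K 1 * E 2 = q⁻¹ • (E 2 * K 1) := by simpa [cartan] using h.KE 1 2
  have k1 : K 1 * E 1 = (q * q) • (E 1 * K 1) := by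
    have := h.KE 1 1; rw [show cartan 1 1 = 2 from rfl] at this; rw [this]; congr 1
    rw [zpow_ofNat, pow_two]
  have l0 : L 1 * E 0 = q • (E 0 * L 1) := by simpa [cartan] using h.LE hq 1 0
  have l2 : L 1 * E 2 = q • (E 2 * L 1) := by simpa [cartan] using h.LE hq 1 2
  have l1 : L 1 * E 1 = (q⁻¹ * q⁻¹) • (E 1 * L 1) := by
    have := h.LE hq 1 1; rw [show cartan 1 1 = 2 from rfl] at this; rw [this]; congr 1
    rw [zpow_neg, zpow_ofNat, pow_two, mul_inv]
  have z := h.EE 0 2 rfl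
  have sm : ∀ {u v w : A} {r : R}, u * v = r • w → ∀ t, u * (v * t) = r • (w * t) :=
    fun e t => by rw [← mul_assoc, e, smul_mul_assoc]
  have cc : ∀ {u v w : A}, u * v = w → ∀ t, u * (v * t) = w * t :=
    fun e t => by rw [← mul_assoc, e]
  unfold core qbr
  simp only [mul_sub, sub_mul, mul_add, add_mul, smul_sub, smul_add, smul_mul_assoc,
    mul_smul_comm, mul_assoc, e1, f0, f2, k0, k1, k2, l0, l1, l2, cc e1, cc f0, cc f2, sm k0,
    sm k1, sm k2, sm l0, sm l1, sm l2, z, cc z, inv_inv]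
  match_scalars <;> field_simp <;> ring

/-- The commutator of `F₂` with the powers of `[E₂, T₁₃(E₂)]_{q⁻²}`. The factor is `q⁻¹ {n}`,
because `K₂` and this element commute up to `q ^ 2`. -/
theorem F_one_mul_core_pow (h : DJRel q E F K L) (hq : q ≠ 0) (h2 : 1 + q ^ 2 ≠ 0)
    (hq' : q ^ 2 - 1 ≠ 0) (n : ℕ) :
    F 1 * core q (E 0) (E 1) (E 2) ^ n - core q (E 0) (E 1) (E 2) ^ n * F 1 =
      (q⁻¹ * ∑ j ∈ Finset.range n, q ^ (2 * j)) •
        (qbr q (E 0) (qbr q (E 2) (E 1)) * L 1 * core q (E 0) (E 1) (E 2) ^ (n - 1) -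
        (q⁻¹ * q⁻¹) • (core q (E 0) (E 1) (E 2) ^ (n - 1) *
          qbr q⁻¹ (E 0) (qbr q⁻¹ (E 2) (E 1)) * K 1)) := by
  have hF := h.F_one_mul_core hq hq'
  have hY := h.serreTriple.core_mul hq h2
  have hYb := h.serreTriple.core_mul_bar hq h2
  have k0 : K 1 * E 0 = q⁻¹ • (E 0 * K 1) := by simpa [cartan] using h.KE 1 0
  have k2 : K 1 * E 2 = q⁻¹ • (E 2 * K 1) := by simpa [cartan] using h.KE 1 2
  have k1 : K 1 * E 1 = (q * q) • (E 1 * K 1) := by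
    have := h.KE 1 1; rw [show cartan 1 1 = 2 from rfl] at this; rw [this]; congr 1
    rw [zpow_ofNat, pow_two]
  have l0 : L 1 * E 0 = q • (E 0 * L 1) := by simpa [cartan] using h.LE hq 1 0
  have l2 : L 1 * E 2 = q • (E 2 * L 1) := by simpa [cartan] using h.LE hq 1 2
  have l1 : L 1 * E 1 = (q⁻¹ * q⁻¹) • (E 1 * L 1) := by
    have := h.LE hq 1 1; rw [show cartan 1 1 = 2 from rfl] at this; rw [this]; congr 1
    rw [zpow_neg, zpow_ofNat, pow_two, mul_inv]
  have sm : ∀ {u v w : A} {r : R}, u * v = r • w → ∀ t, u * (v * t) = r • (w * t) :=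
    fun e t => by rw [← mul_assoc, e, smul_mul_assoc]
  have hK : K 1 * core q (E 0) (E 1) (E 2) = q ^ 2 • (core q (E 0) (E 1) (E 2) * K 1) := by
    unfold core qbr
    simp only [mul_sub, sub_mul, smul_sub, smul_mul_assoc, mul_smul_comm, mul_assoc, k0, k1, k2,
      sm k0, sm k1, sm k2]
    match_scalars <;> field_simp
  have hL : q ^ 2 • (L 1 * core q (E 0) (E 1) (E 2)) = core q (E 0) (E 1) (E 2) * L 1 := by
    unfold core qbr
    simp only [mul_sub, sub_mul, smul_sub, smul_mul_assoc, mul_smul_comm, mul_assoc, l0, l1, l2,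
      sm l0, sm l1, sm l2]
    match_scalars <;> field_simp
  generalize core q (E 0) (E 1) (E 2) = e at *
  generalize qbr q (E 0) (qbr q (E 2) (E 1)) = Y at *
  generalize qbr q⁻¹ (E 0) (qbr q⁻¹ (E 2) (E 1)) = Z at *
  have hKn : ∀ n, K 1 * e ^ n = q ^ (2 * n) • (e ^ n * K 1) := fun n => by
    induction n with
    | zero => simp
    | succ n ih =>
      rw [pow_succ, ← mul_assoc, ih, smul_mul_assoc, mul_assoc, hK, mul_smul_comm, smul_smul,
        ← mul_assoc, ← pow_add]
      rfl
  have hLn : ∀ n, q ^ (2 * n) • (L 1 * e ^ n) = e ^ n * L 1 := fun n => by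
    induction n with
    | zero => simp
    | succ n ih =>
      rw [pow_succ, mul_assoc, ← hL, mul_smul_comm, ← mul_assoc (e ^ n), ← ih, smul_mul_assoc,
        smul_smul, mul_assoc, ← pow_succ, ← pow_add]
      congr 2; ring
  have hYn : ∀ n, e ^ n * Y = Y * e ^ n := fun n => Commute.pow_left (show Commute e Y from hY) n
  have hZn : ∀ n, e ^ n * Z = Z * e ^ n := fun n => Commute.pow_left (show Commute e Z from hYb) n
  induction n with
  | zero => simp
  | succ n ih =>
    have step : F 1 * e ^ (n + 1) - e ^ (n + 1) * F 1 =
        (F 1 * e ^ n - e ^ n * F 1) * e + e ^ n * (F 1 * e - e * F 1) := by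
      rw [pow_succ]; noncomm_ring
    rw [step, ih, hF, Nat.add_sub_cancel, Finset.sum_range_succ]
    rcases n with _ | n
    · simp
    rw [Nat.add_sub_cancel]
    have a1 : Y * L 1 * e ^ n * e = Y * L 1 * e ^ (n + 1) := by rw [mul_assoc, pow_succ]
    have a2 : e ^ (n + 1) * (Y * L 1) = q ^ (2 * (n + 1)) • (Y * L 1 * e ^ (n + 1)) := by
      rw [← mul_assoc, hYn, mul_assoc, ← hLn, mul_smul_comm, mul_assoc]
    have a3 : e ^ n * Z * K 1 * e = q ^ 2 • (e ^ (n + 1) * Z * K 1) := by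
      rw [mul_assoc, hK, mul_smul_comm, ← mul_assoc, mul_assoc _ Z, ← hYb, ← mul_assoc, ← pow_succ]
    have a4 : e ^ (n + 1) * (Z * K 1) = e ^ (n + 1) * Z * K 1 := (mul_assoc _ _ _).symm
    have g : q ^ 2 * (∑ j ∈ Finset.range (n + 1), q ^ (2 * j)) + 1 =
        ∑ j ∈ Finset.range (n + 1), q ^ (2 * j) + q ^ (2 * (n + 1)) := by
      rw [← Finset.sum_range_succ, Finset.sum_range_succ' _ (n + 1), Finset.mul_sum]
      simp only [mul_zero, pow_zero]
      congr 1
      exact Finset.sum_congr rfl fun j _ => by ring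
    simp only [smul_mul_assoc, mul_smul_comm, sub_mul, mul_sub, a1, a2, a3, a4, smul_sub,
      smul_smul]
    generalize ∑ j ∈ Finset.range (n + 1), q ^ (2 * j) = s at g ⊢
    match_scalars
    · ring
    · linear_combination (-q⁻¹ * q⁻¹ * q⁻¹) * g

end DJRel
end

/-! ### The coproduct formulas -/

theorem cartan_symm (i j : Fin 3) : cartan i j = cartan j i := by
  fin_cases i <;> fin_cases j <;> rfl

theorem cartan_self (i : Fin 3) : cartan i i = 2 := by fin_cases i <;> rfl

section
variable {R A : Type*} [Field R] [Ring A] [Algebra R A] {q : R}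

namespace DJRel
variable {E F K L E' F' K' L' : Fin 3 → A}

/-- The quantum Serre relation for the elements `E_i + K_i E'_i`. -/
theorem serre_comul (h : DJRel q E F K L) (h' : DJRel q E' F' K' L') (hq : q ≠ 0)
    (hEE : ∀ i j, E' i * E j = E j * E' i) (hEK : ∀ i j, E' i * K j = K j * E' i)
    (i j : Fin 3) (c : cartan i j = -1) :
    (E i + K i * E' i) * (E i + K i * E' i) * (E j + K j * E' j) -
      (q + q⁻¹) • ((E i + K i * E' i) * (E j + K j * E' j) * (E i + K i * E' i)) +
      (E j + K j * E' j) * (E i + K i * E' i) * (E i + K i * E' i) = 0 := by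
  have c' : cartan j i = -1 := cartan_symm i j ▸ c
  have k1 : K i * E i = (q * q) • (E i * K i) := by
    have := h.KE i i
    rw [cartan_self] at this; rw [this, zpow_ofNat, pow_two]
  have k2 : K i * E j = q⁻¹ • (E j * K i) := by rw [h.KE, c, zpow_neg_one]
  have k3 : K j * E i = q⁻¹ • (E i * K j) := by rw [h.KE, c', zpow_neg_one]
  have kk := h.KK j i
  have e1 := hEE i i
  have e2 := hEE i j
  have e3 := hEE j i
  have e4 := hEK i i
  have e5 := hEK i j
  have e6 := hEK j i
  have s1 := h.EEE i j c
  have s2 := congrArg (K i * K i * K j * ·) (h'.EEE i j c)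
  have sm : ∀ {u v w : A} {r : R}, u * v = r • w → ∀ t, u * (v * t) = r • (w * t) :=
    fun e t => by rw [← mul_assoc, e, smul_mul_assoc]
  have cc : ∀ {u v w : A}, u * v = w → ∀ t, u * (v * t) = w * t :=
    fun e t => by rw [← mul_assoc, e]
  have kk3 : K j * (K i * K i) = K i * (K i * K j) := by
    rw [← mul_assoc, kk, mul_assoc, kk]
  simp only [mul_add, add_mul, mul_sub, sub_mul, smul_add, smul_sub, smul_mul_assoc,
    mul_smul_comm, mul_assoc, mul_zero, smul_smul, e1, e2, e3, e4, e5, e6, k1, k2, k3, kk, cc e1,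
    cc e2, cc e3, cc e4, cc e5, cc e6, sm k1, sm k2, sm k3, cc kk] at s1 s2 ⊢
  linear_combination (norm := (match_scalars <;> field_simp <;> ring)) s1 + s2

/-- `E_i + K_i E'_i` and `E_j + K_j E'_j` commute for distant nodes. -/
theorem far_comul (h : DJRel q E F K L) (h' : DJRel q E' F' K' L')
    (hEE : ∀ i j, E' i * E j = E j * E' i) (hEK : ∀ i j, E' i * K j = K j * E' i)
    (i j : Fin 3) (c : cartan i j = 0) :
    (E i + K i * E' i) * (E j + K j * E' j) = (E j + K j * E' j) * (E i + K i * E' i) := by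
  have cc : ∀ {u v w : A}, u * v = w → ∀ t, u * (v * t) = w * t :=
    fun e t => by rw [← mul_assoc, e]
  have k1 : K i * E j = E j * K i := by rw [h.KE, c, zpow_zero, one_smul]
  have k2 : K j * E i = E i * K j := by rw [h.KE, cartan_symm, c, zpow_zero, one_smul]
  have a1 := hEE i j
  have a2 := hEE j i
  have a3 := hEK i j
  have a4 := hEK j i
  have a5 := h.EE i j c
  have a6 := h'.EE i j c
  have a7 := h.KK i j
  simp only [mul_add, add_mul, mul_assoc, a1, a2, a3, a4, cc a3, cc a4, a5, a6, cc k1, cc k2,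
    cc a7]
  abel

/-- If two families satisfying the relations of `U` commute, then the coproduct formulas give a
third one. -/
theorem comul (h : DJRel q E F K L) (h' : DJRel q E' F' K' L') (hq : q ≠ 0)
    (hEE : ∀ i j, E' i * E j = E j * E' i) (hEF : ∀ i j, E' i * F j = F j * E' i)
    (hEK : ∀ i j, E' i * K j = K j * E' i)
    (hFE : ∀ i j, F' i * E j = E j * F' i) (hFF : ∀ i j, F' i * F j = F j * F' i)
    (hFK : ∀ i j, F' i * K j = K j * F' i)
    (hKE : ∀ i j, K' i * E j = E j * K' i) (hKF : ∀ i j, K' i * F j = F j * K' i)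
    (hKK : ∀ i j, K' i * K j = K j * K' i) (hKL : ∀ i j, K' i * L j = L j * K' i)
    (hLE : ∀ i j, L' i * E j = E j * L' i) (hLF : ∀ i j, L' i * F j = F j * L' i)
    (hLK : ∀ i j, L' i * K j = K j * L' i) :
    DJRel q (fun i => E i + K i * E' i) (fun i => F i * L' i + F' i) (fun i => K i * K' i)
      (fun i => L i * L' i) := by
  have cc : ∀ {u v w : A}, u * v = w → ∀ t, u * (v * t) = w * t :=
    fun e t => by rw [← mul_assoc, e]
  have sm : ∀ {u v w : A} {r : R}, u * v = r • w → ∀ t, u * (v * t) = r • (w * t) :=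
    fun e t => by rw [← mul_assoc, e, smul_mul_assoc]
  refine ⟨fun i => ?_, fun i => ?_, fun i j => ?_, fun i j => ?_, fun i j => ?_, fun i j => ?_,
    fun i j c => h.far_comul h' hEE hEK i j c, fun i j c => h.serre_comul h' hq hEE hEK i j c,
    fun i j c => ?_, fun i j c => ?_⟩
  · rw [mul_assoc, cc (hKL i i), mul_assoc, h'.KL, mul_one, h.KL]
  · rw [mul_assoc, cc (hLK i i), mul_assoc, h'.LK, mul_one, h.LK]
  · simp only [mul_assoc, hKK, cc (hKK _ _), h'.KK i j, cc (h.KK i j)]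
  · simp only [mul_add, add_mul, mul_assoc, hKE, cc (hKE _ _), hKK, cc (hKK _ _), h.KE i j,
      h'.KE i j, sm (h.KE i j), mul_smul_comm, cc (hEK _ _), smul_mul_assoc, smul_add,
      cc (h.KK i j)]
  · simp only [mul_add, add_mul, mul_assoc, hKF, cc (hKF _ _), cc (hKK _ _), cc (hLK _ _),
      h'.KF i j, sm (h.KF i j), mul_smul_comm, cc (hFK _ _), smul_mul_assoc, smul_add,
      (h'.LK' j i).symm]
  · have a1 := h.EF i j
    have a2 := h'.EF i j
    have a3 : L' j * E' i = q ^ (-cartan i j) • (E' i * L' j) := by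
      rw [h'.LE hq, cartan_symm]
    have a4 := h.KF i j
    have : (E i + K i * E' i) * (F j * L' j + F' j) - (F j * L' j + F' j) * (E i + K i * E' i) =
        (E i * F j - F j * E i) * L' j + K i * (E' i * F' j - F' j * E' i) := by
      simp only [mul_add, add_mul, mul_sub, sub_mul, mul_assoc, hLE, hFE, cc (hEF _ _), sm a4,
        cc (hLK _ _), cc (hFK _ _), a3, mul_smul_comm]
      abel
    rw [this, a1, a2]
    split_ifs with e
    · subst e
      simp only [smul_mul_assoc, mul_smul_comm, sub_mul, mul_sub]
      rw [← smul_add]; congr 1; abel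
    · simp
  -- the relations between the `F_i` are those between the `E_i` in the opposite algebra
  all_goals
    have ho := h.opp hq
    have ho' := h'.opp hq
  · have := ho'.far_comul ho (fun i j => by simp only [← MulOpposite.op_mul, hFF])
      (fun i j => by simp only [← MulOpposite.op_mul, hLF]) i j c
    have := congrArg MulOpposite.unop this
    simp only [MulOpposite.unop_mul, MulOpposite.unop_add, MulOpposite.unop_op] at this
    rw [add_comm (F i * _), add_comm (F j * _), this]
  · have := ho'.serre_comul ho (inv_ne_zero hq)
      (fun i j => by simp only [← MulOpposite.op_mul, hFF])
      (fun i j => by simp only [← MulOpposite.op_mul, hLF]) i j c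
    have := congrArg MulOpposite.unop this
    simp only [MulOpposite.unop_mul, MulOpposite.unop_add, MulOpposite.unop_op,
      MulOpposite.unop_sub, MulOpposite.unop_smul, inv_inv, MulOpposite.unop_zero] at this
    rw [add_comm (F i * _), add_comm (F j * _), add_comm q, ← this]
    simp only [mul_assoc]
    abel

/-- Exchanging the `E_i` with the `F_i` and the `K_i` with the `K_i⁻¹` preserves the relations. -/
theorem swap (h : DJRel q E F K L) (hq : q ≠ 0) : DJRel q F E L K where
  KL := h.LK
  LK := h.KL
  KK := h.LL
  KE := h.LF hq
  KF := h.LE hq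
  EF i j := by
    rw [← neg_sub, h.EF]
    by_cases e : j = i
    · subst e
      rw [if_pos rfl, if_pos rfl, ← smul_neg, neg_sub]
    · rw [if_neg e, if_neg (Ne.symm e), neg_zero]
  EE := h.FF
  EEE := h.FFF
  FF := h.EE
  FFF := h.EEE

end DJRel
end

section
variable {R A B : Type*} [Field R] [Ring A] [Algebra R A] [Ring B] [Algebra R B] {q : R}
  {E F K L : Fin 3 → A}

theorem DJRel.map (h : DJRel q E F K L) (f : A →ₐ[R] B) :
    DJRel q (fun i => f (E i)) (fun i => f (F i)) (fun i => f (K i)) (fun i => f (L i)) where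
  KL i := by rw [← map_mul, h.KL, map_one]
  LK i := by rw [← map_mul, h.LK, map_one]
  KK i j := by rw [← map_mul, h.KK, map_mul]
  KE i j := by rw [← map_mul, h.KE, map_smul, map_mul]
  KF i j := by rw [← map_mul, h.KF, map_smul, map_mul]
  EF i j := by
    rw [← map_mul, ← map_mul, ← map_sub, h.EF]
    split_ifs
    · rw [map_smul, map_sub]
    · rw [map_zero]
  EE i j c := by rw [← map_mul, h.EE i j c, map_mul]
  EEE i j c := by simpa using congrArg f (h.EEE i j c)
  FF i j c := by rw [← map_mul, h.FF i j c, map_mul]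
  FFF i j c := by simpa using congrArg f (h.FFF i j c)

end

/-! ### Representations -/

section
variable {k : Type*} [Field k]

/-- A representation of `U` on a vector space. -/
abbrev Rep (k M : Type*) [Field k] [AddCommGroup M] [Module (RatFunc k) M] :=
  Uq k →ₐ[RatFunc k] Module.End (RatFunc k) M

variable {M N : Type*} [AddCommGroup M] [Module (RatFunc k) M] [AddCommGroup N]
  [Module (RatFunc k) N]

namespace Rep

/-- The coproduct respects the relations of `U`. -/
theorem tensRel (ρ : Rep k M) (σ : Rep k N) :
    DJRel (q k)
      (fun i => (ρ (Uq.E k i)).rTensor N + (ρ (Uq.K k i)).rTensor N * (σ (Uq.E k i)).lTensor M)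
      (fun i => (ρ (Uq.F k i)).rTensor N * (σ (Uq.Kinv k i)).lTensor M + (σ (Uq.F k i)).lTensor M)
      (fun i => (ρ (Uq.K k i)).rTensor N * (σ (Uq.K k i)).lTensor M)
      (fun i => (ρ (Uq.Kinv k i)).rTensor N * (σ (Uq.Kinv k i)).lTensor M) := by
  have c : ∀ (f : Module.End (RatFunc k) N) (g : Module.End (RatFunc k) M),
      f.lTensor M * g.rTensor N = g.rTensor N * f.lTensor M := fun f g => by
    rw [Module.End.mul_eq_comp, Module.End.mul_eq_comp, LinearMap.lTensor_comp_rTensor,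
      LinearMap.rTensor_comp_lTensor]
  exact (((Uq.rel k).map ρ).map (Module.End.rTensorAlgHom _ _ N)).comul
    (((Uq.rel k).map σ).map (Module.End.lTensorAlgHom _ _ M)) (Uq.q_facts k).1
    (fun i j => c _ _) (fun i j => c _ _) (fun i j => c _ _) (fun i j => c _ _) (fun i j => c _ _)
    (fun i j => c _ _) (fun i j => c _ _) (fun i j => c _ _) (fun i j => c _ _) (fun i j => c _ _)
    (fun i j => c _ _) (fun i j => c _ _) (fun i j => c _ _)

/-- The tensor product of two representations, with the coproduct
`E ↦ E ⊗ 1 + K ⊗ E`, `F ↦ F ⊗ K⁻¹ + 1 ⊗ F`, `K ↦ K ⊗ K`. -/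
noncomputable def tens (ρ : Rep k M) (σ : Rep k N) : Rep k (M ⊗[RatFunc k] N) :=
  Uq.lift (tensRel ρ σ)

variable (ρ : Rep k M) (σ : Rep k N)

theorem tens_E (i : Fin 3) (m : M) (n : N) : tens ρ σ (Uq.E k i) (m ⊗ₜ n) =
    ρ (Uq.E k i) m ⊗ₜ n + ρ (Uq.K k i) m ⊗ₜ σ (Uq.E k i) n := by
  have : tens ρ σ (Uq.E k i) = _ := Uq.lift_mk (tensRel ρ σ) (Gen.E i)
  rw [this]; simp [Uq.genVal]

theorem tens_F (i : Fin 3) (m : M) (n : N) : tens ρ σ (Uq.F k i) (m ⊗ₜ n) =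
    ρ (Uq.F k i) m ⊗ₜ σ (Uq.Kinv k i) n + m ⊗ₜ σ (Uq.F k i) n := by
  have : tens ρ σ (Uq.F k i) = _ := Uq.lift_mk (tensRel ρ σ) (Gen.F i)
  rw [this]; simp [Uq.genVal]

theorem tens_K (i : Fin 3) (m : M) (n : N) : tens ρ σ (Uq.K k i) (m ⊗ₜ n) =
    ρ (Uq.K k i) m ⊗ₜ σ (Uq.K k i) n := by
  have : tens ρ σ (Uq.K k i) = _ := Uq.lift_mk (tensRel ρ σ) (Gen.K i)
  rw [this]; simp [Uq.genVal]

theorem tens_Kinv (i : Fin 3) (m : M) (n : N) : tens ρ σ (Uq.Kinv k i) (m ⊗ₜ n) =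
    ρ (Uq.Kinv k i) m ⊗ₜ σ (Uq.Kinv k i) n := by
  have : tens ρ σ (Uq.Kinv k i) = _ := Uq.lift_mk (tensRel ρ σ) (Gen.L i)
  rw [this]; simp [Uq.genVal]

end Rep

variable (k) in
/-- The automorphism `ω` of `U` that exchanges `E_i` with `F_i` and `K_i` with `K_i⁻¹`. -/
noncomputable def omega : Uq k →ₐ[RatFunc k] Uq k :=
  Uq.lift ((Uq.rel k).swap (Uq.q_facts k).1)

theorem omega_E (i : Fin 3) : omega k (Uq.E k i) = Uq.F k i := Uq.lift_mk _ (Gen.E i)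
theorem omega_F (i : Fin 3) : omega k (Uq.F k i) = Uq.E k i := Uq.lift_mk _ (Gen.F i)
theorem omega_K (i : Fin 3) : omega k (Uq.K k i) = Uq.Kinv k i := Uq.lift_mk _ (Gen.K i)

/-! ### The action on Laurent monomials by `q`-difference operators -/

variable (k) in
/-- The symmetric quantum integer `[n]`. -/
noncomputable def qint (n : ℤ) : RatFunc k := (q k ^ n - q k ^ (-n)) * (q k - (q k)⁻¹)⁻¹

variable (k) in
/-- The space of Laurent polynomials in four variables; `Finsupp.single α 1` is the monomial
`x^α`. -/
abbrev Lau := (Fin 4 → ℤ) →₀ RatFunc k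

/-- The operator `x^α ↦ c α • x^{α + v}`. -/
noncomputable def shiftOp (c : (Fin 4 → ℤ) → RatFunc k) (v : Fin 4 → ℤ) :
    Module.End (RatFunc k) (Lau k) :=
  Finsupp.linearCombination (RatFunc k) fun α => Finsupp.single (α + v) (c α)

section shift
variable (c d : (Fin 4 → ℤ) → RatFunc k) (v w : Fin 4 → ℤ)

theorem shiftOp_single (α : Fin 4 → ℤ) (r : RatFunc k) :
    shiftOp c v (Finsupp.single α r) = Finsupp.single (α + v) (r * c α) := by
  simp [shiftOp]

theorem shiftOp_mul : shiftOp c v * shiftOp d w = shiftOp (fun α => d α * c (α + w)) (w + v) := by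
  ext α : 2
  simp [shiftOp_single, add_assoc]

theorem shiftOp_add : shiftOp c v + shiftOp d v = shiftOp (fun α => c α + d α) v := by
  ext α : 2
  simp [shiftOp_single]

theorem shiftOp_sub : shiftOp c v - shiftOp d v = shiftOp (fun α => c α - d α) v := by
  ext α : 2
  simp [shiftOp_single]

theorem smul_shiftOp (r : RatFunc k) : r • shiftOp c v = shiftOp (fun α => r * c α) v := by
  ext α : 2
  simp [shiftOp_single]

theorem shiftOp_congr {c d : (Fin 4 → ℤ) → RatFunc k} {v w : Fin 4 → ℤ} (h : v = w)
    (h' : ∀ α, c α = d α) : shiftOp c v = shiftOp d w := by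
  rw [h, funext h']

theorem shiftOp_zero : shiftOp (fun _ => (0 : RatFunc k)) v = 0 := by
  ext α : 2
  simp [shiftOp_single]

theorem shiftOp_one : shiftOp (fun _ => (1 : RatFunc k)) 0 = 1 := by
  ext α : 2
  simp [shiftOp_single]

/-- The quantum Serre relation for weighted shifts, checked on coefficients. -/
theorem shiftOp_serre (r : RatFunc k)
    (h : ∀ α, d α * c (α + w) * c (α + w + v) - r * (c α * d (α + v) * c (α + v + w)) +
      c α * c (α + v) * d (α + v + v) = 0) :
    shiftOp c v * shiftOp c v * shiftOp d w - r • (shiftOp c v * shiftOp d w * shiftOp c v) +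
      shiftOp d w * shiftOp c v * shiftOp c v = 0 := by
  rw [mul_assoc, mul_assoc, mul_assoc]
  simp only [shiftOp_mul, smul_shiftOp]
  rw [add_right_comm v w v, add_comm w v, add_right_comm v w v, shiftOp_sub, shiftOp_add,
    ← shiftOp_zero (v + v + w)]
  refine shiftOp_congr rfl fun α => ?_
  rw [← h α]
  simp only [← add_assoc]
  rw [add_right_comm α v w]

end shift

/-- The exponent vector of `x_i / x_{i+1}`. -/
def ratio (i : Fin 3) : Fin 4 → ℤ := Pi.single i.castSucc 1 - Pi.single i.succ 1

theorem ratio_castSucc (i j : Fin 3) : cartan i j = ratio j i.castSucc - ratio j i.succ := by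
  fin_cases i <;> fin_cases j <;> rfl

/-- The `q`-difference operators `x_i ∂_{i+1}`, `x_{i+1} ∂_i` satisfy the relations of `U`. -/
theorem lauRel : DJRel (q k)
    (fun i => shiftOp (fun α => qint k (α i.succ)) (ratio i))
    (fun i => shiftOp (fun α => qint k (α i.castSucc)) (-ratio i))
    (fun i => shiftOp (fun α => q k ^ (α i.castSucc - α i.succ)) 0)
    (fun i => shiftOp (fun α => q k ^ (α i.succ - α i.castSucc)) 0) := by
  have hq := (Uq.q_facts k).1
  have hq2 := (Uq.q_facts k).2.2
  have hd : (q k - (q k)⁻¹)⁻¹ = q k * (q k ^ 2 - 1)⁻¹ := by field_simp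
  refine ⟨fun i => ?_, fun i => ?_, fun i j => ?_, fun i j => ?_, fun i j => ?_, fun i j => ?_,
    fun i j c => ?_, fun i j c => ?_, fun i j c => ?_, fun i j c => ?_⟩
  · rw [shiftOp_mul, ← shiftOp_one]
    exact shiftOp_congr (by simp) fun α => by rw [← zpow_add₀ hq]; simp
  · rw [shiftOp_mul, ← shiftOp_one]
    exact shiftOp_congr (by simp) fun α => by rw [← zpow_add₀ hq]; simp
  · rw [shiftOp_mul, shiftOp_mul]
    exact shiftOp_congr (by simp) fun α => by simp only [add_zero]; exact mul_comm _ _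
  · rw [shiftOp_mul, shiftOp_mul, smul_shiftOp]
    exact shiftOp_congr (by simp) fun α => by
      rw [ratio_castSucc, add_zero, mul_left_comm, ← mul_assoc, mul_comm, ← zpow_add₀ hq]
      simp only [Pi.add_apply]
      congr 2
      ring
  · rw [shiftOp_mul, shiftOp_mul, smul_shiftOp]
    exact shiftOp_congr (by simp) fun α => by
      rw [ratio_castSucc, add_zero, mul_left_comm, ← mul_assoc, mul_comm, ← zpow_add₀ hq]
      simp only [Pi.add_apply, Pi.neg_apply]
      congr 2
      ring
  · simp only [shiftOp_mul]
    by_cases e : i = j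
    · subst e
      rw [if_pos rfl, neg_add_cancel, add_neg_cancel, shiftOp_sub, shiftOp_sub, smul_shiftOp]
      refine shiftOp_congr rfl fun α => ?_
      have h1 : ratio i i.castSucc = 1 := by fin_cases i <;> rfl
      have h2 : ratio i i.succ = -1 := by fin_cases i <;> rfl
      simp only [Pi.add_apply, Pi.neg_apply, h1, h2, qint, hd, neg_neg, neg_add, zpow_add₀ hq,
        zpow_sub₀ hq, zpow_neg, zpow_one]
      have a := zpow_ne_zero (α i.castSucc) hq
      have b := zpow_ne_zero (α i.succ) hq
      field_simp
      ring
    · rw [if_neg e, add_comm, shiftOp_sub, ← shiftOp_zero (ratio i + -ratio j)]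
      refine shiftOp_congr rfl fun α => ?_
      fin_cases i <;> fin_cases j <;> first | exact absurd rfl e | skip
      all_goals simp [ratio, Pi.single_apply]
      all_goals ring
  · simp only [shiftOp_mul]
    rw [add_comm]
    refine shiftOp_congr rfl fun α => ?_
    fin_cases i <;> fin_cases j <;> first | exact absurd c (by decide) | skip
    all_goals simp [ratio, Pi.single_apply]
    all_goals ring
  · refine shiftOp_serre _ _ _ _ _ fun α => ?_
    fin_cases i <;> fin_cases j <;> first | exact absurd c (by decide) | skip
    all_goals
      simp [ratio, Pi.single_apply, qint, hd, zpow_add₀ hq, zpow_sub₀ hq]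
      have a0 := zpow_ne_zero (α 0) hq
      have a1 := zpow_ne_zero (α 1) hq
      have a2 := zpow_ne_zero (α 2) hq
      have a3 := zpow_ne_zero (α 3) hq
      field_simp
      ring
  · simp only [shiftOp_mul]
    rw [add_comm]
    refine shiftOp_congr rfl fun α => ?_
    fin_cases i <;> fin_cases j <;> first | exact absurd c (by decide) | skip
    all_goals simp [ratio, Pi.single_apply]
    all_goals ring
  · refine shiftOp_serre _ _ _ _ _ fun α => ?_
    fin_cases i <;> fin_cases j <;> first | exact absurd c (by decide) | skip
    all_goals
      simp [ratio, Pi.single_apply, qint, hd, zpow_add₀ hq, zpow_sub₀ hq]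
      have a0 := zpow_ne_zero (α 0) hq
      have a1 := zpow_ne_zero (α 1) hq
      have a2 := zpow_ne_zero (α 2) hq
      have a3 := zpow_ne_zero (α 3) hq
      field_simp
      ring

end

/-! ### The Poincaré-Birkhoff-Witt monomials -/

section
variable {R A : Type*} [Field R] [Ring A] [Algebra R A] {q : R}

namespace SerreTriple
variable {x y z : A}

theorem qbr_assoc (h : SerreTriple q x y z) :
    qbr q x (qbr q y z) = qbr q (qbr q x y) z := by
  have hxz' : ∀ t : A, x * (z * t) = z * (x * t) := fun t => by
    rw [← mul_assoc, h.comm, mul_assoc]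
  unfold qbr
  simp only [mul_sub, sub_mul, smul_mul_assoc, mul_smul_comm, mul_assoc, h.comm, hxz', smul_sub]
  abel

/-- Both identities follow from the expansion of `[x, [y, z]]` through the outer bracket with `x`
and through the outer bracket with `z`. -/
theorem qbr_mul_qbr (h : SerreTriple q x y z) (hq : q ≠ 0) (h2 : 1 + q ^ 2 ≠ 0) :
    y * qbr q x (qbr q y z) = qbr q x (qbr q y z) * y ∧
    qbr q y z * qbr q x y =
      qbr q x y * qbr q y z - (q - q⁻¹) • (qbr q x (qbr q y z) * y) := by
  have d := mul_qbr_of_serre hq h.yyz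
  have a := qbr_mul_of_serre hq h.yyx
  have e := mul_eq_qbr_add q x y
  have f := mul_eq_qbr_add q y z
  have g := h.qbr_assoc
  have i1 : y * qbr q x (qbr q y z) = q ^ 2 • (qbr q x (qbr q y z) * y) -
      q • (qbr q x y * qbr q y z - qbr q y z * qbr q x y) := by
    have e' : y * x = q • (x * y) - q • qbr q x y := by
      rw [e, smul_add, smul_smul, mul_inv_cancel₀ hq, one_smul]; abel
    generalize qbr q x y = A at *
    generalize qbr q y z = D at *
    have e'' : ∀ t, y * (x * t) = q • (x * (y * t)) - q • (A * t) := fun t => by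
      rw [← mul_assoc, e', sub_mul, smul_mul_assoc, smul_mul_assoc, mul_assoc]
    have d' : ∀ t, y * (D * t) = q • (D * (y * t)) := fun t => by
      rw [← mul_assoc, d, smul_mul_assoc, mul_assoc]
    unfold qbr
    simp only [mul_sub, sub_mul, smul_mul_assoc, mul_smul_comm, mul_assoc, smul_sub, e', e'', d, d']
    match_scalars <;> field_simp
  have i2 : qbr q x (qbr q y z) * y = q ^ 2 • (y * qbr q x (qbr q y z)) -
      q • (qbr q x y * qbr q y z - qbr q y z * qbr q x y) := by
    have f' : z * y = q • (y * z) - q • qbr q y z := by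
      rw [f, smul_add, smul_smul, mul_inv_cancel₀ hq, one_smul]; abel
    rw [g]
    generalize qbr q x y = A at *
    generalize qbr q y z = D at *
    have f'' : ∀ t, z * (y * t) = q • (y * (z * t)) - q • (D * t) := fun t => by
      rw [← mul_assoc, f', sub_mul, smul_mul_assoc, smul_mul_assoc, mul_assoc]
    have a' : ∀ t, A * (y * t) = q • (y * (A * t)) := fun t => by
      rw [← mul_assoc, a, smul_mul_assoc, mul_assoc]
    unfold qbr
    simp only [mul_sub, sub_mul, smul_mul_assoc, mul_smul_comm, mul_assoc, smul_sub, f', f'', a, a']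
    match_scalars <;> field_simp
  have c : y * qbr q x (qbr q y z) = qbr q x (qbr q y z) * y := by
    have : (1 + q ^ 2) • (y * qbr q x (qbr q y z) - qbr q x (qbr q y z) * y) = 0 := by
      linear_combination (norm := (match_scalars <;> ring)) i1 - i2
    exact sub_eq_zero.mp ((smul_eq_zero.mp this).resolve_left h2)
  refine ⟨c, ?_⟩
  rw [c] at i1
  linear_combination (norm := (match_scalars <;> field_simp <;> ring)) -q⁻¹ • i1

theorem qbr_qbr_mul_right (h : SerreTriple q x y z) (hq : q ≠ 0) :
    qbr q x (qbr q y z) * z = q • (z * qbr q x (qbr q y z)) := by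
  have d := qbr_mul_of_serre hq h.zzy
  generalize qbr q y z = D at *
  have d' : ∀ t, D * (z * t) = q • (z * (D * t)) := fun t => by
    rw [← mul_assoc, d, smul_mul_assoc, mul_assoc]
  have hxz' : ∀ t : A, x * (z * t) = z * (x * t) := fun t => by
    rw [← mul_assoc, h.comm, mul_assoc]
  unfold qbr
  simp only [mul_sub, sub_mul, smul_mul_assoc, mul_smul_comm, mul_assoc, smul_sub, h.comm, hxz',
    d, d']
  match_scalars <;> field_simp

theorem mul_qbr_qbr_right (h : SerreTriple q x y z) (hq : q ≠ 0) :
    x * qbr q x (qbr q y z) = q • (qbr q x (qbr q y z) * x) := by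
  have d := mul_qbr_of_serre hq h.xxy
  rw [h.qbr_assoc]
  generalize qbr q x y = D at *
  have d' : ∀ t, x * (D * t) = q • (D * (x * t)) := fun t => by
    rw [← mul_assoc, d, smul_mul_assoc, mul_assoc]
  have hxz' : ∀ t : A, x * (z * t) = z * (x * t) := fun t => by
    rw [← mul_assoc, h.comm, mul_assoc]
  unfold qbr
  simp only [mul_sub, sub_mul, smul_mul_assoc, mul_smul_comm, mul_assoc, smul_sub, h.comm, hxz',
    d, d']
  match_scalars <;> field_simp

theorem qbr_qbr_mul_qbr (h : SerreTriple q x y z) (hq : q ≠ 0) (h2 : 1 + q ^ 2 ≠ 0) :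
    qbr q x (qbr q y z) * qbr q y z = q • (qbr q y z * qbr q x (qbr q y z)) := by
  have d := qbr_mul_of_serre hq h.zzy
  have c := (h.qbr_mul_qbr hq h2).2
  have f := mul_eq_qbr_add q y z
  have g := mul_eq_qbr_add q (qbr q x y) z
  have z1 := h.qbr_qbr_mul_right hq
  have key : qbr q y z * (qbr q x y * z - q⁻¹ • (z * qbr q x y)) =
      qbr q y z * qbr q x (qbr q y z) := by rw [h.qbr_assoc]; rfl
  rw [← h.qbr_assoc] at g
  generalize qbr q x (qbr q y z) = G at *
  generalize qbr q x y = A at *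
  generalize qbr q y z = D at *
  have d' : ∀ t, D * (z * t) = q • (z * (D * t)) := fun t => by
    rw [← mul_assoc, d, smul_mul_assoc, mul_assoc]
  have c' : ∀ t, D * (A * t) = A * (D * t) - (q - q⁻¹) • (G * (y * t)) := fun t => by
    rw [← mul_assoc, c, sub_mul, smul_mul_assoc, mul_assoc, mul_assoc]
  have g' : ∀ t, A * (z * t) = G * t + q⁻¹ • (z * (A * t)) := fun t => by
    rw [← mul_assoc, g, add_mul, smul_mul_assoc, mul_assoc]
  have z1' : ∀ t, G * (z * t) = q • (z * (G * t)) := fun t => by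
    rw [← mul_assoc, z1, smul_mul_assoc, mul_assoc]
  rw [← key, mul_sub, ← mul_assoc, c]
  simp only [mul_sub, sub_mul, mul_add, add_mul, smul_mul_assoc, mul_smul_comm, mul_assoc,
    smul_sub, smul_add, d, d', c, c', f, g, g', z1, z1']
  match_scalars <;> field_simp <;> ring

theorem qbr_mul_qbr_qbr' (h : SerreTriple q x y z) (hq : q ≠ 0) (h2 : 1 + q ^ 2 ≠ 0) :
    qbr q x y * qbr q x (qbr q y z) = q • (qbr q x (qbr q y z) * qbr q x y) := by
  have a := mul_qbr_of_serre hq h.xxy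
  have c := (h.qbr_mul_qbr hq h2).2
  have e := mul_eq_qbr_add q x y
  have x1 := h.mul_qbr_qbr_right hq
  have key : qbr q x y * (x * qbr q y z - q⁻¹ • (qbr q y z * x)) =
      qbr q x y * qbr q x (qbr q y z) := rfl
  have g := mul_eq_qbr_add q x (qbr q y z)
  generalize qbr q x (qbr q y z) = G at *
  generalize qbr q x y = A at *
  generalize qbr q y z = D at *
  have a0 : A * x = q⁻¹ • (x * A) := by rw [a, smul_smul, inv_mul_cancel₀ hq, one_smul]
  have a0' : ∀ t, A * (x * t) = q⁻¹ • (x * (A * t)) := fun t => by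
    rw [← mul_assoc, a0, smul_mul_assoc, mul_assoc]
  have c0 : A * D = D * A + (q - q⁻¹) • (G * y) := by rw [c]; abel
  have c' : ∀ t, A * (D * t) = D * (A * t) + (q - q⁻¹) • (G * (y * t)) := fun t => by
    rw [← mul_assoc, c0, add_mul, smul_mul_assoc, mul_assoc, mul_assoc]
  have e' : x * y = A + q⁻¹ • (y * x) := e
  have x1' : ∀ t, x * (G * t) = q • (G * (x * t)) := fun t => by
    rw [← mul_assoc, x1, smul_mul_assoc, mul_assoc]
  have g' : ∀ t, x * (D * t) = G * t + q⁻¹ • (D * (x * t)) := fun t => by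
    rw [← mul_assoc, g, add_mul, smul_mul_assoc, mul_assoc]
  rw [← key, mul_sub, ← mul_assoc, a0]
  simp only [mul_sub, sub_mul, mul_add, add_mul, smul_mul_assoc, mul_smul_comm, mul_assoc,
    smul_sub, smul_add, a0, a0', c0, c', e', g', x1']
  match_scalars <;> field_simp <;> ring

end SerreTriple

theorem mul_pow_of_qcomm {x y : A} {s : R} (h : x * y = s • (y * x)) (n : ℕ) :
    x * y ^ n = s ^ n • (y ^ n * x) := by
  induction n with
  | zero => simp
  | succ n ih =>
    rw [pow_succ, ← mul_assoc, ih, smul_mul_assoc, mul_assoc, h, mul_smul_comm, smul_smul,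
      ← mul_assoc, ← pow_succ]

/-- If `x y = s y x + z` and `z` commutes with `y` up to a scalar, then moving `x` past `y ^ n`
creates only a multiple of `y ^ (n - 1) z`. -/
theorem mul_pow_of_qcomm_add {x y z : A} {s t : R} (h : x * y = z + s • (y * x))
    (hz : z * y = t • (y * z)) (n : ℕ) :
    ∃ c : R, x * y ^ n = s ^ n • (y ^ n * x) + c • (y ^ (n - 1) * z) := by
  induction n with
  | zero => exact ⟨0, by simp⟩
  | succ n ih =>
    obtain ⟨c, hc⟩ := ih
    rcases n with _ | n
    · exact ⟨1, by simp [h, add_comm]⟩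
    refine ⟨s ^ (n + 1) + c * t, ?_⟩
    rw [pow_succ _ (n + 1), ← mul_assoc, hc, add_mul, smul_mul_assoc, smul_mul_assoc, mul_assoc, h,
      mul_assoc _ z, hz, Nat.add_sub_cancel, Nat.add_sub_cancel]
    simp only [mul_add, mul_smul_comm, ← mul_assoc, ← pow_succ, smul_add, smul_smul]
    match_scalars <;> ring

/-- The Poincaré-Birkhoff-Witt monomial with exponents `b` in the root vectors
`E₃, [E₂, E₃], [E₁, [E₂, E₃]], E₂, [E₁, E₂], E₁`. -/
def pbw (q : R) (E : Fin 3 → A) (b : Fin 6 → ℕ) : A :=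
  E 2 ^ b 0 * (qbr q (E 1) (E 2) ^ b 1 * (qbr q (E 0) (qbr q (E 1) (E 2)) ^ b 2 *
    (E 1 ^ b 3 * (qbr q (E 0) (E 1) ^ b 4 * E 0 ^ b 5))))

/-- The span of the Poincaré-Birkhoff-Witt monomials is stable under left multiplication by the
`E i`: each `E i` moves to its place by the rules for pairs of root vectors. -/
theorem mul_mem_span_pbw (hq : q ≠ 0) (h2 : 1 + q ^ 2 ≠ 0) {E : Fin 3 → A}
    (h : SerreTriple q (E 0) (E 1) (E 2)) (i : Fin 3) {u : A}
    (hu : u ∈ Submodule.span R (Set.range (pbw q E))) :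
    E i * u ∈ Submodule.span R (Set.range (pbw q E)) := by
  have mem : ∀ a b c d e f : ℕ, E 2 ^ a * (qbr q (E 1) (E 2) ^ b *
      (qbr q (E 0) (qbr q (E 1) (E 2)) ^ c * (E 1 ^ d * (qbr q (E 0) (E 1) ^ e * E 0 ^ f)))) ∈
      Submodule.span R (Set.range (pbw q E)) := fun a b c d e f =>
    Submodule.subset_span ⟨![a, b, c, d, e, f], rfl⟩
  refine Submodule.span_induction (p := fun u _ => E i * u ∈ Submodule.span R (Set.range (pbw q E)))
    ?_ (by simp) (fun _ _ _ _ h h' => by rw [mul_add]; exact add_mem h h')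
    (fun r _ _ h => by rw [mul_smul_comm]; exact Submodule.smul_mem _ r h) hu
  rintro _ ⟨b, rfl⟩
  rw [show pbw q E b = E 2 ^ b 0 * (qbr q (E 1) (E 2) ^ b 1 *
    (qbr q (E 0) (qbr q (E 1) (E 2)) ^ b 2 *
      (E 1 ^ b 3 * (qbr q (E 0) (E 1) ^ b 4 * E 0 ^ b 5)))) from rfl]
  generalize b 0 = a, b 1 = b', b 2 = c, b 3 = d, b 4 = e, b 5 = f
  have yz := mul_eq_qbr_add q (E 1) (E 2)
  have xD := mul_eq_qbr_add q (E 0) (qbr q (E 1) (E 2))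
  have xy := mul_eq_qbr_add q (E 0) (E 1)
  have Dz := qbr_mul_of_serre hq h.zzy
  have yD := mul_qbr_of_serre hq h.yyz
  have yG := (h.qbr_mul_qbr hq h2).1
  have xG := h.mul_qbr_qbr_right hq
  have GD := h.qbr_qbr_mul_qbr hq h2
  have xA := mul_qbr_of_serre hq h.xxy
  have Ay := qbr_mul_of_serre hq h.yyx
  have xz := h.comm
  generalize qbr q (E 0) (qbr q (E 1) (E 2)) = G at *
  generalize qbr q (E 1) (E 2) = D at *
  generalize qbr q (E 0) (E 1) = B at *
  generalize hx : E 0 = x at *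
  generalize hy : E 1 = y at *
  generalize hz : E 2 = z at *
  have sm : ∀ {u v w : A} {r : R}, u * v = r • w → ∀ t, u * (v * t) = r • (w * t) :=
    fun e t => by rw [← mul_assoc, e, smul_mul_assoc]
  have ad : ∀ {u v w w' : A} {r r' : R}, u * v = r • w + r' • w' →
      ∀ t, u * (v * t) = r • (w * t) + r' • (w' * t) :=
    fun e t => by rw [← mul_assoc, e, add_mul, smul_mul_assoc, smul_mul_assoc]
  have cases3 : i = 0 ∨ i = 1 ∨ i = 2 := by fin_cases i <;> simp
  rcases cases3 with rfl | rfl | rfl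
  · obtain ⟨c1, h1⟩ := mul_pow_of_qcomm_add xD GD b'
    obtain ⟨c2, h2'⟩ := mul_pow_of_qcomm_add xy Ay d
    have h0 := mul_pow_of_qcomm (x := x) (y := z) (s := (1 : R)) (by rw [one_smul]; exact xz) a
    have h3 := mul_pow_of_qcomm xG c
    have h4 := mul_pow_of_qcomm xA e
    rw [hx, sm h0]
    simp only [mul_assoc, ad h1, sm h3, ad h2', sm h4, mul_add, mul_smul_comm, smul_add]
    simp only [← mul_assoc G, ← mul_assoc B, ← pow_succ']
    refine add_mem (add_mem ?_ ?_) ?_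
    all_goals
      repeat' apply Submodule.smul_mem
      exact mem _ _ _ _ _ _
  · obtain ⟨c1, h1⟩ := mul_pow_of_qcomm_add yz Dz a
    have h3 := mul_pow_of_qcomm yD b'
    have h4 := mul_pow_of_qcomm (x := y) (y := G) (s := (1 : R)) (by rw [one_smul]; exact yG) c
    rw [hy, ad h1]
    simp only [mul_assoc, sm h3, sm h4, mul_add, mul_smul_comm, smul_add]
    simp only [← mul_assoc D, ← mul_assoc y, ← pow_succ']
    refine add_mem ?_ ?_
    all_goals
      repeat' apply Submodule.smul_mem
      exact mem _ _ _ _ _ _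
  · rw [hz, ← mul_assoc, ← pow_succ']
    exact mem _ _ _ _ _ _

/-- A subspace that contains `1` and is stable under left multiplication by generators contains the
subalgebra that they generate. -/
theorem adjoin_le_of_mul_mem {s : Set A} {S : Submodule R A} (h1 : (1 : A) ∈ S)
    (h : ∀ x ∈ s, ∀ y ∈ S, x * y ∈ S) : Subalgebra.toSubmodule (Algebra.adjoin R s) ≤ S := by
  have key : ∀ u ∈ Algebra.adjoin R s, ∀ y ∈ S, u * y ∈ S := fun u hu => by
    induction hu using Algebra.adjoin_induction with
    | mem x hx => exact h x hx
    | algebraMap r => exact fun y hy => by rw [← Algebra.smul_def]; exact S.smul_mem r hy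
    | add x y _ _ hx hy => exact fun t ht => by rw [add_mul]; exact add_mem (hx t ht) (hy t ht)
    | mul x y _ _ hx hy => exact fun t ht => by rw [mul_assoc]; exact hx _ (hy t ht)
  exact fun u hu => by simpa using key u hu 1 h1

theorem pbw_zero (q : R) (E : Fin 3 → A) : pbw q E 0 = 1 := by simp [pbw]

end

section
variable (k : Type*) [Field k]

theorem Uplus_eq_span :
    Subalgebra.toSubmodule (Uplus k) =
      Submodule.span (RatFunc k) (Set.range (pbw (q k) (Uq.E k))) := by
  obtain ⟨hq, h2, -⟩ := Uq.q_facts k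
  refine le_antisymm (adjoin_le_of_mul_mem (Submodule.subset_span ⟨0, pbw_zero _ _⟩) ?_) ?_
  · rintro _ ⟨i, rfl⟩ y hy
    exact mul_mem_span_pbw hq h2 (Uq.rel k).serreTriple i hy
  · rw [Submodule.span_le]
    rintro _ ⟨b, rfl⟩
    have hE : ∀ i, Uq.E k i ∈ Uplus k := fun i => Algebra.subset_adjoin ⟨i, rfl⟩
    have hb : ∀ {x y}, x ∈ Uplus k → y ∈ Uplus k → qbr (q k) x y ∈ Uplus k := fun hx hy =>
      sub_mem (mul_mem hx hy) (Subalgebra.smul_mem _ (mul_mem hy hx) _)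
    change pbw (q k) (Uq.E k) b ∈ Uplus k
    exact mul_mem (pow_mem (hE _) _) (mul_mem (pow_mem (hb (hE _) (hE _)) _)
      (mul_mem (pow_mem (hb (hE _) (hb (hE _) (hE _))) _) (mul_mem (pow_mem (hE _) _)
        (mul_mem (pow_mem (hb (hE _) (hE _)) _) (pow_mem (hE _) _)))))

end

/-! ### The action of the monomials on tensor products of Laurent polynomials -/

section
variable {k : Type*} [Field k]

variable (k) in
/-- The action of `U` on Laurent polynomials with `E_i x^α = [α_{i+1}] x_i x_{i+1}⁻¹ x^α`,
`F_i x^α = [α_i] x_{i+1} x_i⁻¹ x^α`. -/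
noncomputable def lau : Rep k (Lau k) := Uq.lift lauRel

theorem lau_E (i : Fin 3) (α : Fin 4 → ℤ) (r : RatFunc k) :
    lau k (Uq.E k i) (Finsupp.single α r) =
      Finsupp.single (α + ratio i) (r * qint k (α i.succ)) := by
  have : lau k (Uq.E k i) = _ := Uq.lift_mk lauRel (Gen.E i)
  rw [this]; simp [Uq.genVal, shiftOp_single]

theorem lau_F (i : Fin 3) (α : Fin 4 → ℤ) (r : RatFunc k) :
    lau k (Uq.F k i) (Finsupp.single α r) =
      Finsupp.single (α - ratio i) (r * qint k (α i.castSucc)) := by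
  have : lau k (Uq.F k i) = _ := Uq.lift_mk lauRel (Gen.F i)
  rw [this]; simp [Uq.genVal, shiftOp_single, sub_eq_add_neg]

theorem lau_K (i : Fin 3) (α : Fin 4 → ℤ) (r : RatFunc k) :
    lau k (Uq.K k i) (Finsupp.single α r) =
      q k ^ (α i.castSucc - α i.succ) • Finsupp.single α r := by
  have : lau k (Uq.K k i) = _ := Uq.lift_mk lauRel (Gen.K i)
  rw [this]; simp [Uq.genVal, shiftOp_single, mul_comm]

theorem q_pow_injective : Function.Injective fun n : ℤ => q k ^ n := by
  have key : ∀ n : ℕ, q k ^ n = 1 → n = 0 := fun n h => by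
    have h1 : (Polynomial.X ^ n : Polynomial k) = 1 :=
      RatFunc.algebraMap_injective k (by simpa using h)
    by_contra hn
    have := congrArg Polynomial.natDegree h1
    rw [Polynomial.natDegree_X_pow, Polynomial.natDegree_one] at this
    exact hn this
  have key' : ∀ n : ℤ, q k ^ n = 1 → n = 0 := fun n h => by
    rcases Int.natAbs_eq n with e | e
    · rw [e, zpow_natCast] at h
      rw [e, key _ h]; rfl
    · rw [e, zpow_neg, zpow_natCast, inv_eq_one] at h
      rw [e, key _ h]; rfl
  intro m n h
  have hq := (Uq.q_facts k).1
  have : q k ^ (m - n) = 1 := by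
    rw [zpow_sub₀ hq, show q k ^ m = q k ^ n from h, div_self (zpow_ne_zero _ hq)]
  exact sub_eq_zero.mp (key' _ this)

theorem qint_zero : qint k 0 = 0 := by simp [qint]

theorem q_sub_inv_ne_zero : q k - (q k)⁻¹ ≠ 0 := fun h => by
  have h1 : q k ^ (1 : ℤ) = q k ^ (-1 : ℤ) := by simpa using sub_eq_zero.mp h
  exact absurd (q_pow_injective h1) (by decide)

theorem qint_ne_zero {n : ℤ} (hn : n ≠ 0) : qint k n ≠ 0 := by
  refine mul_ne_zero (fun h => hn ?_) (inv_ne_zero q_sub_inv_ne_zero)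
  have := q_pow_injective (sub_eq_zero.mp h)
  omega

theorem qint_add_one (n : ℤ) : qint k (n + 1) - (q k)⁻¹ * qint k n = q k ^ n := by
  have hq := (Uq.q_facts k).1
  have h2 := (Uq.q_facts k).2.2
  have hd : (q k - (q k)⁻¹)⁻¹ = q k * (q k ^ 2 - 1)⁻¹ := by field_simp
  have := zpow_ne_zero n hq
  simp only [qint, hd, neg_add, zpow_add₀ hq, zpow_neg, zpow_one]
  field_simp
  ring

variable (k) in
/-- The monomial `x₁^a x₂^b x₃^c x₄^d`. -/
noncomputable def mon (a b c d : ℤ) : Lau k := Finsupp.single ![a, b, c, d] 1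

section mon
variable (a b c d : ℤ)

theorem lau_E_zero : lau k (Uq.E k 0) (mon k a b c d) = qint k b • mon k (a + 1) (b - 1) c d := by
  rw [mon, lau_E, one_mul, mon, Finsupp.smul_single, smul_eq_mul, mul_one]
  congr 1
  ext i; fin_cases i <;> simp [ratio, Pi.single_apply, sub_eq_add_neg]

theorem lau_E_one : lau k (Uq.E k 1) (mon k a b c d) = qint k c • mon k a (b + 1) (c - 1) d := by
  rw [mon, lau_E, one_mul, mon, Finsupp.smul_single, smul_eq_mul, mul_one]
  congr 1
  ext i; fin_cases i <;> simp [ratio, Pi.single_apply, sub_eq_add_neg]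

theorem lau_E_two : lau k (Uq.E k 2) (mon k a b c d) = qint k d • mon k a b (c + 1) (d - 1) := by
  rw [mon, lau_E, one_mul, mon, Finsupp.smul_single, smul_eq_mul, mul_one]
  congr 1
  ext i; fin_cases i <;> simp [ratio, Pi.single_apply, sub_eq_add_neg]

theorem lau_qbr (X Y : Uq k) (m : Lau k) : lau k (qbr (q k) X Y) m =
    lau k X (lau k Y m) - (q k)⁻¹ • lau k Y (lau k X m) := by
  simp [qbr]

theorem lau_E12 : lau k (qbr (q k) (Uq.E k 1) (Uq.E k 2)) (mon k a b c d) =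
    (q k ^ c * qint k d) • mon k a (b + 1) c (d - 1) := by
  rw [lau_qbr, lau_E_one, lau_E_two, map_smul, map_smul, lau_E_one, lau_E_two, ← qint_add_one]
  simp only [add_sub_cancel_right, sub_add_cancel]
  rw [smul_smul, smul_smul, smul_smul, ← sub_smul]
  congr 1
  ring

theorem lau_E012 : lau k (qbr (q k) (Uq.E k 0) (qbr (q k) (Uq.E k 1) (Uq.E k 2))) (mon k a b c d) =
    (q k ^ (b + c) * qint k d) • mon k (a + 1) b c (d - 1) := by
  rw [lau_qbr, lau_E_zero, lau_E12, map_smul, map_smul, lau_E_zero, lau_E12,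
    zpow_add₀ (Uq.q_facts k).1, ← qint_add_one b]
  simp only [add_sub_cancel_right, sub_add_cancel]
  rw [smul_smul, smul_smul, smul_smul, ← sub_smul]
  congr 1
  ring

theorem lau_E01 : lau k (qbr (q k) (Uq.E k 0) (Uq.E k 1)) (mon k a b c d) =
    (q k ^ b * qint k c) • mon k (a + 1) b (c - 1) d := by
  rw [lau_qbr, lau_E_zero, lau_E_one, map_smul, map_smul, lau_E_zero, lau_E_one, ← qint_add_one]
  simp only [add_sub_cancel_right, sub_add_cancel]
  rw [smul_smul, smul_smul, smul_smul, ← sub_smul]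
  congr 1
  ring

end mon

variable {M N : Type*} [AddCommGroup M] [Module (RatFunc k) M] [AddCommGroup N]
  [Module (RatFunc k) N]

/-- The powers of an operator that moves along a chain of vectors without vanishing. -/
theorem exists_pow_apply_chain {T : Module.End (RatFunc k) M} {m : ℕ → M} {c : ℕ → RatFunc k}
    {n : ℕ} (h : ∀ j, T (m j) = c j • m (j + 1)) (hc : ∀ j < n, c j ≠ 0) :
    ∃ γ : RatFunc k, γ ≠ 0 ∧ (T ^ n) (m 0) = γ • m n := by
  induction n with
  | zero => exact ⟨1, one_ne_zero, by simp⟩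
  | succ n ih =>
    obtain ⟨γ, h0, hγ⟩ := ih fun j hj => hc j (by omega)
    refine ⟨γ * c n, mul_ne_zero h0 (hc n (by omega)), ?_⟩
    rw [pow_succ', Module.End.mul_apply, hγ, map_smul, h, smul_smul]

section chains
variable {n : ℕ}

theorem lau_E012_pow {A : ℕ} (h : n ≤ A) : ∃ γ : RatFunc k, γ ≠ 0 ∧
    (lau k (qbr (q k) (Uq.E k 0) (qbr (q k) (Uq.E k 1) (Uq.E k 2)) ^ n)) (mon k 0 0 0 A) =
      γ • mon k n 0 0 (A - n) := by
  rw [map_pow]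
  obtain ⟨γ, h0, h⟩ := exists_pow_apply_chain (n := n) (m := fun j => mon k j 0 0 (A - j))
    (c := fun j => q k ^ ((0 : ℤ) + 0) * qint k (A - j)) (fun j => by
      rw [lau_E012, sub_sub _ (j : ℤ) 1]; push_cast; rfl) (fun j hj => by
      simpa using qint_ne_zero (by omega))
  exact ⟨γ, h0, by simpa using h⟩

theorem lau_E12_pow {a A : ℕ} (h : a + n ≤ A) : ∃ γ : RatFunc k, γ ≠ 0 ∧
    (lau k (qbr (q k) (Uq.E k 1) (Uq.E k 2) ^ n)) (mon k a 0 0 (A - a)) =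
      γ • mon k a n 0 (A - a - n) := by
  rw [map_pow]
  obtain ⟨γ, h0, h⟩ := exists_pow_apply_chain (n := n) (m := fun j => mon k a j 0 (A - a - j))
    (c := fun j => q k ^ (0 : ℤ) * qint k (A - a - j)) (fun j => by
      rw [lau_E12, sub_sub _ (j : ℤ) 1]; push_cast; rfl) (fun j hj => by
      simpa using qint_ne_zero (by omega))
  exact ⟨γ, h0, by simpa using h⟩

theorem lau_E2_pow {a b A : ℕ} (h : a + b + n ≤ A) : ∃ γ : RatFunc k, γ ≠ 0 ∧
    (lau k (Uq.E k 2 ^ n)) (mon k a b 0 (A - a - b)) = γ • mon k a b n (A - a - b - n) := by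
  rw [map_pow]
  obtain ⟨γ, h0, h⟩ := exists_pow_apply_chain (n := n) (m := fun j => mon k a b j (A - a - b - j))
    (c := fun j => qint k (A - a - b - j)) (fun j => by
      rw [lau_E_two, sub_sub _ (j : ℤ) 1]; push_cast; rfl) (fun j hj => qint_ne_zero (by omega))
  exact ⟨γ, h0, by simpa using h⟩

theorem lau_E01_pow {B : ℕ} (h : n ≤ B) : ∃ γ : RatFunc k, γ ≠ 0 ∧
    (lau k (qbr (q k) (Uq.E k 0) (Uq.E k 1) ^ n)) (mon k 0 0 B 0) = γ • mon k n 0 (B - n) 0 := by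
  rw [map_pow]
  obtain ⟨γ, h0, h⟩ := exists_pow_apply_chain (n := n) (m := fun j => mon k j 0 (B - j) 0)
    (c := fun j => q k ^ (0 : ℤ) * qint k (B - j)) (fun j => by
      rw [lau_E01, sub_sub _ (j : ℤ) 1]; push_cast; rfl) (fun j hj => by
      simpa using qint_ne_zero (by omega))
  exact ⟨γ, h0, by simpa using h⟩

theorem lau_E1_pow {a B : ℕ} (h : a + n ≤ B) : ∃ γ : RatFunc k, γ ≠ 0 ∧
    (lau k (Uq.E k 1 ^ n)) (mon k a 0 (B - a) 0) = γ • mon k a n (B - a - n) 0 := by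
  rw [map_pow]
  obtain ⟨γ, h0, h⟩ := exists_pow_apply_chain (n := n) (m := fun j => mon k a j (B - a - j) 0)
    (c := fun j => qint k (B - a - j)) (fun j => by
      rw [lau_E_one, sub_sub _ (j : ℤ) 1]; push_cast; rfl) (fun j hj => qint_ne_zero (by omega))
  exact ⟨γ, h0, by simpa using h⟩

theorem lau_E0_pow {C : ℕ} (h : n ≤ C) : ∃ γ : RatFunc k, γ ≠ 0 ∧
    (lau k (Uq.E k 0 ^ n)) (mon k 0 C 0 0) = γ • mon k n (C - n) 0 0 := by
  rw [map_pow]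
  obtain ⟨γ, h0, h⟩ := exists_pow_apply_chain (n := n) (m := fun j => mon k j (C - j) 0 0)
    (c := fun j => qint k (C - j)) (fun j => by
      rw [lau_E_zero, sub_sub _ (j : ℤ) 1]; push_cast; rfl) (fun j hj => qint_ne_zero (by omega))
  exact ⟨γ, h0, by simpa using h⟩

end chains

namespace Rep

/-- On `M ⊗ P` the element `X` acts as `X ⊗ 1`. -/
def ActsLeft (ρ : Rep k M) (σ : Rep k N) (P : Submodule (RatFunc k) N) (X : Uq k) : Prop :=
  ∀ m, ∀ n ∈ P, tens ρ σ X (m ⊗ₜ n) = ρ X m ⊗ₜ n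

/-- On `m ⊗ N` the element `X` acts as `1 ⊗ X`. -/
def ActsRight (ρ : Rep k M) (σ : Rep k N) (m : M) (X : Uq k) : Prop :=
  ∀ n, tens ρ σ X (m ⊗ₜ n) = m ⊗ₜ σ X n

variable {ρ : Rep k M} {σ : Rep k N} {P : Submodule (RatFunc k) N} {X Y : Uq k}

theorem ActsLeft.E {i : Fin 3} (h : ∀ n ∈ P, σ (Uq.E k i) n = 0) :
    ActsLeft ρ σ P (Uq.E k i) := fun m n hn => by
  rw [tens_E, h n hn, TensorProduct.tmul_zero, add_zero]

theorem ActsLeft.pow (h : ActsLeft ρ σ P X) (n : ℕ) : ActsLeft ρ σ P (X ^ n) := by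
  induction n with
  | zero => intro m n _; simp
  | succ n ih =>
    intro m p hp
    rw [pow_succ', map_mul, map_mul, Module.End.mul_apply, ih m p hp, h _ p hp,
      Module.End.mul_apply]

/-- If `P` is stable under `E_i` and `K_i X = q⁻¹ X K_i`, the terms `K_i X ⊗ E_i` of `[E_i, X]`
cancel. -/
theorem ActsLeft.qbr {i : Fin 3} (h : ActsLeft ρ σ P X) (hP : ∀ n ∈ P, σ (Uq.E k i) n ∈ P)
    (hX : Uq.K k i * X = (q k)⁻¹ • (X * Uq.K k i)) :
    ActsLeft ρ σ P (qbr (q k) (Uq.E k i) X) := fun m n hn => by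
  have e : ∀ m, ρ (Uq.K k i) (ρ X m) = (q k)⁻¹ • ρ X (ρ (Uq.K k i) m) := fun m => by
    rw [← Module.End.mul_apply, ← map_mul, hX, map_smul, map_mul]; rfl
  simp only [QSP.qbr, map_sub, map_mul, map_smul, LinearMap.sub_apply, LinearMap.smul_apply,
    Module.End.mul_apply]
  rw [h m n hn, tens_E, tens_E, map_add, h _ n hn, h _ _ (hP n hn), e, TensorProduct.sub_tmul,
    smul_add, TensorProduct.smul_tmul', TensorProduct.smul_tmul']
  abel

theorem ActsRight.E {m : M} {i : Fin 3} (h : ρ (Uq.E k i) m = 0) (h' : ρ (Uq.K k i) m = m) :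
    ActsRight ρ σ m (Uq.E k i) := fun n => by
  rw [tens_E, h, h', TensorProduct.zero_tmul, zero_add]

theorem ActsRight.mul {m : M} (h : ActsRight ρ σ m X) (h' : ActsRight ρ σ m Y) :
    ActsRight ρ σ m (X * Y) := fun n => by
  rw [map_mul, map_mul, Module.End.mul_apply, h', h, Module.End.mul_apply]

theorem ActsRight.pow {m : M} (h : ActsRight ρ σ m X) (n : ℕ) : ActsRight ρ σ m (X ^ n) := by
  induction n with
  | zero => intro n; simp
  | succ n ih => rw [pow_succ]; exact ih.mul h

theorem ActsRight.qbr {m : M} (h : ActsRight ρ σ m X) (h' : ActsRight ρ σ m Y) :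
    ActsRight ρ σ m (qbr (q k) X Y) := fun n => by
  simp only [QSP.qbr, map_sub, map_smul, LinearMap.sub_apply, LinearMap.smul_apply,
    h.mul h' n, h'.mul h n, TensorProduct.tmul_sub, TensorProduct.tmul_smul]

end Rep

variable (k) in
/-- The tensor cube of the space of Laurent polynomials. -/
abbrev Lau3 := Lau k ⊗[RatFunc k] (Lau k ⊗[RatFunc k] Lau k)

variable (k) in
/-- The action of `U` on the tensor cube of the space of Laurent polynomials. -/
noncomputable def lau3 : Rep k (Lau3 k) := Rep.tens (lau k) (Rep.tens (lau k) (lau k))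

variable (k) in
/-- The vector `x₄^A ⊗ x₃^B ⊗ x₂^C`. -/
noncomputable def wvec (A B C : ℤ) : Lau3 k :=
  mon k 0 0 0 A ⊗ₜ (mon k 0 0 B 0 ⊗ₜ mon k 0 C 0 0)

variable (k) in
/-- The vector to which the monomial with exponents `b` maps `x₄^A ⊗ x₃^B ⊗ x₂^C`. -/
noncomputable def tvec (A B C : ℤ) (b : Fin 6 → ℕ) : Lau3 k :=
  mon k (b 2) (b 1) (b 0) (A - b 2 - b 1 - b 0) ⊗ₜ
    (mon k (b 4) (b 3) (B - b 4 - b 3) 0 ⊗ₜ mon k (b 5) (C - b 5) 0 0)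

/-- The tensors of monomials without `x₄`. -/
noncomputable def noFour (k : Type*) [Field k] : Submodule (RatFunc k) (Lau k ⊗[RatFunc k] Lau k) :=
  Submodule.span _ {t | ∃ α β r s, α 3 = 0 ∧ β 3 = 0 ∧
    t = Finsupp.single α r ⊗ₜ Finsupp.single β s}

/-- The polynomials without `x₃`. -/
noncomputable def noThree (k : Type*) [Field k] : Submodule (RatFunc k) (Lau k) :=
  Submodule.span _ {t | ∃ α r, α 2 = 0 ∧ t = Finsupp.single α r}

/-- The monomials map `x₄^A ⊗ x₃^B ⊗ x₂^C` to nonzero multiples of distinct basis vectors. This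
rests on the shape of the coproduct: since `E₃` kills the last two factors, `E₃`, `[E₂, E₃]` and
`[E₁, [E₂, E₃]]` act on the first factor alone, and since `x₄^A` is fixed by `E₁, E₂` in the sense
of `Rep.ActsRight`, the other three root vectors act on the last two factors; there the argument
repeats. -/
theorem lau3_pbw {A B C : ℕ} {b : Fin 6 → ℕ} (hA : b 2 + b 1 + b 0 ≤ A) (hB : b 4 + b 3 ≤ B)
    (hC : b 5 ≤ C) :
    ∃ γ : RatFunc k, γ ≠ 0 ∧
      lau3 k (pbw (q k) (Uq.E k) b) (wvec k A B C) = γ • tvec k A B C b := by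
  have rel := Uq.rel k
  have hq := (Uq.q_facts k).1
  have k12 : Uq.K k 1 * Uq.E k 2 = (q k)⁻¹ • (Uq.E k 2 * Uq.K k 1) := by
    simpa [cartan] using rel.KE 1 2
  have k01 : Uq.K k 0 * Uq.E k 1 = (q k)⁻¹ • (Uq.E k 1 * Uq.K k 0) := by
    simpa [cartan] using rel.KE 0 1
  have k02 : Uq.K k 0 * Uq.E k 2 = Uq.E k 2 * Uq.K k 0 := by
    simpa [cartan] using rel.KE 0 2
  have k012 : Uq.K k 0 * qbr (q k) (Uq.E k 1) (Uq.E k 2) =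
      (q k)⁻¹ • (qbr (q k) (Uq.E k 1) (Uq.E k 2) * Uq.K k 0) := by
    have k01' : ∀ t, Uq.K k 0 * (Uq.E k 1 * t) = (q k)⁻¹ • (Uq.E k 1 * (Uq.K k 0 * t)) :=
      fun t => by rw [← mul_assoc, k01, smul_mul_assoc, mul_assoc]
    have k02' : ∀ t, Uq.K k 0 * (Uq.E k 2 * t) = Uq.E k 2 * (Uq.K k 0 * t) :=
      fun t => by rw [← mul_assoc, k02, mul_assoc]
    simp only [qbr, mul_sub, sub_mul, mul_smul_comm, smul_mul_assoc, mul_assoc, k01, k01', k02,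
      k02', smul_sub]
  -- the last two factors
  have r1 : ∀ m, lau k (Uq.E k 0) (mon k 0 0 m 0) = 0 := fun m => by
    rw [lau_E_zero, qint_zero, zero_smul]
  have r2 : ∀ m, lau k (Uq.K k 0) (mon k 0 0 m 0) = mon k 0 0 m 0 := fun m => by
    rw [mon, lau_K]; simp
  have l1 : ∀ n ∈ noThree k, lau k (Uq.E k 1) n = 0 := fun n hn => by
    refine (Submodule.span_le (p := LinearMap.ker (lau k (Uq.E k 1)))).mpr ?_ hn
    rintro _ ⟨α, r, h, rfl⟩
    have : α (Fin.succ 1) = 0 := h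
    rw [SetLike.mem_coe, LinearMap.mem_ker, lau_E, this, qint_zero, mul_zero,
      Finsupp.single_zero]
  have l2 : ∀ n ∈ noThree k, lau k (Uq.E k 0) n ∈ noThree k := fun n hn => by
    refine (Submodule.span_le (p := (noThree k).comap (lau k (Uq.E k 0)))).mpr ?_ hn
    rintro _ ⟨α, r, h, rfl⟩
    rw [SetLike.mem_coe, Submodule.mem_comap, lau_E]
    exact Submodule.subset_span ⟨_, _, by simp [h, ratio], rfl⟩
  have step2 : ∃ γ : RatFunc k, γ ≠ 0 ∧
      Rep.tens (lau k) (lau k) (Uq.E k 1 ^ b 3 *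
        (qbr (q k) (Uq.E k 0) (Uq.E k 1) ^ b 4 * Uq.E k 0 ^ b 5))
        (mon k 0 0 B 0 ⊗ₜ mon k 0 C 0 0) = γ •
          (mon k (b 4) (b 3) (B - b 4 - b 3) 0 ⊗ₜ mon k (b 5) (C - b 5) 0 0) := by
    obtain ⟨γ1, h1, e1⟩ := lau_E0_pow (k := k) hC
    obtain ⟨γ2, h2, e2⟩ := lau_E01_pow (k := k) (n := b 4) (B := B) (by omega)
    obtain ⟨γ3, h3, e3⟩ := lau_E1_pow (k := k) (n := b 3) (a := b 4) (B := B) hB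
    refine ⟨γ1 * γ2 * γ3, mul_ne_zero (mul_ne_zero h1 h2) h3, ?_⟩
    have hP : mon k (b 5) (C - b 5) 0 0 ∈ noThree k := Submodule.subset_span ⟨_, _, rfl, rfl⟩
    have aE1 : Rep.ActsLeft (lau k) (lau k) (noThree k) (Uq.E k 1) := Rep.ActsLeft.E l1
    rw [map_mul, map_mul, Module.End.mul_apply, Module.End.mul_apply,
      (Rep.ActsRight.E (r1 B) (r2 B)).pow, e1, TensorProduct.tmul_smul, map_smul,
      ((aE1.qbr l2 k01).pow _) _ _ hP, e2, map_smul, ← TensorProduct.smul_tmul', map_smul,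
      (aE1.pow _) _ _ hP, e3, ← TensorProduct.smul_tmul', smul_smul, smul_smul]
  -- all three factors
  have s1 : ∀ m, lau k (Uq.E k 0) (mon k 0 0 0 m) = 0 := fun m => by
    rw [lau_E_zero, qint_zero, zero_smul]
  have s2 : ∀ m, lau k (Uq.E k 1) (mon k 0 0 0 m) = 0 := fun m => by
    rw [lau_E_one, qint_zero, zero_smul]
  have s3 : ∀ m, lau k (Uq.K k 0) (mon k 0 0 0 m) = mon k 0 0 0 m := fun m => by
    rw [mon, lau_K]; simp
  have s4 : ∀ m, lau k (Uq.K k 1) (mon k 0 0 0 m) = mon k 0 0 0 m := fun m => by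
    rw [mon, lau_K]; simp
  have t1 : ∀ n ∈ noFour k, Rep.tens (lau k) (lau k) (Uq.E k 2) n = 0 := fun n hn => by
    refine (Submodule.span_le
      (p := LinearMap.ker (Rep.tens (lau k) (lau k) (Uq.E k 2)))).mpr ?_ hn
    rintro _ ⟨α, β, r, s, h, h', rfl⟩
    have e : α (Fin.succ 2) = 0 := h
    have e' : β (Fin.succ 2) = 0 := h'
    rw [SetLike.mem_coe, LinearMap.mem_ker, Rep.tens_E, lau_E, lau_E, e, e', qint_zero, mul_zero,
      mul_zero, Finsupp.single_zero, Finsupp.single_zero, TensorProduct.zero_tmul,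
      TensorProduct.tmul_zero, add_zero]
  have t2 : ∀ i : Fin 3, ratio i 3 = 0 → ∀ n ∈ noFour k,
      Rep.tens (lau k) (lau k) (Uq.E k i) n ∈ noFour k := fun i hi n hn => by
    refine (Submodule.span_le
      (p := (noFour k).comap (Rep.tens (lau k) (lau k) (Uq.E k i)))).mpr ?_ hn
    rintro _ ⟨α, β, r, s, h, h', rfl⟩
    rw [SetLike.mem_coe, Submodule.mem_comap, Rep.tens_E, lau_E, lau_E, lau_K,
      ← TensorProduct.smul_tmul']
    exact add_mem (Submodule.subset_span ⟨_, _, _, _, by simp [h, hi], h', rfl⟩)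
      (Submodule.smul_mem _ _ (Submodule.subset_span ⟨_, _, _, _, h, by simp [h', hi], rfl⟩))
  obtain ⟨γ, h0, hγ⟩ := step2
  obtain ⟨γ1, h1, e1⟩ := lau_E012_pow (k := k) (n := b 2) (A := A) (by omega)
  obtain ⟨γ2, h2, e2⟩ := lau_E12_pow (k := k) (n := b 1) (a := b 2) (A := A) (by omega)
  obtain ⟨γ3, h3, e3⟩ := lau_E2_pow (k := k) (n := b 0) (a := b 2) (b := b 1) (A := A) hA
  refine ⟨γ * γ1 * γ2 * γ3, mul_ne_zero (mul_ne_zero (mul_ne_zero h0 h1) h2) h3, ?_⟩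
  -- the three root vectors without `E₃` act on the right factor, the others on the left one
  have hP : (mon k (b 4) (b 3) (B - b 4 - b 3) 0 ⊗ₜ mon k (b 5) (C - b 5) 0 0) ∈ noFour k :=
    Submodule.subset_span ⟨_, _, _, _, rfl, rfl, rfl⟩
  have aE2 : Rep.ActsLeft (lau k) (Rep.tens (lau k) (lau k)) (noFour k) (Uq.E k 2) :=
    Rep.ActsLeft.E t1
  have aD := aE2.qbr (t2 1 rfl) k12
  have aG := aD.qbr (t2 0 rfl) k012
  have aE0 : Rep.ActsRight (lau k) (Rep.tens (lau k) (lau k)) (mon k 0 0 0 A) (Uq.E k 0) :=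
    Rep.ActsRight.E (s1 A) (s3 A)
  have aE1 : Rep.ActsRight (lau k) (Rep.tens (lau k) (lau k)) (mon k 0 0 0 A) (Uq.E k 1) :=
    Rep.ActsRight.E (s2 A) (s4 A)
  unfold pbw lau3 wvec tvec
  rw [map_mul, map_mul (Rep.tens _ _) (_ ^ b 1), map_mul (Rep.tens _ _) (_ ^ b 2),
    Module.End.mul_apply, Module.End.mul_apply, Module.End.mul_apply,
    (aE1.pow _).mul (((aE0.qbr aE1).pow _).mul (aE0.pow _)), hγ, TensorProduct.tmul_smul,
    map_smul, (aG.pow _) _ _ hP, e1, ← TensorProduct.smul_tmul']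
  simp only [map_smul]
  rw [(aD.pow _) _ _ hP, e2, ← TensorProduct.smul_tmul']
  simp only [map_smul]
  rw [(aE2.pow _) _ _ hP, e3, ← TensorProduct.smul_tmul', smul_smul, smul_smul, smul_smul]

end

/-! ### The triangular decomposition: spanning -/

section
variable {k : Type*} [Field k]

variable (k) in
/-- The subalgebra `U⁻`, generated by the `F_i`. -/
noncomputable def Uminus : Subalgebra (RatFunc k) (Uq k) :=
  Algebra.adjoin (RatFunc k) (Set.range (Uq.F k))

theorem serreTriple_F : SerreTriple (q k) (Uq.F k 0) (Uq.F k 1) (Uq.F k 2) :=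
  have h := Uq.rel k
  ⟨h.FF 0 2 rfl, h.FFF 0 1 rfl, h.FFF 1 0 rfl, h.FFF 2 1 rfl, h.FFF 1 2 rfl⟩

variable (k) in
theorem Uminus_le_span : Subalgebra.toSubmodule (Uminus k) ≤
    Submodule.span (RatFunc k) (Set.range (pbw (q k) (Uq.F k))) := by
  obtain ⟨hq, h2, -⟩ := Uq.q_facts k
  refine adjoin_le_of_mul_mem (Submodule.subset_span ⟨0, pbw_zero _ _⟩) ?_
  rintro _ ⟨i, rfl⟩ y hy
  exact mul_mem_span_pbw hq h2 serreTriple_F i hy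

variable (k) in
theorem adjoin_gens : Algebra.adjoin (RatFunc k)
    (Set.range (Uq.E k) ∪ Set.range (Uq.F k) ∪ Set.range (Uq.K k) ∪ Set.range (Uq.Kinv k)) = ⊤ := by
  have hs : Function.Surjective (Uq.mk k) := RingQuot.mkAlgHom_surjective _ _
  rw [← (AlgHom.range_eq_top (Uq.mk k)).mpr hs, ← Algebra.map_top, ← FreeAlgebra.adjoin_range_ι,
    AlgHom.map_adjoin]
  refine le_antisymm (Algebra.adjoin_mono ?_) (Algebra.adjoin_mono ?_)
  · rintro _ (((⟨i, rfl⟩ | ⟨i, rfl⟩) | ⟨i, rfl⟩) | ⟨i, rfl⟩)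
    exacts [⟨_, ⟨Gen.E i, rfl⟩, rfl⟩, ⟨_, ⟨Gen.F i, rfl⟩, rfl⟩, ⟨_, ⟨Gen.K i, rfl⟩, rfl⟩,
      ⟨_, ⟨Gen.L i, rfl⟩, rfl⟩]
  · rintro _ ⟨_, ⟨g, rfl⟩, rfl⟩
    cases g with
    | E i => exact Or.inl (Or.inl (Or.inl ⟨i, rfl⟩))
    | F i => exact Or.inl (Or.inl (Or.inr ⟨i, rfl⟩))
    | K i => exact Or.inl (Or.inr ⟨i, rfl⟩)
    | L i => exact Or.inr ⟨i, rfl⟩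

theorem Kunit_comm (i j : Fin 3) : Commute (Kunit k i) (Kunit k j) :=
  Units.ext ((Uq.rel k).KK i j)

theorem Klam_add (l m : Fin 3 → ℤ) : Klam k (l + m) = Klam k l * Klam k m := by
  have h : ∀ i j (a b : ℤ), Commute (Kunit k i ^ a) (Kunit k j ^ b) :=
    fun i j a b => (Kunit_comm i j).zpow_zpow a b
  unfold Klam
  rw [← Units.val_mul]
  congr 1
  simp only [Pi.add_apply, zpow_add]
  rw [(h 0 1 _ _).mul_mul_mul_comm, ((h 0 2 _ _).mul_left (h 1 2 _ _)).mul_mul_mul_comm]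

theorem Klam_mem (S : Submonoid (Uq k)) (hK : ∀ i, Uq.K k i ∈ S) (hL : ∀ i, Uq.Kinv k i ∈ S)
    (l : Fin 3 → ℤ) : Klam k l ∈ S := by
  have h : ∀ i (z : ℤ), ((Kunit k i ^ z : (Uq k)ˣ) : Uq k) ∈ S := fun i z => by
    rcases z with n | n
    · rw [Int.ofNat_eq_natCast, zpow_natCast, Units.val_pow_eq_pow_val]
      exact pow_mem (hK i) n
    · rw [zpow_negSucc, ← inv_pow, Units.val_pow_eq_pow_val]
      exact pow_mem (hL i) _
  unfold Klam
  rw [Units.val_mul, Units.val_mul]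
  exact mul_mem (mul_mem (h _ _) (h _ _)) (h _ _)

theorem Klam_single (i : Fin 3) : Klam k (Pi.single i 1) = Uq.K k i := by
  fin_cases i <;> simp [Klam, Kunit]

theorem Klam_neg_single (i : Fin 3) : Klam k (-Pi.single i 1) = Uq.Kinv k i := by
  fin_cases i <;> simp [Klam, Kunit]

theorem Klam_zero : Klam k 0 = 1 := by simp [Klam]

theorem E_mul_Klam (i : Fin 3) (l : Fin 3 → ℤ) :
    ∃ s : RatFunc k, Uq.E k i * Klam k l = s • (Klam k l * Uq.E k i) := by
  have hq := (Uq.q_facts k).1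
  let S : Submonoid (Uq k) :=
    { carrier := {x | ∃ s : RatFunc k, Uq.E k i * x = s • (x * Uq.E k i)}
      one_mem' := ⟨1, by simp⟩
      mul_mem' := by
        rintro x y ⟨s, hs⟩ ⟨t, ht⟩
        exact ⟨s * t, by
          rw [← mul_assoc, hs, smul_mul_assoc, mul_assoc, ht, mul_smul_comm, smul_smul,
            mul_assoc]⟩ }
  refine Klam_mem S (fun j => ⟨q k ^ (-cartan j i), ?_⟩) (fun j => ⟨q k ^ (cartan j i), ?_⟩) l
  · rw [(Uq.rel k).KE, smul_smul, ← zpow_add₀ hq]; simp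
  · rw [(Uq.rel k).LE hq, smul_smul, ← zpow_add₀ hq]; simp

theorem conj_mem_Uminus (i : Fin 3) {f : Uq k} (hf : f ∈ Uminus k) :
    Uq.K k i * f * Uq.Kinv k i ∈ Uminus k ∧ Uq.Kinv k i * f * Uq.K k i ∈ Uminus k := by
  have rel := Uq.rel k
  have hq := (Uq.q_facts k).1
  induction hf using Algebra.adjoin_induction with
  | mem x hx =>
    obtain ⟨j, rfl⟩ := hx
    rw [rel.KF, rel.LF hq, smul_mul_assoc, smul_mul_assoc, mul_assoc, mul_assoc, rel.KL, rel.LK,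
      mul_one]
    have : Uq.F k j ∈ Uminus k := Algebra.subset_adjoin ⟨j, rfl⟩
    exact ⟨Subalgebra.smul_mem _ this _, Subalgebra.smul_mem _ this _⟩
  | algebraMap r =>
    rw [← Algebra.commutes, ← Algebra.commutes, mul_assoc, mul_assoc, rel.KL, rel.LK, mul_one]
    exact ⟨Subalgebra.algebraMap_mem _ _, Subalgebra.algebraMap_mem _ _⟩
  | add x y _ _ hx hy =>
    simp only [mul_add, add_mul]
    exact ⟨add_mem hx.1 hy.1, add_mem hx.2 hy.2⟩
  | mul x y _ _ hx hy =>
    have e1 : Uq.K k i * (x * y) * Uq.Kinv k i =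
        (Uq.K k i * x * Uq.Kinv k i) * (Uq.K k i * y * Uq.Kinv k i) := by
      simp only [mul_assoc]
      rw [← mul_assoc (Uq.Kinv k i) (Uq.K k i), rel.LK, one_mul]
    have e2 : Uq.Kinv k i * (x * y) * Uq.K k i =
        (Uq.Kinv k i * x * Uq.K k i) * (Uq.Kinv k i * y * Uq.K k i) := by
      simp only [mul_assoc]
      rw [← mul_assoc (Uq.K k i) (Uq.Kinv k i), rel.KL, one_mul]
    rw [e1, e2]
    exact ⟨mul_mem hx.1 hy.1, mul_mem hx.2 hy.2⟩

theorem K_mul_eq (i : Fin 3) (f : Uq k) :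
    Uq.K k i * f = Uq.K k i * f * Uq.Kinv k i * Klam k (Pi.single i 1) ∧
    Uq.Kinv k i * f = Uq.Kinv k i * f * Uq.K k i * Klam k (-Pi.single i 1) := by
  rw [Klam_single, Klam_neg_single, mul_assoc _ (Uq.Kinv k i), mul_assoc _ (Uq.K k i),
    (Uq.rel k).LK, (Uq.rel k).KL, mul_one, mul_one]
  exact ⟨rfl, rfl⟩

/-- Commuting `E_i` past an element of `U⁻` creates only elements of `U⁻ U⁰`. -/
theorem E_mul_sub_mem (i : Fin 3) {f : Uq k} (hf : f ∈ Uminus k) :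
    Uq.E k i * f - f * Uq.E k i ∈
      Submodule.span (RatFunc k) {t | ∃ f ∈ Uminus k, ∃ l, t = f * Klam k l} := by
  set T0 := Submodule.span (RatFunc k) {t : Uq k | ∃ f ∈ Uminus k, ∃ l, t = f * Klam k l}
  have hF : ∀ j, Uq.F k j ∈ Uminus k := fun j => Algebra.subset_adjoin ⟨j, rfl⟩
  have hFT : ∀ j, ∀ t ∈ T0, Uq.F k j * t ∈ T0 := fun j t ht => by
    refine (Submodule.span_le (p := T0.comap (LinearMap.mulLeft (RatFunc k) (Uq.F k j)))).mpr
      ?_ ht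
    rintro _ ⟨f, hf, l, rfl⟩
    exact Submodule.subset_span ⟨_, mul_mem (hF j) hf, l, by simp [mul_assoc]⟩
  let S : Submodule (RatFunc k) (Uq k) := Subalgebra.toSubmodule (Uminus k) ⊓
    T0.comap (LinearMap.mulLeft (RatFunc k) (Uq.E k i) - LinearMap.mulRight (RatFunc k) (Uq.E k i))
  have : Subalgebra.toSubmodule (Uminus k) ≤ S := by
    refine adjoin_le_of_mul_mem ⟨one_mem (Uminus k), by simp⟩ ?_
    rintro _ ⟨j, rfl⟩ f ⟨hf, hf'⟩
    refine ⟨show _ ∈ Uminus k from mul_mem (hF j) hf, ?_⟩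
    replace hf' : Uq.E k i * f - f * Uq.E k i ∈ T0 := hf'
    change Uq.E k i * (Uq.F k j * f) - Uq.F k j * f * Uq.E k i ∈ T0
    have e : Uq.E k i * (Uq.F k j * f) - Uq.F k j * f * Uq.E k i =
        Uq.F k j * (Uq.E k i * f - f * Uq.E k i) +
          (Uq.E k i * Uq.F k j - Uq.F k j * Uq.E k i) * f := by noncomm_ring
    rw [e, (Uq.rel k).EF]
    refine add_mem (hFT j _ hf') ?_
    split_ifs
    · rw [smul_mul_assoc, sub_mul, (K_mul_eq i f).1, (K_mul_eq i f).2]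
      exact T0.smul_mem _ (sub_mem
        (Submodule.subset_span ⟨_, (conj_mem_Uminus i hf).1, _, rfl⟩)
        (Submodule.subset_span ⟨_, (conj_mem_Uminus i hf).2, _, rfl⟩))
    · rw [zero_mul]; exact zero_mem _
  exact (this hf).2

variable (k) in
/-- `U = U⁻ U⁰ U⁺`. -/
theorem span_triangular : Submodule.span (RatFunc k)
    {t : Uq k | ∃ f ∈ Uminus k, ∃ l, ∃ e ∈ Uplus k, t = f * (Klam k l * e)} = ⊤ := by
  set T := Submodule.span (RatFunc k)
    {t : Uq k | ∃ f ∈ Uminus k, ∃ l, ∃ e ∈ Uplus k, t = f * (Klam k l * e)} with hT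
  have mem : ∀ {f l e}, f ∈ Uminus k → e ∈ Uplus k → f * (Klam k l * e) ∈ T :=
    fun hf he => Submodule.subset_span ⟨_, hf, _, _, he, rfl⟩
  have red : ∀ X : Uq k, (∀ f ∈ Uminus k, ∀ l, ∀ e ∈ Uplus k, X * (f * (Klam k l * e)) ∈ T) →
      ∀ t ∈ T, X * t ∈ T := fun X h t ht => by
    refine (Submodule.span_le (p := T.comap (LinearMap.mulLeft (RatFunc k) X))).mpr ?_ ht
    rintro _ ⟨f, hf, l, e, he, rfl⟩
    exact h f hf l e he
  rw [eq_top_iff, ← Algebra.top_toSubmodule, ← adjoin_gens]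
  refine adjoin_le_of_mul_mem ?_ ?_
  · have := mem (l := 0) (one_mem (Uminus k)) (one_mem (Uplus k))
    simpa [Klam_zero] using this
  · rintro _ (((⟨i, rfl⟩ | ⟨i, rfl⟩) | ⟨i, rfl⟩) | ⟨i, rfl⟩)
    · refine red _ fun f hf l e he => ?_
      obtain ⟨s, hs⟩ := E_mul_Klam (k := k) i l
      have e1 : Uq.E k i * (f * (Klam k l * e)) =
          (Uq.E k i * f - f * Uq.E k i) * (Klam k l * e) +
            s • (f * (Klam k l * (Uq.E k i * e))) := by
        rw [← mul_assoc (Klam k l), ← mul_smul_comm, ← smul_mul_assoc, ← hs]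
        noncomm_ring
      rw [e1]
      refine add_mem ?_ (T.smul_mem _ (mem hf (mul_mem (Algebra.subset_adjoin ⟨i, rfl⟩) he)))
      refine (Submodule.span_le (p := T.comap (LinearMap.mulRight (RatFunc k)
        (Klam k l * e)))).mpr ?_ (E_mul_sub_mem i hf)
      rintro _ ⟨f', hf', l', rfl⟩
      change f' * Klam k l' * (Klam k l * e) ∈ T
      rw [mul_assoc, ← mul_assoc (Klam k l'), ← Klam_add]
      exact mem hf' he
    · refine red _ fun f hf l e he => ?_
      rw [← mul_assoc]
      exact mem (mul_mem (Algebra.subset_adjoin ⟨i, rfl⟩) hf) he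
    · refine red _ fun f hf l e he => ?_
      rw [← mul_assoc, (K_mul_eq i f).1, mul_assoc, ← mul_assoc (Klam k _), ← Klam_add]
      exact mem (conj_mem_Uminus i hf).1 he
    · refine red _ fun f hf l e he => ?_
      rw [← mul_assoc, (K_mul_eq i f).2, mul_assoc, ← mul_assoc (Klam k _), ← Klam_add]
      exact mem (conj_mem_Uminus i hf).2 he

/-- Exponents of the monomials that span `U`. -/
abbrev PBWIndex := (Fin 6 → ℕ) × (Fin 3 → ℤ) × (Fin 6 → ℕ)

variable (k) in
/-- The monomial `F^a K_λ E^b`. -/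
noncomputable def fullPBW (x : PBWIndex) : Uq k :=
  pbw (q k) (Uq.F k) x.1 * (Klam k x.2.1 * pbw (q k) (Uq.E k) x.2.2)

variable (k) in
theorem span_fullPBW : Submodule.span (RatFunc k) (Set.range (fullPBW k)) = ⊤ := by
  rw [eq_top_iff, ← span_triangular, Submodule.span_le]
  rintro _ ⟨f, hf, l, e, he, rfl⟩
  set S := Submodule.span (RatFunc k) (Set.range (fullPBW k))
  have h1 : ∀ a, pbw (q k) (Uq.F k) a * (Klam k l * e) ∈ S := fun a => by
    refine (Submodule.span_le (p := S.comap ((LinearMap.mulLeft (RatFunc k)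
      (pbw (q k) (Uq.F k) a)).comp (LinearMap.mulLeft (RatFunc k) (Klam k l))))).mpr ?_
      ((Uplus_eq_span k).le he)
    rintro _ ⟨b, rfl⟩
    exact Submodule.subset_span ⟨(a, l, b), rfl⟩
  refine (Submodule.span_le (p := S.comap (LinearMap.mulRight (RatFunc k)
    (Klam k l * e)))).mpr ?_ (Uminus_le_span k hf)
  rintro _ ⟨a, rfl⟩
  exact h1 a

end

/-! ### The triangular decomposition: linear independence -/

section
variable {k : Type*} [Field k]

variable {M N : Type*} [AddCommGroup M] [Module (RatFunc k) M] [AddCommGroup N]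
  [Module (RatFunc k) N]

/-- `m` is a vector of weight `n`: every `K_i` multiplies it by `q ^ n i`. -/
def IsWt (ρ : Rep k M) (n : Fin 3 → ℤ) (m : M) : Prop := ∀ i, ρ (Uq.K k i) m = q k ^ n i • m

namespace IsWt
variable {ρ : Rep k M} {σ : Rep k N} {n n' : Fin 3 → ℤ} {m : M} {x : N}

theorem Kinv (h : IsWt ρ n m) (i : Fin 3) : ρ (Uq.Kinv k i) m = q k ^ (-n i) • m := by
  have hq := (Uq.q_facts k).1
  have h1 := congrArg (fun t => q k ^ (-n i) • ρ (Uq.Kinv k i) t) (h i)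
  beta_reduce at h1
  rw [← Module.End.mul_apply, ← map_mul, (Uq.rel k).LK, map_one, Module.End.one_apply, map_smul,
    smul_smul, ← zpow_add₀ hq, neg_add_cancel, zpow_zero, one_smul] at h1
  exact h1.symm

theorem E (h : IsWt ρ n m) (i : Fin 3) :
    IsWt ρ (fun j => n j + cartan j i) (ρ (Uq.E k i) m) := fun j => by
  rw [← Module.End.mul_apply, ← map_mul, (Uq.rel k).KE, map_smul, map_mul, LinearMap.smul_apply,
    Module.End.mul_apply, h j, map_smul, smul_smul, ← zpow_add₀ (Uq.q_facts k).1, add_comm]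

theorem F (h : IsWt ρ n m) (i : Fin 3) :
    IsWt ρ (fun j => n j - cartan j i) (ρ (Uq.F k i) m) := fun j => by
  rw [← Module.End.mul_apply, ← map_mul, (Uq.rel k).KF, map_smul, map_mul, LinearMap.smul_apply,
    Module.End.mul_apply, h j, map_smul, smul_smul, ← zpow_add₀ (Uq.q_facts k).1, add_comm]
  rfl

theorem smul (h : IsWt ρ n m) (r : RatFunc k) : IsWt ρ n (r • m) := fun j => by
  rw [map_smul, h j, smul_comm]

theorem tmul (h : IsWt ρ n m) (h' : IsWt σ n' x) :
    IsWt (Rep.tens ρ σ) (n + n') (m ⊗ₜ x) := fun j => by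
  rw [Rep.tens_K, h j, h' j, TensorProduct.smul_tmul_smul, ← zpow_add₀ (Uq.q_facts k).1]
  rfl

theorem omega (h : IsWt ρ n m) : IsWt (ρ.comp (omega k)) (-n) m := fun j => by
  rw [AlgHom.comp_apply, omega_K, h.Kinv]
  rfl

theorem Klam (h : IsWt ρ n m) (l : Fin 3 → ℤ) :
    ρ (Klam k l) m = q k ^ (∑ i, l i * n i) • m := by
  have key : ∀ i (z : ℤ), ρ ((Kunit k i ^ z : (Uq k)ˣ) : Uq k) m = q k ^ (z * n i) • m := by
    have pw : ∀ (X : Uq k) (s : RatFunc k), ρ X m = s • m →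
        ∀ j : ℕ, ρ (X ^ j) m = s ^ j • m := fun X s hX j => by
      induction j with
      | zero => simp
      | succ j ih =>
        rw [pow_succ', map_mul, Module.End.mul_apply, ih, map_smul, hX, smul_smul, pow_succ]
    intro i z
    rcases z with j | j
    · rw [Int.ofNat_eq_natCast, zpow_natCast, Units.val_pow_eq_pow_val, mul_comm, zpow_mul,
        zpow_natCast]
      exact pw _ _ (h i) j
    · rw [zpow_negSucc, ← inv_pow, Units.val_pow_eq_pow_val]
      have := pw _ _ (h.Kinv i) (j + 1)
      rw [← zpow_natCast, ← zpow_mul] at this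
      have e : (Int.negSucc j) * n i = -n i * ((j + 1 : ℕ) : ℤ) := by
        rw [Int.negSucc_eq]; push_cast; ring
      rw [e]
      exact this
  unfold QSP.Klam
  rw [Units.val_mul, Units.val_mul, map_mul, map_mul, Module.End.mul_apply, Module.End.mul_apply,
    key, map_smul, map_smul, key, map_smul, key, smul_smul, smul_smul,
    ← zpow_add₀ (Uq.q_facts k).1, ← zpow_add₀ (Uq.q_facts k).1, Fin.sum_univ_three]
  congr 2
  ring

end IsWt

/-- Twice the height of a weight: the linear function that is `2` on every simple root. -/
def wtHeight (n : Fin 3 → ℤ) : ℤ := 3 * n 0 + 4 * n 1 + 3 * n 2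

theorem wtHeight_cartan (i : Fin 3) : wtHeight (fun j => cartan j i) = 2 := by
  fin_cases i <;> rfl

theorem wtHeight_add (n n' : Fin 3 → ℤ) : wtHeight (n + n') = wtHeight n + wtHeight n' := by
  simp only [wtHeight, Pi.add_apply]; ring

theorem wtHeight_sub (n n' : Fin 3 → ℤ) : wtHeight (n - n') = wtHeight n - wtHeight n' := by
  simp only [wtHeight, Pi.sub_apply]; ring

/-- The span of the weight vectors with `wtHeight` at least `j`. -/
noncomputable def heightGE (ρ : Rep k M) (j : ℤ) : Submodule (RatFunc k) M :=
  Submodule.span _ {m | ∃ n, IsWt ρ n m ∧ j ≤ wtHeight n}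

variable (N) in
/-- The span of the tensors whose first factor is a weight vector with `wtHeight` at
least `j`. -/
noncomputable def tensGE (ρ : Rep k M) (j : ℤ) : Submodule (RatFunc k) (M ⊗[RatFunc k] N) :=
  Submodule.span _ {t | ∃ n m x, IsWt ρ n m ∧ j ≤ wtHeight n ∧ t = m ⊗ₜ x}

section filtration
variable {ρ : Rep k M} {σ : Rep k N} {i j : ℤ}

theorem tensGE_mono (h : i ≤ j) : tensGE N ρ j ≤ tensGE N ρ i :=
  Submodule.span_mono fun _ ⟨n, m, x, hn, hj, e⟩ => ⟨n, m, x, hn, h.trans hj, e⟩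

theorem tmul_mem_tensGE {m : M} (h : m ∈ heightGE ρ j) (x : N) : m ⊗ₜ x ∈ tensGE N ρ j := by
  refine (Submodule.span_le (p := (tensGE N ρ j).comap
    ((TensorProduct.mk (RatFunc k) M N).flip x))).mpr ?_ h
  rintro m ⟨n, hn, hj⟩
  exact Submodule.subset_span ⟨n, m, x, hn, hj, rfl⟩

theorem tensGE_le {p : Submodule (RatFunc k) (M ⊗[RatFunc k] N)}
    {f : Module.End (RatFunc k) (M ⊗[RatFunc k] N)}
    (h : ∀ n m x, IsWt ρ n m → j ≤ wtHeight n → f (m ⊗ₜ x) ∈ p) :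
    ∀ t ∈ tensGE N ρ j, f t ∈ p := fun t ht => by
  refine (Submodule.span_le (p := p.comap f)).mpr ?_ ht
  rintro _ ⟨n, m, x, hn, hj, rfl⟩
  exact h n m x hn hj

theorem heightGE_F {m : M} (h : m ∈ heightGE ρ j) (l : Fin 3) :
    ρ (Uq.F k l) m ∈ heightGE ρ (j - 2) := by
  refine (Submodule.span_le (p := (heightGE ρ (j - 2)).comap (ρ (Uq.F k l)))).mpr ?_ h
  rintro m ⟨n, hn, hj⟩
  refine Submodule.subset_span ⟨_, hn.F l, ?_⟩
  rw [show (fun j => n j - cartan j l) = n - fun j => cartan j l from rfl, wtHeight_sub,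
    wtHeight_cartan]
  omega

theorem tensGE_E (l : Fin 3) : ∀ t ∈ tensGE N ρ j, Rep.tens ρ σ (Uq.E k l) t ∈ tensGE N ρ j := by
  refine tensGE_le fun n m x hn hj => ?_
  rw [Rep.tens_E, hn l]
  refine add_mem (Submodule.subset_span ⟨_, _, _, hn.E l, ?_, rfl⟩)
    (Submodule.subset_span ⟨_, _, _, hn.smul _, hj, rfl⟩)
  rw [show (fun j => n j + cartan j l) = n + fun j => cartan j l from rfl, wtHeight_add,
    wtHeight_cartan]
  omega

theorem tensGE_F (l : Fin 3) :
    ∀ t ∈ tensGE N ρ j, Rep.tens ρ σ (Uq.F k l) t ∈ tensGE N ρ (j - 2) := by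
  refine tensGE_le fun n m x hn hj => ?_
  rw [Rep.tens_F]
  have hm : m ∈ heightGE ρ j := Submodule.subset_span ⟨n, hn, hj⟩
  exact add_mem (tmul_mem_tensGE (heightGE_F hm l) _)
    (tensGE_mono (by omega) (tmul_mem_tensGE hm _))

theorem tensGE_Klam (l : Fin 3 → ℤ) :
    ∀ t ∈ tensGE N ρ j, Rep.tens ρ σ (Klam k l) t ∈ tensGE N ρ j := by
  let S : Submonoid (Uq k) :=
    { carrier := {X | ∀ t ∈ tensGE N ρ j, Rep.tens ρ σ X t ∈ tensGE N ρ j}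
      one_mem' := fun t ht => by rwa [map_one]
      mul_mem' := fun {X Y} hX hY t ht => by
        rw [map_mul, Module.End.mul_apply]; exact hX _ (hY t ht) }
  refine Klam_mem S (fun i => tensGE_le fun n m x hn hj => ?_)
    (fun i => tensGE_le fun n m x hn hj => ?_) l
  · rw [Rep.tens_K, hn i]
    exact Submodule.subset_span ⟨_, _, _, hn.smul _, hj, rfl⟩
  · rw [Rep.tens_Kinv, hn.Kinv i]
    exact Submodule.subset_span ⟨_, _, _, hn.smul _, hj, rfl⟩

end filtration

/-- On a tensor `m ⊗ x` the leading term of `X` (for the filtration by the height of the first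
factor) is a nonzero multiple of `m ⊗ X x`. -/
structure LeadE (ρ : Rep k M) (σ : Rep k N) (X : Uq k) (κ : (Fin 3 → ℤ) → RatFunc k) : Prop where
  ne_zero : ∀ n, κ n ≠ 0
  stable : ∀ j, ∀ t ∈ tensGE N ρ j, Rep.tens ρ σ X t ∈ tensGE N ρ j
  lead : ∀ n m x, IsWt ρ n m →
    Rep.tens ρ σ X (m ⊗ₜ x) - κ n • (m ⊗ₜ σ X x) ∈ tensGE N ρ (wtHeight n + 1)

/-- `X` lowers heights by at most `h`, and on a tensor `m ⊗ x` its part that lowers the height of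
the first factor by `h` is a nonzero multiple of `X m ⊗ x`. -/
structure LeadF (ρ : Rep k M) (σ : Rep k N) (h : ℤ) (X : Uq k) (κ : (Fin 3 → ℤ) → RatFunc k) :
    Prop where
  ne_zero : ∀ n, κ n ≠ 0
  lower : ∀ j, ∀ t ∈ tensGE N ρ j, Rep.tens ρ σ X t ∈ tensGE N ρ (j - h)
  lower_left : ∀ j, ∀ m ∈ heightGE ρ j, ρ X m ∈ heightGE ρ (j - h)
  lead : ∀ j, ∀ m ∈ heightGE ρ j, ∀ n x, IsWt σ n x →
    Rep.tens ρ σ X (m ⊗ₜ x) - κ n • (ρ X m ⊗ₜ x) ∈ tensGE N ρ (j - h + 1)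

section lead
variable {ρ : Rep k M} {σ : Rep k N} {X Y : Uq k} {κ κ' : (Fin 3 → ℤ) → RatFunc k} {h h' : ℤ}

theorem LeadE.one : LeadE ρ σ 1 1 :=
  ⟨fun _ => one_ne_zero, fun j t ht => by rwa [map_one], fun n m x _ => by simp⟩

theorem LeadE.mul (hX : LeadE ρ σ X κ) (hY : LeadE ρ σ Y κ') : LeadE ρ σ (X * Y) (κ * κ') := by
  refine ⟨fun n => mul_ne_zero (hX.1 n) (hY.1 n), fun j t ht => ?_, fun n m x hm => ?_⟩
  · rw [map_mul, Module.End.mul_apply]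
    exact hX.2 _ _ (hY.2 _ _ ht)
  · have e : Rep.tens ρ σ (X * Y) (m ⊗ₜ x) - (κ * κ') n • (m ⊗ₜ σ (X * Y) x) =
        Rep.tens ρ σ X (Rep.tens ρ σ Y (m ⊗ₜ x) - κ' n • (m ⊗ₜ σ Y x)) +
          κ' n • (Rep.tens ρ σ X (m ⊗ₜ σ Y x) - κ n • (m ⊗ₜ σ X (σ Y x))) := by
      rw [map_mul, map_mul, Module.End.mul_apply, Module.End.mul_apply, map_sub, map_smul,
        smul_sub, smul_smul, Pi.mul_apply, mul_comm (κ n)]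
      abel
    rw [e]
    exact add_mem (hX.2 _ _ (hY.3 n m x hm)) (Submodule.smul_mem _ _ (hX.3 n m _ hm))

theorem LeadE.pow (hX : LeadE ρ σ X κ) (n : ℕ) : LeadE ρ σ (X ^ n) (κ ^ n) := by
  induction n with
  | zero => rw [pow_zero, pow_zero]; exact LeadE.one
  | succ n ih => rw [pow_succ, pow_succ]; exact ih.mul hX

theorem LeadE.sub_smul (hX : LeadE ρ σ X κ) (hY : LeadE ρ σ Y κ) (r : RatFunc k) :
    LeadE ρ σ (X - r • Y) κ := by
  refine ⟨hX.1, fun j t ht => ?_, fun n m x hm => ?_⟩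
  · rw [map_sub, map_smul]
    exact sub_mem (hX.2 _ _ ht) (Submodule.smul_mem _ _ (hY.2 _ _ ht))
  · have e : Rep.tens ρ σ (X - r • Y) (m ⊗ₜ x) - κ n • (m ⊗ₜ σ (X - r • Y) x) =
        (Rep.tens ρ σ X (m ⊗ₜ x) - κ n • (m ⊗ₜ σ X x)) -
          r • (Rep.tens ρ σ Y (m ⊗ₜ x) - κ n • (m ⊗ₜ σ Y x)) := by
      rw [map_sub, map_smul, map_sub, map_smul, LinearMap.sub_apply, LinearMap.smul_apply,
        LinearMap.sub_apply, LinearMap.smul_apply, TensorProduct.tmul_sub, TensorProduct.tmul_smul,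
        smul_sub, smul_sub, smul_comm r]
      abel
    rw [e]
    exact sub_mem (hX.3 n m x hm) (Submodule.smul_mem _ _ (hY.3 n m x hm))

theorem LeadE.qbr (hX : LeadE ρ σ X κ) (hY : LeadE ρ σ Y κ') :
    LeadE ρ σ (qbr (q k) X Y) (κ * κ') :=
  (hX.mul hY).sub_smul (mul_comm κ κ' ▸ hY.mul hX) _

variable (ρ σ) in
theorem LeadE.E (i : Fin 3) : LeadE ρ σ (Uq.E k i) fun n => q k ^ n i := by
  refine ⟨fun n => zpow_ne_zero _ (Uq.q_facts k).1, fun j => tensGE_E i, fun n m x hm => ?_⟩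
  rw [Rep.tens_E, hm i, TensorProduct.smul_tmul', add_sub_cancel_right]
  refine Submodule.subset_span ⟨_, _, _, hm.E i, ?_, rfl⟩
  rw [show (fun j => n j + cartan j i) = n + fun j => cartan j i from rfl, wtHeight_add,
    wtHeight_cartan]
  omega

variable (ρ σ) in
theorem exists_leadE_pbw (b : Fin 6 → ℕ) : ∃ κ, LeadE ρ σ (pbw (q k) (Uq.E k) b) κ :=
  have e := LeadE.E ρ σ
  ⟨_, ((e 2).pow _).mul ((((e 1).qbr (e 2)).pow _).mul ((((e 0).qbr ((e 1).qbr (e 2))).pow _).mul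
    (((e 1).pow _).mul ((((e 0).qbr (e 1)).pow _).mul ((e 0).pow _)))))⟩

theorem LeadF.one : LeadF ρ σ 0 1 1 :=
  ⟨fun _ => one_ne_zero, fun j t ht => by rwa [map_one, sub_zero],
    fun j m hm => by rwa [map_one, sub_zero], fun j m _ n x _ => by simp⟩

theorem LeadF.mul (hX : LeadF ρ σ h X κ) (hY : LeadF ρ σ h' Y κ') :
    LeadF ρ σ (h + h') (X * Y) (κ * κ') := by
  refine ⟨fun n => mul_ne_zero (hX.1 n) (hY.1 n), fun j t ht => ?_, fun j m hm => ?_,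
    fun j m hm n x hx => ?_⟩
  · rw [map_mul, Module.End.mul_apply, show j - (h + h') = j - h' - h by ring]
    exact hX.2 _ _ (hY.2 _ _ ht)
  · rw [map_mul, Module.End.mul_apply, show j - (h + h') = j - h' - h by ring]
    exact hX.3 _ _ (hY.3 _ _ hm)
  · have e : Rep.tens ρ σ (X * Y) (m ⊗ₜ x) - (κ * κ') n • (ρ (X * Y) m ⊗ₜ x) =
        Rep.tens ρ σ X (Rep.tens ρ σ Y (m ⊗ₜ x) - κ' n • (ρ Y m ⊗ₜ x)) +
          κ' n • (Rep.tens ρ σ X (ρ Y m ⊗ₜ x) - κ n • (ρ X (ρ Y m) ⊗ₜ x)) := by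
      rw [map_mul, map_mul, Module.End.mul_apply, Module.End.mul_apply, map_sub, map_smul,
        smul_sub, smul_smul, Pi.mul_apply, mul_comm (κ n)]
      abel
    rw [e]
    refine add_mem ?_ (Submodule.smul_mem _ _ ?_)
    · have := hX.2 _ _ (hY.4 j m hm n x hx)
      rwa [show j - h' + 1 - h = j - (h + h') + 1 by ring] at this
    · have := hX.4 _ _ (hY.3 j m hm) n x hx
      rwa [show j - h' - h + 1 = j - (h + h') + 1 by ring] at this

theorem LeadF.pow (hX : LeadF ρ σ h X κ) (n : ℕ) : LeadF ρ σ (n * h) (X ^ n) (κ ^ n) := by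
  induction n with
  | zero => simpa using LeadF.one
  | succ n ih =>
    rw [pow_succ, pow_succ, Nat.cast_succ, add_mul, one_mul]
    exact ih.mul hX

theorem LeadF.sub_smul (hX : LeadF ρ σ h X κ) (hY : LeadF ρ σ h Y κ) (r : RatFunc k) :
    LeadF ρ σ h (X - r • Y) κ := by
  refine ⟨hX.1, fun j t ht => ?_, fun j m hm => ?_, fun j m hm n x hx => ?_⟩
  · rw [map_sub, map_smul]
    exact sub_mem (hX.2 _ _ ht) (Submodule.smul_mem _ _ (hY.2 _ _ ht))
  · rw [map_sub, map_smul]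
    exact sub_mem (hX.3 _ _ hm) (Submodule.smul_mem _ _ (hY.3 _ _ hm))
  · have e : Rep.tens ρ σ (X - r • Y) (m ⊗ₜ x) - κ n • (ρ (X - r • Y) m ⊗ₜ x) =
        (Rep.tens ρ σ X (m ⊗ₜ x) - κ n • (ρ X m ⊗ₜ x)) -
          r • (Rep.tens ρ σ Y (m ⊗ₜ x) - κ n • (ρ Y m ⊗ₜ x)) := by
      rw [map_sub, map_smul, map_sub, map_smul, LinearMap.sub_apply, LinearMap.smul_apply,
        LinearMap.sub_apply, LinearMap.smul_apply, TensorProduct.sub_tmul,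
        ← TensorProduct.smul_tmul', smul_sub, smul_sub, smul_comm r]
      abel
    rw [e]
    exact sub_mem (hX.4 j m hm n x hx) (Submodule.smul_mem _ _ (hY.4 j m hm n x hx))

theorem LeadF.qbr (hX : LeadF ρ σ h X κ) (hY : LeadF ρ σ h' Y κ') :
    LeadF ρ σ (h + h') (qbr (q k) X Y) (κ * κ') :=
  (hX.mul hY).sub_smul (mul_comm κ κ' ▸ add_comm h h' ▸ hY.mul hX) _

variable (ρ σ) in
theorem LeadF.F (i : Fin 3) : LeadF ρ σ 2 (Uq.F k i) fun n => q k ^ (-n i) := by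
  refine ⟨fun n => zpow_ne_zero _ (Uq.q_facts k).1, fun j => tensGE_F i,
    fun j m hm => heightGE_F hm i, fun j m hm n x hx => ?_⟩
  rw [Rep.tens_F, hx.Kinv i, TensorProduct.tmul_smul, add_sub_cancel_left]
  exact tensGE_mono (by omega) (tmul_mem_tensGE hm _)

/-- Twice the height of the weight of the monomial with exponents `b`. -/
def pbwHeight (b : Fin 6 → ℕ) : ℤ :=
  b 0 * 2 + (b 1 * (2 + 2) + (b 2 * (2 + (2 + 2)) + (b 3 * 2 + (b 4 * (2 + 2) + b 5 * 2))))

variable (ρ σ) in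
theorem exists_leadF_pbw (a : Fin 6 → ℕ) :
    ∃ κ, LeadF ρ σ (pbwHeight a) (pbw (q k) (Uq.F k) a) κ :=
  have e := LeadF.F ρ σ
  ⟨_, ((e 2).pow _).mul ((((e 1).qbr (e 2)).pow _).mul ((((e 0).qbr ((e 1).qbr (e 2))).pow _).mul
    (((e 1).pow _).mul ((((e 0).qbr (e 1)).pow _).mul ((e 0).pow _)))))⟩

/-- The leading term of the action of `F^a K_λ E^b` on a tensor of weight vectors. -/
theorem exists_lead_fullPBW (a b : Fin 6 → ℕ) {n n' : Fin 3 → ℤ} {m : M} (hm : IsWt ρ n m)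
    {x : N} (hx : IsWt σ n' (σ (pbw (q k) (Uq.E k) b) x)) :
    ∃ γ : RatFunc k, γ ≠ 0 ∧ ∀ l, Rep.tens ρ σ (fullPBW k (a, l, b)) (m ⊗ₜ x) -
      (q k ^ (∑ i, l i * (n i + n' i)) * γ) •
        (ρ (pbw (q k) (Uq.F k) a) m ⊗ₜ σ (pbw (q k) (Uq.E k) b) x) ∈
          tensGE N ρ (wtHeight n - pbwHeight a + 1) := by
  obtain ⟨κ, hκ⟩ := exists_leadE_pbw ρ σ b
  obtain ⟨κ', hκ'⟩ := exists_leadF_pbw ρ σ a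
  refine ⟨κ n * κ' n', mul_ne_zero (hκ.1 _) (hκ'.1 _), fun l => ?_⟩
  have h1 := tensGE_Klam (σ := σ) l _ (hκ.3 n m x hm)
  have h2 := hκ'.4 _ m (Submodule.subset_span ⟨n, hm, le_rfl⟩) n' _ hx
  have e := (hm.tmul hx).Klam l
  have h3 := add_mem (hκ'.2 _ _ h1) (tensGE_mono (by omega) (Submodule.smul_mem _ (κ n *
    q k ^ (∑ i, l i * (n i + n' i))) h2) : _ ∈ tensGE N ρ (wtHeight n + 1 - pbwHeight a))
  rw [show wtHeight n - pbwHeight a + 1 = wtHeight n + 1 - pbwHeight a by ring]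
  convert h3 using 1
  rw [fullPBW, map_mul, map_mul, Module.End.mul_apply, Module.End.mul_apply, map_sub, map_smul, e,
    map_sub, smul_sub, smul_smul, map_smul, smul_smul]
  simp only [Pi.add_apply]
  rw [sub_add_sub_cancel]
  congr 2
  ring

end lead
end

/-! ### The test vectors in a six-fold tensor product -/

section
variable {k : Type*} [Field k]

theorem map_pbw {R A B : Type*} [Field R] [Ring A] [Algebra R A] [Ring B] [Algebra R B]
    (f : A →ₐ[R] B) (q : R) (E : Fin 3 → A) (b : Fin 6 → ℕ) :
    f (pbw q E b) = pbw q (fun i => f (E i)) b := by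
  simp [pbw, qbr]

theorem omega_pbw (a : Fin 6 → ℕ) :
    omega k (pbw (q k) (Uq.F k) a) = pbw (q k) (Uq.E k) a := by
  rw [map_pbw]
  simp only [omega_F]

/-- The exponents of a tensor of three monomials. -/
abbrev Exp3 := (Fin 4 → ℤ) × ((Fin 4 → ℤ) × (Fin 4 → ℤ))

variable (k) in
/-- The basis of the tensor cube that consists of the tensors of monomials. -/
noncomputable def lau3Basis : Module.Basis Exp3 (RatFunc k) (Lau3 k) :=
  Module.Basis.tensorProduct Finsupp.basisSingleOne
    (Module.Basis.tensorProduct Finsupp.basisSingleOne Finsupp.basisSingleOne)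

theorem lau3Basis_apply (x : Exp3) : lau3Basis k x = Finsupp.single x.1 1 ⊗ₜ
    (Finsupp.single x.2.1 1 ⊗ₜ Finsupp.single x.2.2 1) := by
  simp [lau3Basis, Module.Basis.tensorProduct_apply']

/-- The weight of a monomial. -/
def expWt (α : Fin 4 → ℤ) (i : Fin 3) : ℤ := α i.castSucc - α i.succ

/-- The weight of a tensor of three monomials. -/
def exp3Wt (x : Exp3) : Fin 3 → ℤ := expWt x.1 + (expWt x.2.1 + expWt x.2.2)

theorem isWt_lau (α : Fin 4 → ℤ) (r : RatFunc k) :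
    IsWt (lau k) (expWt α) (Finsupp.single α r) := fun i => lau_K i α r

theorem isWt_lau3Basis (x : Exp3) : IsWt (lau3 k) (exp3Wt x) (lau3Basis k x) := by
  rw [lau3Basis_apply]
  exact (isWt_lau _ _).tmul ((isWt_lau _ _).tmul (isWt_lau _ _))

/-- The exponents of `tvec`. -/
def tvecExp (A B C : ℤ) (b : Fin 6 → ℕ) : Exp3 :=
  (![b 2, b 1, b 0, A - b 2 - b 1 - b 0], ![b 4, b 3, B - b 4 - b 3, 0], ![b 5, C - b 5, 0, 0])

theorem tvec_eq (A B C : ℤ) (b : Fin 6 → ℕ) :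
    tvec k A B C b = lau3Basis k (tvecExp A B C b) := by
  rw [lau3Basis_apply]; rfl

theorem wvec_eq (A B C : ℤ) : wvec k A B C = lau3Basis k (tvecExp A B C 0) := by
  rw [lau3Basis_apply]
  simp [wvec, mon, tvecExp]

theorem tvecExp_injective (A B C : ℤ) : Function.Injective (tvecExp A B C) := fun b b' h => by
  have h1 := congrArg (fun x : Exp3 => x.1) h
  have h2 := congrArg (fun x : Exp3 => x.2.1) h
  have h3 := congrArg (fun x : Exp3 => x.2.2) h
  have e0 := congrFun h1 0
  have e1 := congrFun h1 1
  have e2 := congrFun h1 2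
  have e3 := congrFun h2 0
  have e4 := congrFun h2 1
  have e5 := congrFun h3 0
  simp [tvecExp] at e0 e1 e2 e3 e4 e5
  ext i
  fin_cases i <;> assumption

theorem wtHeight_tvecExp (A B C : ℤ) (b : Fin 6 → ℕ) :
    wtHeight (exp3Wt (tvecExp A B C b)) = wtHeight (exp3Wt (tvecExp A B C 0)) + pbwHeight b := by
  simp [wtHeight, exp3Wt, expWt, tvecExp, pbwHeight]
  ring

/-- A coordinate with respect to a basis of weight vectors vanishes on vectors of other weights. -/
theorem isWt_coord {ρ : Rep k (Lau3 k)} {w : Exp3 → Fin 3 → ℤ}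
    (hw : ∀ x, IsWt ρ (w x) (lau3Basis k x)) {n : Fin 3 → ℤ} {m : Lau3 k} (hm : IsWt ρ n m)
    {x : Exp3} (hx : n ≠ w x) : (lau3Basis k).coord x m = 0 := by
  by_contra h0
  refine hx (funext fun i => q_pow_injective (k := k) ?_)
  have e : (lau3Basis k).coord x ∘ₗ ρ (Uq.K k i) = q k ^ w x i • (lau3Basis k).coord x := by
    refine (lau3Basis k).ext fun y => ?_
    by_cases hy : y = x
    · subst hy; simp [hw y i]
    · simp [hw y i, Finsupp.single_apply, hy]
  have h1 := LinearMap.congr_fun e m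
  rw [LinearMap.comp_apply, hm i, map_smul, LinearMap.smul_apply, smul_eq_mul, smul_eq_mul] at h1
  exact mul_right_cancel₀ h0 h1

/-- The additive group structure of the tensor cube, stated so that instance search need not unfold
`Lau3`. -/
noncomputable instance : AddCommGroup (Lau3 k) := TensorProduct.addCommGroup

variable (k) in
/-- The action of `U` on the tensor product of the twist by `ω` of the tensor cube of the space of
Laurent polynomials with the tensor cube itself. -/
noncomputable def lau6 : Rep k (Lau3 k ⊗[RatFunc k] Lau3 k) :=
  Rep.tens ((lau3 k).comp (omega k)) (lau3 k)

variable (k) in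
/-- The coefficient of a tensor of six monomials. -/
noncomputable def coord6 (x y : Exp3) : Lau3 k ⊗[RatFunc k] Lau3 k →ₗ[RatFunc k] RatFunc k :=
  LinearMap.mul' _ _ ∘ₗ TensorProduct.map ((lau3Basis k).coord x) ((lau3Basis k).coord y)

theorem coord6_tmul (x y : Exp3) (m n : Lau3 k) :
    coord6 k x y (m ⊗ₜ n) = (lau3Basis k).coord x m * (lau3Basis k).coord y n := by
  simp [coord6]

theorem isWt_twist_lau3Basis (x : Exp3) :
    IsWt ((lau3 k).comp (omega k)) (-exp3Wt x) (lau3Basis k x) := (isWt_lau3Basis x).omega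

theorem coord6_tensGE {j : ℤ} {x : Exp3} (hx : wtHeight (-exp3Wt x) < j) (y : Exp3) :
    ∀ t ∈ tensGE (Lau3 k) ((lau3 k).comp (omega k)) j, coord6 k x y t = 0 := fun t ht => by
  refine (Submodule.span_le (p := LinearMap.ker (coord6 k x y))).mpr ?_ ht
  rintro _ ⟨n, m, t, hn, hj, rfl⟩
  rw [SetLike.mem_coe, LinearMap.mem_ker, coord6_tmul,
    isWt_coord isWt_twist_lau3Basis hn (fun h => by rw [h] at hj; omega), zero_mul]

/-- The weight of a test vector after `E^b` is applied to its second factor; the first factor is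
twisted by `ω`, which changes the sign of its weight. -/
def testWt (A₀ A B C : ℤ) (b : Fin 6 → ℕ) (i : Fin 3) : ℤ :=
  -exp3Wt (tvecExp A₀ A₀ A₀ 0) i + exp3Wt (tvecExp A B C b) i

/-- The coefficient that detects `F^a E^b`, evaluated on the action of the monomials. -/
theorem exists_coord6_fullPBW {A₀ A B C : ℕ} {a b : Fin 6 → ℕ} (a₀ b₀ : Fin 6 → ℕ)
    (h0 : a 2 + a 1 + a 0 ≤ A₀) (h1 : a 4 + a 3 ≤ A₀) (h2 : a 5 ≤ A₀)
    (hA : b 2 + b 1 + b 0 ≤ A) (hB : b 4 + b 3 ≤ B) (hC : b 5 ≤ C)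
    (h : pbwHeight a ≤ pbwHeight a₀) :
    ∃ γ : RatFunc k, γ ≠ 0 ∧ ∀ l, coord6 k (tvecExp A₀ A₀ A₀ a₀) (tvecExp A B C b₀)
      (lau6 k (fullPBW k (a, l, b)) (wvec k A₀ A₀ A₀ ⊗ₜ wvec k A B C)) =
        if a = a₀ ∧ b = b₀ then q k ^ (∑ i, l i * testWt A₀ A B C b₀ i) * γ else 0 := by
  obtain ⟨γ₁, hγ₁, e₁⟩ := lau3_pbw (k := k) h0 h1 h2
  obtain ⟨γ₂, hγ₂, e₂⟩ := lau3_pbw (k := k) hA hB hC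
  rw [tvec_eq] at e₁ e₂
  have w1 := isWt_twist_lau3Basis (k := k) (tvecExp A₀ A₀ A₀ 0)
  rw [← wvec_eq] at w1
  have w2 : IsWt (lau3 k) (exp3Wt (tvecExp A B C b))
      (lau3 k (pbw (q k) (Uq.E k) b) (wvec k A B C)) := by
    rw [e₂]; exact (isWt_lau3Basis _).smul _
  obtain ⟨γ, hγ, e⟩ := exists_lead_fullPBW a b w1 w2
  rw [AlgHom.comp_apply, omega_pbw, e₁, e₂] at e
  refine ⟨γ * γ₁ * γ₂, mul_ne_zero (mul_ne_zero hγ hγ₁) hγ₂, fun l => ?_⟩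
  have hz : coord6 k (tvecExp A₀ A₀ A₀ a₀) (tvecExp A B C b₀) _ = 0 :=
    coord6_tensGE ?_ _ _ (e l)
  · rw [map_sub, sub_eq_zero] at hz
    refine hz.trans ?_
    rw [map_smul, coord6_tmul]
    simp only [map_smul, Module.Basis.coord_apply, Module.Basis.repr_self, smul_eq_mul]
    by_cases ea : a = a₀
    · by_cases eb : b = b₀
      · subst ea eb
        rw [if_pos ⟨rfl, rfl⟩]
        simp [testWt]
        ring
      · rw [if_neg (fun h => eb h.2),
          Finsupp.single_eq_of_ne (fun h => eb (tvecExp_injective _ _ _ h.symm))]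
        simp
    · rw [if_neg (fun h => ea h.1),
        Finsupp.single_eq_of_ne (fun h => ea (tvecExp_injective _ _ _ h.symm))]
      simp
  · have e1 : ∀ n : Fin 3 → ℤ, wtHeight (-n) = -wtHeight n := fun n => by
      simp only [wtHeight, Pi.neg_apply]; ring
    rw [e1, e1, wtHeight_tvecExp]
    omega

variable (k) in
/-- The characters of `ℕ³` that separate the `K_λ`. -/
noncomputable def testChar (l : Fin 3 → ℤ) : Multiplicative (Fin 3 → ℕ) →* RatFunc k where
  toFun p := q k ^ (-(l 0 * p.toAdd 2) + l 1 * (p.toAdd 2 - p.toAdd 1) +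
    l 2 * (p.toAdd 1 - p.toAdd 0) : ℤ)
  map_one' := by simp
  map_mul' p p' := by
    rw [← zpow_add₀ (Uq.q_facts k).1]
    congr 1
    simp only [toAdd_mul, Pi.add_apply]
    push_cast
    ring

theorem testChar_injective : Function.Injective (testChar k) := fun l l' h => by
  have key : ∀ i : Fin 3, _ := fun i =>
    q_pow_injective (DFunLike.congr_fun h (Multiplicative.ofAdd (Pi.single i 1)))
  have e0 := key 0
  have e1 := key 1
  have e2 := key 2
  simp [Pi.single_apply] at e0 e1 e2
  ext i
  fin_cases i <;> simp <;> omega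

/-- A combination of the monomials `F^a K_λ E^b` that kills all test vectors is trivial. If `F^a`
has greatest height among those that occur, then the coefficient of the result at the basis vector
that belongs to `a` and `b` only involves the monomials with these exponents; the remaining sum over
`λ` vanishes for all `A, B, C`, so that the independence of characters applies. -/
theorem eq_zero_of_lau6_eq_zero {c : PBWIndex →₀ RatFunc k}
    (h : ∀ A₀ A B C : ℕ, lau6 k (Finsupp.linearCombination _ (fullPBW k) c)
      (wvec k A₀ A₀ A₀ ⊗ₜ wvec k A B C) = 0) : c = 0 := by
  by_contra hc
  obtain ⟨x₀, hx₀, hmax⟩ := Finset.exists_max_image c.support (fun x => pbwHeight x.1)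
    (Finsupp.support_nonempty_iff.mpr hc)
  -- with exponents at least `A₀` in the test vectors, no monomial that occurs kills them
  let A₀ : ℕ := ∑ x ∈ c.support, ∑ i, (x.1 i + x.2.2 i)
  have hA : ∀ x ∈ c.support, ∑ i, (x.1 i + x.2.2 i) ≤ A₀ := fun x hx =>
    Finset.single_le_sum (f := fun x : PBWIndex => ∑ i, (x.1 i + x.2.2 i))
      (fun _ _ => Nat.zero_le _) hx
  let S := c.support.filter fun x => x.1 = x₀.1 ∧ x.2.2 = x₀.2.2
  have hS : x₀ ∈ S := Finset.mem_filter.mpr ⟨hx₀, rfl, rfl⟩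
  have inj : Set.InjOn (fun x : PBWIndex => x.2.1) S := fun x hx y hy e => by
    obtain ⟨-, h1, h2⟩ := Finset.mem_filter.mp hx
    obtain ⟨-, h3, h4⟩ := Finset.mem_filter.mp hy
    exact Prod.ext (h1.trans h3.symm) (Prod.ext e (h2.trans h4.symm))
  have li : LinearIndependent (RatFunc k) fun l : Fin 3 → ℤ =>
      (testChar k l : Multiplicative (Fin 3 → ℕ) → RatFunc k) :=
    (linearIndependent_monoidHom (Multiplicative (Fin 3 → ℕ)) (RatFunc k)).comp _
      testChar_injective
  have hne : c x₀ * q k ^ (∑ i, x₀.2.1 i * testWt A₀ A₀ A₀ A₀ x₀.2.2 i) ≠ 0 :=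
    mul_ne_zero (Finsupp.mem_support_iff.mp hx₀) (zpow_ne_zero _ (Uq.q_facts k).1)
  refine hne (linearIndependent_iff'.mp li (S.image fun x => x.2.1)
    (fun l => c (x₀.1, l, x₀.2.2) * q k ^ (∑ i, l i * testWt A₀ A₀ A₀ A₀ x₀.2.2 i)) ?_ x₀.2.1
    (Finset.mem_image_of_mem _ hS))
  rw [Finset.sum_image inj]
  ext p
  have h1 := congrArg (coord6 k (tvecExp A₀ A₀ A₀ x₀.1)
    (tvecExp (A₀ + p.toAdd 0 : ℕ) (A₀ + p.toAdd 1 : ℕ) (A₀ + p.toAdd 2 : ℕ) x₀.2.2))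
    (h A₀ (A₀ + p.toAdd 0) (A₀ + p.toAdd 1) (A₀ + p.toAdd 2))
  have ex : ∀ a b : Fin 6 → ℕ, ∃ γ : RatFunc k, γ ≠ 0 ∧ ∀ l, (a, l, b) ∈ c.support →
      coord6 k (tvecExp A₀ A₀ A₀ x₀.1)
        (tvecExp (A₀ + p.toAdd 0 : ℕ) (A₀ + p.toAdd 1 : ℕ) (A₀ + p.toAdd 2 : ℕ) x₀.2.2)
        (lau6 k (fullPBW k (a, l, b)) (wvec k A₀ A₀ A₀ ⊗ₜ
          wvec k (A₀ + p.toAdd 0 : ℕ) (A₀ + p.toAdd 1 : ℕ) (A₀ + p.toAdd 2 : ℕ))) =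
      if a = x₀.1 ∧ b = x₀.2.2 then q k ^ (∑ i, l i * testWt A₀ (A₀ + p.toAdd 0 : ℕ)
        (A₀ + p.toAdd 1 : ℕ) (A₀ + p.toAdd 2 : ℕ) x₀.2.2 i) * γ else 0 := fun a b => by
    by_cases hab : ∃ l, (a, l, b) ∈ c.support
    · obtain ⟨l, hl⟩ := hab
      have := hA _ hl
      simp only [Fin.sum_univ_six] at this
      obtain ⟨γ, hγ, e⟩ := exists_coord6_fullPBW (k := k) (A₀ := A₀) (A := A₀ + p.toAdd 0)
        (B := A₀ + p.toAdd 1) (C := A₀ + p.toAdd 2) (a := a) (b := b) x₀.1 x₀.2.2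
        (by omega) (by omega) (by omega) (by omega) (by omega) (by omega) (hmax _ hl)
      exact ⟨γ, hγ, fun l _ => e l⟩
    · exact ⟨1, one_ne_zero, fun l hl => absurd ⟨l, hl⟩ hab⟩
  choose γ hγ e using ex
  rw [Finsupp.linearCombination_apply, Finsupp.sum, map_sum, LinearMap.sum_apply, map_sum,
    map_zero] at h1
  have h2 : ∑ x ∈ S, c x * (q k ^ (∑ i, x.2.1 i * testWt A₀ (A₀ + p.toAdd 0 : ℕ)
        (A₀ + p.toAdd 1 : ℕ) (A₀ + p.toAdd 2 : ℕ) x₀.2.2 i) * γ x₀.1 x₀.2.2) = 0 := by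
    rw [← h1, Finset.sum_filter]
    refine Finset.sum_congr rfl fun x hx => ?_
    rw [map_smul, LinearMap.smul_apply, map_smul, smul_eq_mul, e x.1 x.2.2 x.2.1 hx]
    split_ifs with h3
    · rw [h3.1, h3.2]
    · rw [mul_zero]
  simp only [← mul_assoc] at h2
  rw [← Finset.sum_mul] at h2
  have h3 := (mul_eq_zero.mp h2).resolve_right (hγ _ _)
  rw [Finset.sum_apply, Pi.zero_apply, ← h3]
  refine Finset.sum_congr rfl fun x hx => ?_
  obtain ⟨-, e1, e2⟩ := Finset.mem_filter.mp hx
  rw [Pi.smul_apply, smul_eq_mul, ← e1, ← e2, mul_assoc]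
  congr 1
  change _ * q k ^ (_ : ℤ) = _
  rw [← zpow_add₀ (Uq.q_facts k).1]
  congr 1
  simp [testWt, exp3Wt, expWt, tvecExp, Fin.sum_univ_three]
  ring

variable (k) in
/-- The Poincaré-Birkhoff-Witt theorem: with `span_fullPBW`, the monomials form a basis. -/
theorem linearIndependent_fullPBW : LinearIndependent (RatFunc k) (fullPBW k) :=
  linearIndependent_iff.mpr fun c hc => eq_zero_of_lau6_eq_zero fun A₀ A B C => by
    rw [hc, map_zero, LinearMap.zero_apply]

/-- The test vectors separate the elements of `U`. -/
theorem eq_zero_of_lau6 {u : Uq k} (h : ∀ A₀ A B C : ℕ,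
    lau6 k u (wvec k A₀ A₀ A₀ ⊗ₜ wvec k A B C) = 0) : u = 0 := by
  have hu : u ∈ Submodule.span (RatFunc k) (Set.range (fullPBW k)) := by
    rw [span_fullPBW]; trivial
  obtain ⟨c, rfl⟩ := Finsupp.mem_span_range_iff_exists_finsupp.mp hu
  have := eq_zero_of_lau6_eq_zero (c := c) h
  rw [this, Finsupp.sum_zero_index]

end

/-! ### Finite dimensional modules of type `1` separate the elements of `U` -/

section
variable {k : Type w} [Field k]
variable {M N : Type*} [AddCommGroup M] [Module (RatFunc k) M] [AddCommGroup N]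
  [Module (RatFunc k) N] {ρ : Rep k M} {σ : Rep k N}

/-- `P` is a subrepresentation that is spanned by finitely many weight vectors. -/
structure IsFiniteSub (ρ : Rep k M) (P : Submodule (RatFunc k) M) : Prop where
  exists_span : ∃ s : Set M, s.Finite ∧ (∀ m ∈ s, ∃ n, IsWt ρ n m) ∧ P = Submodule.span _ s
  E_mem : ∀ i, ∀ m ∈ P, ρ (Uq.E k i) m ∈ P
  F_mem : ∀ i, ∀ m ∈ P, ρ (Uq.F k i) m ∈ P

namespace IsFiniteSub
variable {P : Submodule (RatFunc k) M} {Q : Submodule (RatFunc k) N}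

theorem K_mem (h : IsFiniteSub ρ P) (i : Fin 3) : ∀ m ∈ P, ρ (Uq.K k i) m ∈ P := fun m hm => by
  obtain ⟨s, -, hs, rfl⟩ := h.exists_span
  refine (Submodule.span_le (p := (Submodule.span _ s).comap (ρ (Uq.K k i)))).mpr ?_ hm
  intro m hm
  obtain ⟨n, hn⟩ := hs m hm
  rw [SetLike.mem_coe, Submodule.mem_comap, hn i]
  exact Submodule.smul_mem _ _ (Submodule.subset_span hm)

theorem Kinv_mem (h : IsFiniteSub ρ P) (i : Fin 3) :
    ∀ m ∈ P, ρ (Uq.Kinv k i) m ∈ P := fun m hm => by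
  obtain ⟨s, -, hs, rfl⟩ := h.exists_span
  refine (Submodule.span_le (p := (Submodule.span _ s).comap (ρ (Uq.Kinv k i)))).mpr ?_ hm
  intro m hm
  obtain ⟨n, hn⟩ := hs m hm
  rw [SetLike.mem_coe, Submodule.mem_comap, hn.Kinv i]
  exact Submodule.smul_mem _ _ (Submodule.subset_span hm)

/-- Stability under the `E_i` and `F_i` suffices, as `K_i` acts by scalars on weight vectors. -/
theorem mem (h : IsFiniteSub ρ P) (u : Uq k) : ∀ m ∈ P, ρ u m ∈ P := by
  let S : Subalgebra (RatFunc k) (Uq k) :=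
    { carrier := {u | ∀ m ∈ P, ρ u m ∈ P}
      mul_mem' := fun {x y} hx hy m hm => by
        rw [map_mul, Module.End.mul_apply]; exact hx _ (hy m hm)
      add_mem' := fun {x y} hx hy m hm => by
        rw [map_add, LinearMap.add_apply]; exact add_mem (hx m hm) (hy m hm)
      algebraMap_mem' := fun r m hm => by
        rw [AlgHom.commutes, Module.algebraMap_end_apply]; exact P.smul_mem r hm }
  have : u ∈ S := by
    have : (⊤ : Subalgebra (RatFunc k) (Uq k)) ≤ S := by
      rw [← adjoin_gens, Algebra.adjoin_le_iff]
      rintro _ (((⟨i, rfl⟩ | ⟨i, rfl⟩) | ⟨i, rfl⟩) | ⟨i, rfl⟩)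
      · exact h.E_mem i
      · exact h.F_mem i
      · exact h.K_mem i
      · exact h.Kinv_mem i
    exact this trivial
  exact this

theorem omega (h : IsFiniteSub ρ P) : IsFiniteSub (ρ.comp (QSP.omega k)) P where
  exists_span := by
    obtain ⟨s, hf, hs, e⟩ := h.exists_span
    exact ⟨s, hf, fun m hm => let ⟨n, hn⟩ := hs m hm; ⟨-n, hn.omega⟩, e⟩
  E_mem i m hm := by rw [AlgHom.comp_apply, omega_E]; exact h.F_mem i m hm
  F_mem i m hm := by rw [AlgHom.comp_apply, omega_F]; exact h.E_mem i m hm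

theorem tmul (h : IsFiniteSub ρ P) (h' : IsFiniteSub σ Q) :
    IsFiniteSub (Rep.tens ρ σ) (Submodule.map₂ (TensorProduct.mk (RatFunc k) M N) P Q) := by
  refine ⟨?_, fun i => ?_, fun i => ?_⟩
  · obtain ⟨s, hf, hs, rfl⟩ := h.exists_span
    obtain ⟨t, hf', ht, rfl⟩ := h'.exists_span
    refine ⟨_, hf.image2 _ hf', ?_, Submodule.map₂_span_span _ _ _ _⟩
    rintro _ ⟨m, hm, n, hn, rfl⟩
    obtain ⟨a, ha⟩ := hs m hm
    obtain ⟨b, hb⟩ := ht n hn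
    exact ⟨_, ha.tmul hb⟩
  · refine fun x hx => (Submodule.map₂_le (r := (Submodule.map₂ (TensorProduct.mk (RatFunc k) M N)
      P Q).comap (Rep.tens ρ σ (Uq.E k i)))).mpr ?_ hx
    intro m hm n hn
    rw [Submodule.mem_comap, TensorProduct.mk_apply, Rep.tens_E]
    exact add_mem (Submodule.apply_mem_map₂ _ (h.E_mem i m hm) hn)
      (Submodule.apply_mem_map₂ _ (h.K_mem i m hm) (h'.E_mem i n hn))
  · refine fun x hx => (Submodule.map₂_le (r := (Submodule.map₂ (TensorProduct.mk (RatFunc k) M N)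
      P Q).comap (Rep.tens ρ σ (Uq.F k i)))).mpr ?_ hx
    intro m hm n hn
    rw [Submodule.mem_comap, TensorProduct.mk_apply, Rep.tens_F]
    exact add_mem (Submodule.apply_mem_map₂ _ (h.F_mem i m hm) (h'.Kinv_mem i n hn))
      (Submodule.apply_mem_map₂ _ hm (h'.F_mem i n hn))

/-- The action of `U` on a subrepresentation. -/
noncomputable def rep (h : IsFiniteSub ρ P) : Rep k P where
  toFun u := (ρ u).restrict (h.mem u)
  map_one' := by ext; simp
  map_mul' u v := by ext; simp
  map_zero' := by ext; simp
  map_add' u v := by ext; simp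
  commutes' r := by ext; simp [Module.algebraMap_end_apply]

end IsFiniteSub

/-- The homogeneous polynomials of degree `d` are a subrepresentation of the Laurent polynomials. -/
theorem isFiniteSub_lau (d : ℤ) : IsFiniteSub (lau k) (Submodule.span (RatFunc k)
    ((fun α => Finsupp.single α 1) '' {α : Fin 4 → ℤ | 0 ≤ α ∧ ∑ i, α i = d})) := by
  have mem : ∀ α : Fin 4 → ℤ, 0 ≤ α → ∑ i, α i = d → ∀ r : RatFunc k, Finsupp.single α r ∈
      Submodule.span (RatFunc k)
        ((fun α => Finsupp.single α 1) '' {α : Fin 4 → ℤ | 0 ≤ α ∧ ∑ i, α i = d}) :=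
    fun α h h' r => by
      rw [← mul_one r, ← smul_eq_mul, ← Finsupp.smul_single]
      exact Submodule.smul_mem _ _ (Submodule.subset_span ⟨α, ⟨h, h'⟩, rfl⟩)
  refine ⟨⟨_, Set.Finite.image _ ?_, ?_, rfl⟩, fun i m hm => ?_, fun i m hm => ?_⟩
  · refine (Set.finite_Icc (0 : Fin 4 → ℤ) (fun _ => d)).subset fun α ⟨h, h'⟩ => ⟨h, fun i => ?_⟩
    rw [← h']
    exact Finset.single_le_sum (fun j _ => h j) (Finset.mem_univ i)
  · rintro _ ⟨α, -, rfl⟩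
    exact ⟨_, isWt_lau α 1⟩
  · rw [← Submodule.mem_comap]
    refine (?_ : _ ≤ Submodule.comap (lau k (Uq.E k i)) _) hm
    rw [Submodule.span_le]
    rintro _ ⟨α, ⟨h, h'⟩, rfl⟩
    rw [SetLike.mem_coe, Submodule.mem_comap, lau_E]
    by_cases h0 : α i.succ = 0
    · rw [h0, qint_zero, mul_zero, Finsupp.single_zero]; exact zero_mem _
    · have p : 0 < α i.succ := lt_of_le_of_ne (h _) (Ne.symm h0)
      refine mem _ (fun j => ?_) ?_ _
      · have := h j
        revert p this
        fin_cases i <;> fin_cases j <;> simp [ratio, Pi.single_apply] <;> omega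
      · rw [← h']
        fin_cases i <;> simp [ratio, Pi.single_apply, Fin.sum_univ_four] <;> ring
  · rw [← Submodule.mem_comap]
    refine (?_ : _ ≤ Submodule.comap (lau k (Uq.F k i)) _) hm
    rw [Submodule.span_le]
    rintro _ ⟨α, ⟨h, h'⟩, rfl⟩
    rw [SetLike.mem_coe, Submodule.mem_comap, lau_F]
    by_cases h0 : α i.castSucc = 0
    · rw [h0, qint_zero, mul_zero, Finsupp.single_zero]; exact zero_mem _
    · have p : 0 < α i.castSucc := lt_of_le_of_ne (h _) (Ne.symm h0)
      refine mem _ (fun j => ?_) ?_ _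
      · have := h j
        revert p this
        fin_cases i <;> fin_cases j <;> simp [ratio, Pi.single_apply] <;> omega
      · rw [← h']
        fin_cases i <;> simp [ratio, Pi.single_apply, Fin.sum_univ_four]

variable (k) in
/-- The test vectors lie in finite dimensional subrepresentations. -/
theorem exists_isFiniteSub_wvec (A B C : ℕ) :
    ∃ P, IsFiniteSub (lau3 k) P ∧ wvec k A B C ∈ P := by
  refine ⟨_, (isFiniteSub_lau A).tmul ((isFiniteSub_lau B).tmul (isFiniteSub_lau C)),
    Submodule.apply_mem_map₂ _ (Submodule.subset_span ⟨_, ⟨fun i => ?_, ?_⟩, rfl⟩)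
      (Submodule.apply_mem_map₂ _ (Submodule.subset_span ⟨_, ⟨fun i => ?_, ?_⟩, rfl⟩)
        (Submodule.subset_span ⟨_, ⟨fun i => ?_, ?_⟩, rfl⟩))⟩
  any_goals (fin_cases i <;> simp)
  all_goals simp [Fin.sum_univ_four]

/-- An element of `U` that acts by zero on all finite dimensional modules of type `1` is zero. -/
theorem eq_zero_of_isTypeOne {u : Uq k} (h : ∀ (M : Type w) [AddCommGroup M]
    [Module (RatFunc k) M] [Module (Uq k) M] [IsScalarTower (RatFunc k) (Uq k) M],
    IsTypeOne (k := k) M → ∀ m : M, u • m = 0) : u = 0 := by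
  refine eq_zero_of_lau6 fun A₀ A B C => ?_
  obtain ⟨P, hP, hv⟩ := exists_isFiniteSub_wvec k A₀ A₀ A₀
  obtain ⟨Q, hQ, hw⟩ := exists_isFiniteSub_wvec k A B C
  have hR := hP.omega.tmul hQ
  have ht := Submodule.apply_mem_map₂ (TensorProduct.mk (RatFunc k) (Lau3 k) (Lau3 k)) hv hw
  change IsFiniteSub (lau6 k) _ at hR
  generalize Submodule.map₂ (TensorProduct.mk (RatFunc k) (Lau3 k) (Lau3 k)) P Q = R at hR ht
  let _ : Module (Uq k) R := Module.compHom R hR.rep.toRingHom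
  have e : ∀ (v : Uq k) (m : R), v • m = hR.rep v m := fun _ _ => rfl
  have : IsScalarTower (RatFunc k) (Uq k) R := ⟨fun r v m => by
    rw [e, e, map_smul, LinearMap.smul_apply]⟩
  have key : IsTypeOne (k := k) R := by
    obtain ⟨s, hf, hs, e'⟩ := hR.exists_span
    refine ⟨?_, ?_⟩
    · rw [Module.Finite.iff_fg, e']
      exact Submodule.fg_span hf
    · refine Submodule.map_injective_of_injective R.injective_subtype (le_antisymm
        (Submodule.map_mono le_top) ?_)
      rw [Submodule.map_top, Submodule.range_subtype]
      conv_lhs => rw [e']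
      rw [Submodule.span_le]
      intro m hm
      obtain ⟨n, hn⟩ := hs m hm
      have hm' : m ∈ R := e' ▸ Submodule.subset_span hm
      refine ⟨⟨m, hm'⟩, Submodule.mem_iSup_of_mem n fun i => ?_, rfl⟩
      exact Subtype.ext (hn i)
  have := h R key ⟨_, ht⟩
  rw [e] at this
  exact congrArg Subtype.val this

end

/-! ### Elements of `U⁺` that commute with all `F_i` -/

section
variable {k : Type*} [Field k]

theorem qnum_eq_zero {n : ℕ} : qnum k n = 0 ↔ n = 0 := by
  refine ⟨fun h => ?_, fun h => by simp [h, qnum]⟩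
  have h1 := geom_sum_mul (q k ^ 2) n
  simp only [← pow_mul] at h1
  rw [qnum] at h
  rw [h, zero_mul] at h1
  have h2 : q k ^ ((2 * n : ℕ) : ℤ) = q k ^ (0 : ℤ) := by
    rw [zpow_natCast, zpow_zero, ← sub_eq_zero, ← h1]
  have := q_pow_injective h2
  omega

/-- `u` has weight `n` for the adjoint action of `K i`. -/
def IsKWt (i : Fin 3) (n : ℤ) (u : Uq k) : Prop := Uq.K k i * u = q k ^ n • (u * Uq.K k i)

namespace IsKWt
variable {i : Fin 3} {m n : ℤ} {u v : Uq k}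

theorem E (i j : Fin 3) : IsKWt i (cartan i j) (Uq.E k j) := (Uq.rel k).KE i j

theorem mul (hu : IsKWt i m u) (hv : IsKWt i n v) : IsKWt i (m + n) (u * v) := by
  rw [IsKWt, ← mul_assoc, hu, smul_mul_assoc, mul_assoc, hv, mul_smul_comm, smul_smul,
    ← zpow_add₀ (Uq.q_facts k).1, mul_assoc]

theorem qbr (hu : IsKWt i m u) (hv : IsKWt i n v) : IsKWt i (m + n) (qbr (q k) u v) := by
  have h1 := hu.mul hv
  have h2 := hv.mul hu
  rw [add_comm] at h2
  unfold IsKWt QSP.qbr at *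
  rw [mul_sub, h1, mul_smul_comm, h2, sub_mul, smul_sub, smul_mul_assoc, smul_comm]

theorem pow (hu : IsKWt i m u) (e : ℕ) : IsKWt i (e * m) (u ^ e) := by
  induction e with
  | zero => simp [IsKWt]
  | succ e ih =>
    rw [pow_succ, Nat.cast_succ, add_mul, one_mul]
    exact ih.mul hu

theorem Kinv (h : IsKWt i m u) : u * Uq.Kinv k i = q k ^ m • (Uq.Kinv k i * u) := by
  have h1 := congrArg (fun t => Uq.Kinv k i * t * Uq.Kinv k i) h
  beta_reduce at h1
  rw [← mul_assoc, (Uq.rel k).LK, one_mul, mul_smul_comm, smul_mul_assoc, mul_assoc, mul_assoc,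
    (Uq.rel k).KL, mul_one] at h1
  exact h1

end IsKWt

/-- `r` is the value at `u` of the `i`-th skew derivation of `U⁺`: the commutator of `u` with `F_i`
is `(r K_i - K_i⁻¹ r') / (q - q⁻¹)` for some `r'` in `U⁺`. -/
def SkewDer (i : Fin 3) (u r : Uq k) : Prop := r ∈ Uplus k ∧ ∃ r' ∈ Uplus k,
  u * Uq.F k i - Uq.F k i * u = (q k - (q k)⁻¹)⁻¹ • (r * Uq.K k i - Uq.Kinv k i * r')

theorem E_mem_Uplus (i : Fin 3) : Uq.E k i ∈ Uplus k := Algebra.subset_adjoin ⟨i, rfl⟩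

theorem qbr_mem_Uplus {u v : Uq k} (hu : u ∈ Uplus k) (hv : v ∈ Uplus k) :
    qbr (q k) u v ∈ Uplus k :=
  sub_mem (mul_mem hu hv) (Subalgebra.smul_mem _ (mul_mem hv hu) _)

namespace SkewDer
variable {i : Fin 3} {m n : ℤ} {u v r s : Uq k}

theorem of_commute (h : u * Uq.F k i = Uq.F k i * u) : SkewDer i u 0 :=
  ⟨zero_mem _, 0, zero_mem _, by simp [h]⟩

theorem E_self : SkewDer i (Uq.E k i) 1 :=
  ⟨one_mem _, 1, one_mem _, by simpa using (Uq.rel k).EF i i⟩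

theorem E_ne {j : Fin 3} (h : i ≠ j) : SkewDer i (Uq.E k j) 0 :=
  of_commute ((Uq.rel k).commute_EF h.symm)

theorem add (hu : SkewDer i u r) (hv : SkewDer i v s) : SkewDer i (u + v) (r + s) := by
  obtain ⟨hr, r', hr', e⟩ := hu
  obtain ⟨hs, s', hs', e'⟩ := hv
  refine ⟨add_mem hr hs, r' + s', add_mem hr' hs', ?_⟩
  rw [add_mul, mul_add, add_sub_add_comm, e, e', ← smul_add, add_mul, mul_add, add_sub_add_comm]

theorem smul (hu : SkewDer i u r) (t : RatFunc k) : SkewDer i (t • u) (t • r) := by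
  obtain ⟨hr, r', hr', e⟩ := hu
  refine ⟨Subalgebra.smul_mem _ hr t, t • r', Subalgebra.smul_mem _ hr' t, ?_⟩
  rw [smul_mul_assoc, mul_smul_comm, ← smul_sub, e, smul_mul_assoc, mul_smul_comm, ← smul_sub,
    smul_comm]

theorem sum {ι : Type*} (S : Finset ι) {f g : ι → Uq k} (h : ∀ x ∈ S, SkewDer i (f x) (g x)) :
    SkewDer i (∑ x ∈ S, f x) (∑ x ∈ S, g x) := by
  classical
  induction S using Finset.induction_on with
  | empty => simpa using of_commute (k := k) (i := i) (u := 0) (by simp)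
  | insert a S ha ih =>
    rw [Finset.sum_insert ha, Finset.sum_insert ha]
    exact (h a (Finset.mem_insert_self _ _)).add
      (ih fun x hx => h x (Finset.mem_insert_of_mem hx))

theorem mul (hu : SkewDer i u r) (hv : SkewDer i v s) (hu' : u ∈ Uplus k) (hv' : v ∈ Uplus k)
    (wu : IsKWt i m u) (wv : IsKWt i n v) :
    SkewDer i (u * v) (u * s + q k ^ n • (r * v)) := by
  obtain ⟨hr, r', hr', e⟩ := hu
  obtain ⟨hs, s', hs', e'⟩ := hv
  refine ⟨add_mem (mul_mem hu' hs) (Subalgebra.smul_mem _ (mul_mem hr hv') _),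
    r' * v + q k ^ m • (u * s'),
    add_mem (mul_mem hr' hv') (Subalgebra.smul_mem _ (mul_mem hu' hs') _),
    ?_⟩
  have e1 : u * v * Uq.F k i - Uq.F k i * (u * v) =
      u * (v * Uq.F k i - Uq.F k i * v) + (u * Uq.F k i - Uq.F k i * u) * v := by noncomm_ring
  rw [e1, e, e', mul_smul_comm, smul_mul_assoc, ← smul_add]
  congr 1
  rw [mul_sub, sub_mul, mul_assoc r, wv, ← mul_assoc u (Uq.Kinv k i), wu.Kinv]
  simp only [add_mul, mul_add, mul_smul_comm, smul_mul_assoc, mul_assoc]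
  abel

theorem qbr_right (hu : SkewDer i u 0) (hv : SkewDer i v 1) (hu' : u ∈ Uplus k)
    (hv' : v ∈ Uplus k) (wu : IsKWt i (-1) u) (wv : IsKWt i n v) :
    SkewDer i (qbr (q k) u v) ((1 - (q k)⁻¹ * (q k)⁻¹) • u) := by
  have h := (hu.mul hv hu' hv' wu wv).add
    (((hv.mul hu hv' hu' wv wu)).smul (-(q k)⁻¹))
  convert h using 1
  · rw [qbr, neg_smul, sub_eq_add_neg]
  · simp [sub_smul, smul_smul, sub_eq_add_neg, add_smul]

theorem qbr_left (hu : SkewDer i u 1) (hv : SkewDer i v 0) (hu' : u ∈ Uplus k)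
    (hv' : v ∈ Uplus k) (wu : IsKWt i m u) (wv : IsKWt i (-1) v) :
    SkewDer i (qbr (q k) u v) 0 := by
  have h := (hu.mul hv hu' hv' wu wv).add
    (((hv.mul hu hv' hu' wv wu)).smul (-(q k)⁻¹))
  convert h using 1
  · rw [qbr, neg_smul, sub_eq_add_neg]
  · simp

theorem qbr_zero (hu : SkewDer i u 0) (hv : SkewDer i v 0) (hu' : u ∈ Uplus k)
    (hv' : v ∈ Uplus k) (wu : IsKWt i m u) (wv : IsKWt i n v) :
    SkewDer i (qbr (q k) u v) 0 := by
  have h := (hu.mul hv hu' hv' wu wv).add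
    (((hv.mul hu hv' hu' wv wu)).smul (-(q k)⁻¹))
  convert h using 1
  · rw [qbr, neg_smul, sub_eq_add_neg]
  · simp

theorem pow {t : RatFunc k} (hu : SkewDer i u r) (hu' : u ∈ Uplus k) (wu : IsKWt i n u)
    (h : r * u = t • (u * r)) (ht : q k ^ n * t = q k ^ 2) (e : ℕ) :
    SkewDer i (u ^ e) (qnum k e • (u ^ (e - 1) * r)) := by
  induction e with
  | zero => simpa [qnum] using of_commute (k := k) (i := i) (u := 1) (by simp)
  | succ e ih =>
    have h1 := ih.mul hu (pow_mem hu' e) hu' (wu.pow e) wu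
    rw [pow_succ]
    convert h1 using 1
    have h2 : qnum k (e + 1) = 1 + q k ^ 2 * qnum k e := by
      rw [qnum, Finset.sum_range_succ', qnum, Finset.mul_sum, add_comm]
      congr 1
      refine Finset.sum_congr rfl fun j _ => by ring
    rw [h2, Nat.add_sub_cancel, smul_mul_assoc, smul_smul, mul_assoc, h, mul_smul_comm, smul_smul,
      add_smul, one_smul, ← mul_assoc]
    congr 1
    rcases e with _ | e
    · simp [qnum]
    · rw [Nat.add_sub_cancel, ← pow_succ, mul_right_comm, ht]

theorem pow_zero (hu : SkewDer i u 0) (hu' : u ∈ Uplus k) (wu : IsKWt i n u) (e : ℕ) :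
    SkewDer i (u ^ e) 0 := by
  have := hu.pow (t := q k ^ (-n) * q k ^ 2) hu' wu (by simp) (by
    rw [← mul_assoc, ← zpow_add₀ (Uq.q_facts k).1]; simp) e
  simpa using this

theorem mul_left (hu : SkewDer i u 0) (hv : SkewDer i v s) (hu' : u ∈ Uplus k) (hv' : v ∈ Uplus k)
    (wu : IsKWt i m u) (wv : IsKWt i n v) : SkewDer i (u * v) (u * s) := by
  simpa using hu.mul hv hu' hv' wu wv

end SkewDer

variable (k) in
/-- The Poincaré-Birkhoff-Witt basis of `U`. -/
noncomputable def fullBasis : Module.Basis PBWIndex (RatFunc k) (Uq k) :=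
  Module.Basis.mk (linearIndependent_fullPBW k) (span_fullPBW k).ge

theorem coord_fullPBW (x y : PBWIndex) :
    (fullBasis k).coord x (fullPBW k y) = if y = x then 1 else 0 := by
  have : fullPBW k y = fullBasis k y := by rw [fullBasis, Module.Basis.mk_apply]
  rw [this, Module.Basis.coord_apply, Module.Basis.repr_self, Finsupp.single_apply]

theorem pbw_eq_fullPBW (b : Fin 6 → ℕ) : pbw (q k) (Uq.E k) b = fullPBW k (0, 0, b) := by
  simp [fullPBW, pbw_zero, Klam_zero]

theorem Klam_mul_pbw (l : Fin 3 → ℤ) (b : Fin 6 → ℕ) :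
    Klam k l * pbw (q k) (Uq.E k) b = fullPBW k (0, l, b) := by
  simp [fullPBW, pbw_zero]

theorem exists_isKWt_pbw (i : Fin 3) (b : Fin 6 → ℕ) :
    ∃ n, IsKWt i n (pbw (q k) (Uq.E k) b) :=
  have e := fun j => IsKWt.E (k := k) i j
  ⟨_, ((e 2).pow _).mul ((((e 1).qbr (e 2)).pow _).mul ((((e 0).qbr ((e 1).qbr (e 2))).pow _).mul
    (((e 1).pow _).mul ((((e 0).qbr (e 1)).pow _).mul ((e 0).pow _)))))⟩

theorem mem_Uplus_iff {u : Uq k} : u ∈ Uplus k ↔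
    ∃ c : (Fin 6 → ℕ) →₀ RatFunc k, (c.sum fun b s => s • pbw (q k) (Uq.E k) b) = u := by
  rw [← Finsupp.mem_span_range_iff_exists_finsupp, ← Uplus_eq_span]
  rfl

/-- If `u` commutes with `F_i`, the value at `u` of the `i`-th skew derivation is zero. -/
theorem SkewDer.eq_zero {i : Fin 3} {u r : Uq k} (h : SkewDer i u r)
    (hu : u * Uq.F k i = Uq.F k i * u) : r = 0 := by
  obtain ⟨hr, r', hr', e⟩ := h
  obtain ⟨c, rfl⟩ := mem_Uplus_iff.mp hr
  obtain ⟨c', rfl⟩ := mem_Uplus_iff.mp hr'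
  rw [hu, sub_self] at e
  have e1 := sub_eq_zero.mp ((smul_eq_zero.mp e.symm).resolve_left (inv_ne_zero q_sub_inv_ne_zero))
  choose n hn using exists_isKWt_pbw (k := k) i
  suffices h0 : c = 0 by rw [h0, Finsupp.sum_zero_index]
  ext b
  have e2 := congrArg ((fullBasis k).coord (0, Pi.single i 1, b)) e1
  have h1 : ∀ b, pbw (q k) (Uq.E k) b * Uq.K k i =
      q k ^ (-n b) • fullPBW k (0, Pi.single i 1, b) := fun b => by
    rw [← Klam_mul_pbw, Klam_single, hn, smul_smul, ← zpow_add₀ (Uq.q_facts k).1, neg_add_cancel,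
      zpow_zero, one_smul]
  have h2 : ∀ b, Uq.Kinv k i * pbw (q k) (Uq.E k) b = fullPBW k (0, -Pi.single i 1, b) :=
    fun b => by rw [← Klam_mul_pbw, Klam_neg_single]
  have h3 : (-Pi.single i 1 : Fin 3 → ℤ) ≠ Pi.single i 1 := fun h => by
    have := congrFun h i
    simp at this
  simp only [Finsupp.sum, Finset.sum_mul, Finset.mul_sum, smul_mul_assoc, mul_smul_comm, h1, h2,
    map_sum, map_smul, coord_fullPBW, Prod.mk.injEq, h3, true_and, false_and, if_false, smul_zero,
    Finset.sum_const_zero, smul_eq_mul, mul_ite, mul_one, mul_zero, Finset.sum_ite_eq'] at e2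
  by_contra hb
  rw [if_pos (Finsupp.mem_support_iff.mpr hb)] at e2
  exact mul_ne_zero hb (zpow_ne_zero _ (Uq.q_facts k).1) e2

/-- If the skew derivation maps the monomials that occur in `u` to combinations of distinct
monomials, and `u` commutes with `F_i`, then the coefficients of these combinations vanish. -/
theorem coeff_eq_zero {i : Fin 3} {c : (Fin 6 → ℕ) →₀ RatFunc k} {J : Type*} [Fintype J]
    {κ : J → (Fin 6 → ℕ) → RatFunc k} {σ : J → (Fin 6 → ℕ) → Fin 6 → ℕ}
    (hc : (c.sum fun b s => s • pbw (q k) (Uq.E k) b) * Uq.F k i =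
      Uq.F k i * c.sum fun b s => s • pbw (q k) (Uq.E k) b)
    (hD : ∀ b ∈ c.support, SkewDer i (pbw (q k) (Uq.E k) b)
      (∑ j, κ j b • pbw (q k) (Uq.E k) (σ j b)))
    (hσ : ∀ j j' b b', κ j b ≠ 0 → κ j' b' ≠ 0 → b ∈ c.support → b' ∈ c.support →
      σ j b = σ j' b' → j = j' ∧ b = b') :
    ∀ b ∈ c.support, ∀ j, κ j b = 0 := fun b hb j => by
  classical
  by_contra h0
  have h1 := (SkewDer.sum c.support fun b hb => (hD b hb).smul (c b)).eq_zero hc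
  have h2 := congrArg ((fullBasis k).coord (0, 0, σ j b)) h1
  simp only [map_sum, map_smul, pbw_eq_fullPBW, coord_fullPBW, map_zero, Prod.mk.injEq, true_and,
    smul_eq_mul, mul_ite, mul_one, mul_zero] at h2
  rw [Finset.sum_eq_single_of_mem b hb, Finset.sum_eq_single_of_mem j (Finset.mem_univ j),
    if_pos rfl] at h2
  · exact mul_ne_zero (Finsupp.mem_support_iff.mp hb) h0 h2
  · intro j' _ hj
    by_contra h3
    rw [ite_eq_right_iff, not_forall] at h3
    obtain ⟨h3, h4⟩ := h3
    exact hj (hσ j' j b b h4 h0 hb hb h3).1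
  · intro b' hb' hne
    rw [Finset.sum_eq_zero, mul_zero]
    intro j' _
    by_contra h3
    rw [ite_eq_right_iff, not_forall] at h3
    obtain ⟨h3, h4⟩ := h3
    exact hne (hσ j' j b' b h4 h0 hb' hb h3).2

theorem one_sub_q_inv_sq_ne_zero : 1 - (q k)⁻¹ * (q k)⁻¹ ≠ 0 := by
  obtain ⟨hq, -, h⟩ := Uq.q_facts k
  intro h0
  refine h ?_
  field_simp at h0
  rw [h0, mul_zero]

section skewPBW
variable (b : Fin 6 → ℕ)

/-- Of the root vectors, only `E₁` has a nonzero first skew derivative. -/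
theorem skewDer_zero_pbw : SkewDer 0 (pbw (q k) (Uq.E k) b)
    (∑ _j : Fin 1, qnum k (b 5) • pbw (q k) (Uq.E k) ![b 0, b 1, b 2, b 3, b 4, b 5 - 1]) := by
  have w := fun j => IsKWt.E (k := k) 0 j
  have m := fun j => E_mem_Uplus (k := k) j
  have s0 : SkewDer 0 (Uq.E k 0) 1 := .E_self
  have s1 : SkewDer 0 (Uq.E k 1) 0 := .E_ne (by decide)
  have s2 : SkewDer 0 (Uq.E k 2) 0 := .E_ne (by decide)
  have mD := qbr_mem_Uplus (m 1) (m 2)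
  have mG := qbr_mem_Uplus (m 0) mD
  have mA := qbr_mem_Uplus (m 0) (m 1)
  have sD := s1.qbr_zero s2 (m 1) (m 2) (w 1) (w 2)
  have wD := (w 1).qbr (w 2)
  have sG := s0.qbr_left sD (m 0) mD (w 0) wD
  have wG := (w 0).qbr wD
  have sA := s0.qbr_left s1 (m 0) (m 1) (w 0) (w 1)
  have wA := (w 0).qbr (w 1)
  have sE := s0.pow (t := 1) (m 0) (w 0) (by simp) (by simp [cartan]) (b 5)
  have p4 := mul_mem (pow_mem mA (b 4)) (pow_mem (m 0) (b 5))
  have v4 := (wA.pow (b 4)).mul ((w 0).pow (b 5))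
  have p3 := mul_mem (pow_mem (m 1) (b 3)) p4
  have v3 := ((w 1).pow (b 3)).mul v4
  have p2 := mul_mem (pow_mem mG (b 2)) p3
  have v2 := (wG.pow (b 2)).mul v3
  have p1 := mul_mem (pow_mem mD (b 1)) p2
  have v1 := (wD.pow (b 1)).mul v2
  have := (s2.pow_zero (m 2) (w 2) (b 0)).mul_left ((sD.pow_zero mD wD (b 1)).mul_left
    ((sG.pow_zero mG wG (b 2)).mul_left ((s1.pow_zero (m 1) (w 1) (b 3)).mul_left
      ((sA.pow_zero mA wA (b 4)).mul_left sE (pow_mem mA _) (pow_mem (m 0) _) (wA.pow _)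
        ((w 0).pow _)) (pow_mem (m 1) _) p4 ((w 1).pow _) v4) (pow_mem mG _) p3 (wG.pow _) v3)
      (pow_mem mD _) p2 (wD.pow _) v2) (pow_mem (m 2) _) p1 ((w 2).pow _) v1
  convert this using 1
  · simp [pbw]
  · simp [pbw]

/-- Without `E₁`, the second skew derivation only sees `[E₁, E₂]` and `E₂`: it kills `[E₂, E₃]` and
`[E₁, [E₂, E₃]]`. -/
theorem skewDer_one_pbw (h5 : b 5 = 0) : SkewDer 1 (pbw (q k) (Uq.E k) b)
    (∑ j : Fin 2, ![qnum k (b 4) * (1 - (q k)⁻¹ * (q k)⁻¹), q k ^ (b 4) * qnum k (b 3)] j •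
      pbw (q k) (Uq.E k)
        (![![b 0, b 1, b 2, b 3, b 4 - 1, 1], ![b 0, b 1, b 2, b 3 - 1, b 4, 0]] j)) := by
  have w := fun j => IsKWt.E (k := k) 1 j
  have m := fun j => E_mem_Uplus (k := k) j
  have s0 : SkewDer 1 (Uq.E k 0) 0 := .E_ne (by decide)
  have s1 : SkewDer 1 (Uq.E k 1) 1 := .E_self
  have s2 : SkewDer 1 (Uq.E k 2) 0 := .E_ne (by decide)
  have mD := qbr_mem_Uplus (m 1) (m 2)
  have mG := qbr_mem_Uplus (m 0) mD
  have mA := qbr_mem_Uplus (m 0) (m 1)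
  have sD := s1.qbr_left s2 (m 1) (m 2) (w 1) (w 2)
  have wD := (w 1).qbr (w 2)
  have sG := s0.qbr_zero sD (m 0) mD (w 0) wD
  have wG := (w 0).qbr wD
  have sA := s0.qbr_right s1 (m 0) (m 1) (w 0) (w 1)
  have wA : IsKWt 1 1 _ := (w 0).qbr (w 1)
  have hA := mul_qbr_of_serre (Uq.q_facts k).1 (Uq.rel k).serreTriple.xxy
  have sA' := sA.pow (t := q k) mA wA (by rw [smul_mul_assoc, hA, mul_smul_comm, smul_comm])
    (by rw [zpow_one, sq]) (b 4)
  have sE := s1.pow (t := 1) (m 1) (w 1) (by simp) (by simp [cartan]) (b 3)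
  have s3 := sE.mul sA' (pow_mem (m 1) (b 3)) (pow_mem mA (b 4)) ((w 1).pow _) (wA.pow _)
  have p3 := mul_mem (pow_mem (m 1) (b 3)) (pow_mem mA (b 4))
  have v3 := ((w 1).pow (b 3)).mul (wA.pow (b 4))
  have p2 := mul_mem (pow_mem mG (b 2)) p3
  have v2 := (wG.pow (b 2)).mul v3
  have p1 := mul_mem (pow_mem mD (b 1)) p2
  have v1 := (wD.pow (b 1)).mul v2
  have := (s2.pow_zero (m 2) (w 2) (b 0)).mul_left ((sD.pow_zero mD wD (b 1)).mul_left
    ((sG.pow_zero mG wG (b 2)).mul_left s3 (pow_mem mG _) p3 (wG.pow _) v3)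
      (pow_mem mD _) p2 (wD.pow _) v2) (pow_mem (m 2) _) p1 ((w 2).pow _) v1
  convert this using 1
  · simp [pbw, h5]
  · simp [pbw, mul_add, smul_smul]

/-- The third skew derivatives of `[E₁, [E₂, E₃]]`, `[E₂, E₃]` and `E₃` are multiples of `[E₁, E₂]`,
`E₂` and `1`. -/
theorem skewDer_two_pbw (h3 : b 3 = 0) (h4 : b 4 = 0) (h5 : b 5 = 0) :
    SkewDer 2 (pbw (q k) (Uq.E k) b)
      (∑ j : Fin 3, ![qnum k (b 2) * (1 - (q k)⁻¹ * (q k)⁻¹),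
          q k ^ (b 2) * (qnum k (b 1) * (1 - (q k)⁻¹ * (q k)⁻¹)),
          q k ^ (b 1 + b 2) * qnum k (b 0)] j •
        pbw (q k) (Uq.E k) (![![b 0, b 1, b 2 - 1, 0, 1, 0], ![b 0, b 1 - 1, b 2, 1, 0, 0],
          ![b 0 - 1, b 1, b 2, 0, 0, 0]] j)) := by
  obtain ⟨hq, h2, -⟩ := Uq.q_facts k
  have st := (Uq.rel k).serreTriple
  have w := fun j => IsKWt.E (k := k) 2 j
  have m := fun j => E_mem_Uplus (k := k) j
  have s0 : SkewDer 2 (Uq.E k 0) 0 := .E_ne (by decide)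
  have s1 : SkewDer 2 (Uq.E k 1) 0 := .E_ne (by decide)
  have s2 : SkewDer 2 (Uq.E k 2) 1 := .E_self
  have mD := qbr_mem_Uplus (m 1) (m 2)
  have mG := qbr_mem_Uplus (m 0) mD
  have mA := qbr_mem_Uplus (m 0) (m 1)
  have sD := s1.qbr_right s2 (m 1) (m 2) (w 1) (w 2)
  have wD : IsKWt 2 1 _ := (w 1).qbr (w 2)
  have sA := s0.qbr_zero s1 (m 0) (m 1) (w 0) (w 1)
  have wA : IsKWt 2 (-1) _ := (w 0).qbr (w 1)
  have sG := sA.qbr_right s2 mA (m 2) wA (w 2)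
  have wG : IsKWt 2 1 _ := (w 0).qbr wD
  rw [← st.qbr_assoc] at sG
  have sG' := sG.pow (t := q k) mG wG
    (by rw [smul_mul_assoc, st.qbr_mul_qbr_qbr' hq h2, mul_smul_comm, smul_comm])
    (by rw [zpow_one, sq]) (b 2)
  have sD' := sD.pow (t := q k) mD wD
    (by rw [smul_mul_assoc, mul_qbr_of_serre hq st.yyz, mul_smul_comm, smul_comm])
    (by rw [zpow_one, sq]) (b 1)
  have sE := s2.pow (t := 1) (m 2) (w 2) (by simp) (by simp [cartan]) (b 0)
  have s3 := sD'.mul sG' (pow_mem mD (b 1)) (pow_mem mG (b 2)) (wD.pow _) (wG.pow _)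
  have s4 := sE.mul s3 (pow_mem (m 2) (b 0)) (mul_mem (pow_mem mD (b 1)) (pow_mem mG (b 2)))
    ((w 2).pow _) ((wD.pow _).mul (wG.pow _))
  have c : Uq.E k 1 * qbr (q k) (Uq.E k 0) (qbr (q k) (Uq.E k 1) (Uq.E k 2)) ^ b 2 =
      qbr (q k) (Uq.E k 0) (qbr (q k) (Uq.E k 1) (Uq.E k 2)) ^ b 2 * Uq.E k 1 :=
    Commute.pow_right (st.qbr_mul_qbr hq h2).1 _
  convert s4 using 1
  · simp [pbw, h3, h4, h5]
  · simp [pbw, Fin.sum_univ_three, mul_add, smul_smul, mul_assoc, c, add_assoc]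
    rw [← zpow_natCast (q k) (b 1 + b 2), Nat.cast_add]

end skewPBW

/-- An element of `U⁺` that commutes with all `F_i` is a scalar. The skew derivations rule out
the monomials that involve `E₁`, then those that involve `[E₁, E₂]` or `E₂`, then all others
but `1`. -/
theorem exists_smul_one_of_commute_F {z : Uq k} (hz : z ∈ Uplus k)
    (h : ∀ i, z * Uq.F k i = Uq.F k i * z) : ∃ s : RatFunc k, z = s • 1 := by
  obtain ⟨c, rfl⟩ := mem_Uplus_iff.mp hz
  have hq := (Uq.q_facts k).1
  have h1 := one_sub_q_inv_sq_ne_zero (k := k)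
  have z5 : ∀ b ∈ c.support, b 5 = 0 := fun b hb => by
    refine qnum_eq_zero.mp (coeff_eq_zero (h 0) (fun b _ => skewDer_zero_pbw b) ?_ b hb 0)
    intro j j' b b' hb hb' _ _ e
    refine ⟨Subsingleton.elim _ _, ?_⟩
    rw [Ne, qnum_eq_zero] at hb hb'
    have e' := fun i => congrFun e i
    simp [Fin.forall_fin_succ] at e'
    ext i
    fin_cases i <;> simp <;> omega
  have z34 := coeff_eq_zero (h 1) (fun b hb => skewDer_one_pbw b (z5 b hb)) (by
    intro j j' b b' hb hb' hs hs' e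
    have z := z5 b hs
    have z' := z5 b' hs'
    have e' := fun i => congrFun e i
    fin_cases j <;> fin_cases j' <;>
      simp [Fin.forall_fin_succ, hq, h1, qnum_eq_zero] at hb hb' e' ⊢
    all_goals
      ext i
      fin_cases i <;> simp <;> omega)
  have z4 : ∀ b ∈ c.support, b 4 = 0 := fun b hb => by
    simpa [h1, qnum_eq_zero] using z34 b hb 0
  have z3 : ∀ b ∈ c.support, b 3 = 0 := fun b hb => by
    simpa [hq, qnum_eq_zero] using z34 b hb 1
  have z012 := coeff_eq_zero (h 2)
    (fun b hb => skewDer_two_pbw b (z3 b hb) (z4 b hb) (z5 b hb)) (by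
    intro j j' b b' hb hb' hs hs' e
    have z := z5 b hs
    have z' := z5 b' hs'
    have y := z4 b hs
    have y' := z4 b' hs'
    have x := z3 b hs
    have x' := z3 b' hs'
    have e' := fun i => congrFun e i
    fin_cases j <;> fin_cases j' <;>
      simp [Fin.forall_fin_succ, hq, h1, qnum_eq_zero] at hb hb' e' ⊢
    all_goals
      ext i
      fin_cases i <;> simp <;> omega)
  refine ⟨c 0, (Finset.sum_eq_single 0 (fun b hb hne => (hne ?_).elim) fun h0 => ?_).trans ?_⟩
  · have e2 : b 2 = 0 := by simpa [h1, qnum_eq_zero] using z012 b hb 0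
    have e1 : b 1 = 0 := by simpa [hq, h1, qnum_eq_zero] using z012 b hb 1
    have e0 : b 0 = 0 := by simpa [hq, qnum_eq_zero] using z012 b hb 2
    ext i
    fin_cases i
    exacts [e0, e1, e2, z3 b hb, z4 b hb, z5 b hb]
  · rw [Finsupp.notMem_support_iff.mp h0]
    exact zero_smul _ _
  · exact congrArg (c 0 • ·) (pbw_zero _ _)

/-- An element of `U⁺` of nonzero weight that commutes with all `F_i` is zero. -/
theorem eq_zero_of_commute_F {μ : Fin 3 → ℕ} (hμ : μ ≠ 0) {z : Uq k} (hz : IsUplusWeight k μ z)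
    (h : ∀ i, z * Uq.F k i = Uq.F k i * z) : z = 0 := by
  obtain ⟨s, rfl⟩ := exists_smul_one_of_commute_F hz.1 h
  by_contra h0
  refine hμ ?_
  have key : ∀ i, form (fun j => (μ j : ℤ)) (simpleRoot i) = 0 := fun i => by
    have h1 := hz.2 i
    rw [mul_smul_comm, mul_one, smul_mul_assoc, (Uq.rel k).KL] at h1
    have h2 : (1 - q k ^ form (fun j => (μ j : ℤ)) (simpleRoot i)) • (s • (1 : Uq k)) = 0 := by
      rw [sub_smul, one_smul, ← h1, sub_self]
    have h3 := (smul_eq_zero.mp h2).resolve_right h0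
    refine q_pow_injective (k := k) ?_
    beta_reduce
    rw [zpow_zero, ← sub_eq_zero.mp h3]
  have k0 := key 0
  have k1 := key 1
  have k2 := key 2
  simp [form, simpleRoot, cartan, Fin.sum_univ_three, Pi.single_apply] at k0 k1 k2
  ext i
  fin_cases i <;> simp <;> omega

end

/-! ### Weights of finite dimensional modules of type `1` -/

theorem sum_eq_zero_of_iSupIndep {R M ι : Type*} [Ring R] [AddCommGroup M] [Module R M]
    {p : ι → Submodule R M} (hp : iSupIndep p) {S : Finset ι} {x : ι → M} (hx : ∀ i, x i ∈ p i)
    (h : ∑ i ∈ S, x i = 0) : ∀ i ∈ S, x i = 0 := fun i hi => by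
  classical
  refine Submodule.disjoint_def.mp (hp i) _ (hx i) ?_
  rw [← Finset.add_sum_erase S x hi] at h
  rw [eq_neg_of_add_eq_zero_left h]
  refine neg_mem (sum_mem fun j hj => ?_)
  exact Submodule.mem_iSup_of_mem j (Submodule.mem_iSup_of_mem (Finset.ne_of_mem_erase hj) (hx j))

section
variable {k : Type w} [Field k]

section
variable {M : Type*} [AddCommGroup M] [Module (RatFunc k) M] [Module (Uq k) M]
  [IsScalarTower (RatFunc k) (Uq k) M]

theorem smul_comm_U (u : Uq k) (r : RatFunc k) (m : M) : u • r • m = r • u • m := by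
  have : SMulCommClass (Uq k) (RatFunc k) M := IsScalarTower.to_smulCommClass'
  exact smul_comm u r m

variable (M) in
/-- The action of an element of `U` as a linear map. -/
noncomputable def lmul : Uq k →ₐ[RatFunc k] Module.End (RatFunc k) M where
  toFun u :=
    { toFun := fun m => u • m
      map_add' := smul_add u
      map_smul' := smul_comm_U u }
  map_one' := by ext m; exact one_smul _ m
  map_mul' u v := by ext m; exact mul_smul u v m
  map_zero' := by ext m; exact zero_smul _ m
  map_add' u v := by ext m; exact add_smul u v m
  commutes' r := by
    ext m
    change algebraMap (RatFunc k) (Uq k) r • m = r • m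
    exact algebraMap_smul _ r m

variable (k M) in
/-- Distinct weights have distinct eigenvalues, because `q` is not a root of unity. -/
theorem iSupIndep_weightSpace : iSupIndep fun n => weightSpace (k := k) M n := by
  have h := Module.End.independent_iInf_maxGenEigenspace_of_forall_mapsTo
    (fun i => lmul M (Uq.K k i)) fun i j φ =>
      Module.End.mapsTo_maxGenEigenspace_of_comm
        (by rw [commute_iff_eq, ← map_mul, ← map_mul, (Uq.rel k).KK]) φ
  refine (h.comp (f := fun (n : Fin 3 → ℤ) i => q k ^ n i) fun n n' e =>
    funext fun i => q_pow_injective (congrFun e i)).mono fun n m hm => ?_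
  simp only [Function.comp_apply, Submodule.mem_iInf]
  intro i
  refine Module.End.eigenspace_le_maxGenEigenspace ?_
  rw [Module.End.mem_eigenspace_iff]
  exact hm i

variable (k M) in
theorem finite_weights [Module.Finite (RatFunc k) M] :
    {n | weightSpace (k := k) M n ≠ ⊥}.Finite := by
  have h : ∀ i, {z : ℤ | (lmul M (Uq.K k i)).HasEigenvalue (q k ^ z)}.Finite := fun i =>
    Set.Finite.preimage q_pow_injective.injOn
      (Module.End.finite_hasEigenvalue (lmul M (Uq.K k i)))
  refine (Set.Finite.pi' h).subset fun n hn i => ?_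
  obtain ⟨m, hm, h0⟩ := Submodule.exists_mem_ne_zero_of_ne_bot hn
  exact Module.End.hasEigenvalue_of_hasEigenvector (x := m)
    ⟨Module.End.mem_eigenspace_iff.mpr (hm i), h0⟩

end

/-- The weight of the element `μ` of `Q⁺`: its values on the simple coroots. -/
def rootWt (μ : Fin 3 → ℕ) (i : Fin 3) : ℤ := form (fun j => (μ j : ℤ)) (simpleRoot i)

theorem rootWt_eq (μ : Fin 3 → ℕ) :
    rootWt μ = ![2 * (μ 0 : ℤ) - μ 1, 2 * (μ 1 : ℤ) - μ 0 - μ 2, 2 * (μ 2 : ℤ) - μ 1] := by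
  ext i
  fin_cases i <;> simp [rootWt, form, simpleRoot, cartan, Fin.sum_univ_three, Pi.single_apply] <;>
    ring

theorem rootWt_injective : Function.Injective rootWt := fun μ μ' h => by
  rw [rootWt_eq, rootWt_eq] at h
  have h0 := congrFun h 0
  have h1 := congrFun h 1
  have h2 := congrFun h 2
  simp at h0 h1 h2
  ext i
  fin_cases i <;> simp <;> omega

theorem rootWt_add (μ ν : Fin 3 → ℕ) : rootWt (μ + ν) = rootWt μ + rootWt ν := by
  simp only [rootWt_eq]
  ext i
  fin_cases i <;> simp <;> ring

theorem rootWt_nsmul (n : ℕ) (μ : Fin 3 → ℕ) (i : Fin 3) : rootWt (n • μ) i = n * rootWt μ i := by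
  simp only [rootWt_eq]
  fin_cases i <;> simp <;> ring

/-- The `μ`-th member of the family `D` has weight `μ + ν` for the adjoint action. -/
def Homog (ν : Fin 3 → ℤ) (D : (Fin 3 → ℕ) → Uq k) : Prop :=
  ∀ μ i, IsKWt i (rootWt μ i + ν i) (D μ)

namespace IsKWt
variable {i : Fin 3} {n : ℤ} {u v : Uq k}

theorem smul (hu : IsKWt i n u) (r : RatFunc k) : IsKWt i n (r • u) := by
  rw [IsKWt, mul_smul_comm, hu, smul_mul_assoc, smul_comm]

theorem sub (hu : IsKWt i n u) (hv : IsKWt i n v) : IsKWt i n (u - v) := by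
  rw [IsKWt, mul_sub, hu, hv, sub_mul, smul_sub]

theorem zero : IsKWt i n (0 : Uq k) := by simp [IsKWt]

theorem F (i j : Fin 3) : IsKWt i (-cartan i j) (Uq.F k j) := (Uq.rel k).KF i j

theorem K (i j : Fin 3) : IsKWt i 0 (Uq.K k j) := by
  rw [IsKWt, zpow_zero, one_smul, (Uq.rel k).KK]

theorem of_Kinv (i j : Fin 3) : IsKWt i 0 (Uq.Kinv k j) := by
  rw [IsKWt, zpow_zero, one_smul]
  exact congrArg Units.val (((Kunit_comm (k := k) i j).inv_right).eq)

theorem iff_conj : IsKWt i n u ↔ Uq.K k i * u * Uq.Kinv k i = q k ^ n • u := by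
  constructor <;> intro h
  · rw [h, smul_mul_assoc, mul_assoc, (Uq.rel k).KL, mul_one]
  · rw [IsKWt, ← smul_mul_assoc, ← h, mul_assoc _ (Uq.Kinv k i), (Uq.rel k).LK, mul_one]

end IsKWt

namespace Homog
variable {M : Type*} [AddCommGroup M] [Module (RatFunc k) M] [Module (Uq k) M]
  [IsScalarTower (RatFunc k) (Uq k) M] {ν : Fin 3 → ℤ} {D : (Fin 3 → ℕ) → Uq k}

theorem smul_mem (hD : Homog ν D) {n : Fin 3 → ℤ} {m : M} (hm : m ∈ weightSpace (k := k) M n)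
    (μ : Fin 3 → ℕ) : D μ • m ∈ weightSpace (k := k) M (rootWt μ + ν + n) := fun i => by
  rw [smul_smul, hD μ i, smul_assoc, mul_smul, hm i, smul_comm_U, smul_smul,
    ← zpow_add₀ (Uq.q_facts k).1]
  rfl

/-- All but finitely many members of a homogeneous family kill a given vector of a module of
type `1`. -/
theorem finite (hD : Homog ν D) (hM : IsTypeOne (k := k) M) (m : M) :
    Function.HasFiniteSupport fun μ => D μ • m := by
  have := hM.finite
  have hm : m ∈ ⨆ n, weightSpace (k := k) M n := by rw [hM.iSup_weightSpace]; trivial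
  induction hm using Submodule.iSup_induction' with
  | mem n m hm =>
    refine ((finite_weights k M).preimage (f := fun μ => rootWt μ + ν + n)
      (Function.Injective.injOn fun μ μ' h => rootWt_injective ?_)).subset fun μ hμ => ?_
    · simpa using h
    · exact (Submodule.ne_bot_iff _).mpr ⟨_, hD.smul_mem hm μ, hμ⟩
  | zero => simp [Function.HasFiniteSupport]
  | add x y _ _ hx hy =>
    simp only [smul_add]
    exact hx.fun_add hy

/-- If a homogeneous family sums to zero on every module of type `1`, it is zero. -/
theorem eq_zero (hD : Homog ν D) (h : ∀ (M : Type w) [AddCommGroup M] [Module (RatFunc k) M]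
    [Module (Uq k) M] [IsScalarTower (RatFunc k) (Uq k) M], IsTypeOne (k := k) M →
    ∀ m : M, ∑ᶠ μ, D μ • m = 0) (μ : Fin 3 → ℕ) : D μ = 0 := by
  refine eq_zero_of_isTypeOne fun M _ _ _ _ hM m => ?_
  have hm : m ∈ ⨆ n, weightSpace (k := k) M n := by rw [hM.iSup_weightSpace]; trivial
  induction hm using Submodule.iSup_induction' with
  | mem n m hm =>
    have h1 := h M hM m
    rw [finsum_eq_sum _ (hD.finite hM m)] at h1
    by_contra h0
    refine h0 (sum_eq_zero_of_iSupIndep ((iSupIndep_weightSpace k M).comp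
      (f := fun μ => rootWt μ + ν + n) fun μ μ' e => rootWt_injective ?_)
      (fun μ => hD.smul_mem hm μ) h1 μ ?_)
    · simpa using e
    · exact (Set.Finite.mem_toFinset _).mpr h0
  | zero => rw [smul_zero]
  | add x y _ _ hx hy => rw [smul_add, hx, hy, add_zero]

end Homog

section act
variable {M : Type*} [AddCommGroup M] [Module (RatFunc k) M] [Module (Uq k) M]
  [IsScalarTower (RatFunc k) (Uq k) M] {X : (Fin 3 → ℕ) → Uq k}

theorem act_add (hX : Homog 0 X) (hM : IsTypeOne (k := k) M) (m m' : M) :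
    act X (m + m') = act X m + act X m' := by
  simp only [act, smul_add]
  exact finsum_add_distrib (hX.finite hM m) (hX.finite hM m')

theorem act_smul (r : RatFunc k) (m : M) : act X (r • m) = r • act X m := by
  have : Module.IsTorsionFree (RatFunc k) M := inferInstance
  simp only [act, smul_comm_U]
  exact (smul_finsum r _).symm

theorem smul_act (hX : Homog 0 X) (hM : IsTypeOne (k := k) M) (u : Uq k) (m : M) :
    u • act X m = ∑ᶠ μ, (u * X μ) • m := by
  simp only [act, mul_smul]
  exact smul_finsum' u (hX.finite hM m)

end act

/-- `a` after the operator `X` agrees with `X` after `b`, on all modules of type `1`. -/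
def Intertwines (X : (Fin 3 → ℕ) → Uq k) (a b : Uq k) : Prop :=
  ∀ (M : Type w) [AddCommGroup M] [Module (RatFunc k) M] [Module (Uq k) M]
    [IsScalarTower (RatFunc k) (Uq k) M], IsTypeOne (k := k) M →
    ∀ m : M, a • act X m = act X (b • m)

namespace Intertwines
variable {X : (Fin 3 → ℕ) → Uq k} {a b a' b' : Uq k}

theorem add (hX : Homog 0 X) (h : Intertwines X a b) (h' : Intertwines X a' b') :
    Intertwines X (a + a') (b + b') := fun M _ _ _ _ hM m => by
  rw [add_smul, add_smul, h M hM, h' M hM, act_add hX hM]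

theorem mul (h : Intertwines X a b) (h' : Intertwines X a' b') :
    Intertwines X (a * a') (b * b') := fun M _ _ _ _ hM m => by
  rw [mul_smul, mul_smul, h' M hM, h M hM]

theorem of_commute (hX : Homog 0 X) (h : ∀ μ, a * X μ = X μ * a) : Intertwines X a a :=
  fun M _ _ _ _ hM m => by
    rw [smul_act hX hM, act]
    exact finsum_congr fun μ => by rw [h, mul_smul]

/-- A homogeneous element that `X` intertwines with itself commutes with every component of `X`:
the equation splits into its weight components. -/
theorem commute {ν : Fin 3 → ℤ} (hX : Homog 0 X) (ha : ∀ i, IsKWt i (ν i) a)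
    (h : Intertwines X a a) (μ : Fin 3 → ℕ) : a * X μ = X μ * a := by
  have h1 : Homog ν fun μ => a * X μ := fun μ i => by
    have := (ha i).mul (hX μ i)
    rwa [Pi.zero_apply, add_zero, add_comm] at this
  have h2 : Homog ν fun μ => X μ * a := fun μ i => by
    have := (hX μ i).mul (ha i)
    rwa [Pi.zero_apply, add_zero] at this
  refine sub_eq_zero.mp (Homog.eq_zero (D := fun μ => a * X μ - X μ * a)
    (fun μ i => (h1 μ i).sub (h2 μ i)) (fun M _ _ _ _ hM m => ?_) μ)
  simp only [sub_smul]
  rw [finsum_sub_distrib (h1.finite hM m) (h2.finite hM m), ← smul_act hX hM, h M hM]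
  simp only [act, mul_smul, sub_self]

end Intertwines

end

/-! ### The intertwining equation for `B₂` -/

section
variable {k : Type w} [Field k]

theorem T13E2_eq : T13E2 k = qbr (q k) (Uq.E k 0) (qbr (q k) (Uq.E k 2) (Uq.E k 1)) := by
  have e2 : Uq.T k 0 (Uq.E k 2) = Uq.E k 2 := by simp [Uq.T_E, tE, cartan]
  have e1 : Uq.T k 0 (Uq.E k 1) = qbr (q k) (Uq.E k 0) (Uq.E k 1) := by
    simp [Uq.T_E, tE, cartan, qbr]
  have e : Uq.T k 2 (Uq.E k 1) = qbr (q k) (Uq.E k 2) (Uq.E k 1) := by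
    simp [Uq.T_E, tE, cartan, qbr]
  rw [T13E2, e, (Uq.rel k).serreTriple.qbr_qbr_comm, qbr, map_sub, map_smul, map_mul, map_mul, e1,
    e2]
  rfl

theorem barU_Kinv (i : Fin 3) : barU k (Uq.Kinv k i) = Uq.K k i :=
  Uq.lift_mk (barRel k) (Gen.L i)

theorem barU_qbr (x y : Uq k) :
    barU k (qbr (q k) x y) = qbr (q k)⁻¹ (barU k x) (barU k y) := by
  rw [qbr, map_sub, barU_smul, map_mul, map_mul, map_inv₀, barQ_q]
  rfl

theorem barU_T13E2 :
    barU k (T13E2 k) = qbr (q k)⁻¹ (Uq.E k 0) (qbr (q k)⁻¹ (Uq.E k 2) (Uq.E k 1)) := by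
  simp only [T13E2_eq, barU_qbr, barU_E]

variable (k) in
/-- The element `[E₂, T₁₃(E₂)]_{q⁻²}` of `U⁺`. -/
noncomputable abbrev coreU : Uq k := core (q k) (Uq.E k 0) (Uq.E k 1) (Uq.E k 2)

theorem qcomm_eq_coreU : qcomm (Uq.E k 1) (T13E2 k) (q k ^ (-2 : ℤ)) = coreU k := by
  have e : q k ^ (-2 : ℤ) = (q k)⁻¹ * (q k)⁻¹ := by
    rw [← mul_inv, ← sq, zpow_neg]; rfl
  rw [T13E2_eq, qcomm, e]
  rfl

theorem barU_B2 (c : RatFunc k) : barU k (B2 c) =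
    Uq.F k 1 - barQ k c • (barU k (T13E2 k) * Uq.K k 1) := by
  rw [B2, map_sub, barU_F, barU_smul, map_mul, barU_Kinv]

theorem isKWt_T13E2 (i : Fin 3) :
    IsKWt i (cartan i 0 + (cartan i 2 + cartan i 1)) (T13E2 k) := by
  rw [T13E2_eq]
  exact (IsKWt.E i 0).qbr ((IsKWt.E i 2).qbr (IsKWt.E i 1))

theorem isKWt_barU_T13E2 (i : Fin 3) :
    IsKWt i (cartan i 0 + (cartan i 2 + cartan i 1)) (barU k (T13E2 k)) := by
  have hb : ∀ {m n : ℤ} {u v : Uq k}, IsKWt i m u → IsKWt i n v →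
      IsKWt i (m + n) (qbr (q k)⁻¹ u v) := fun {m n} {u v} hu hv =>
    (hu.mul hv).sub (IsKWt.smul (by rw [add_comm]; exact hv.mul hu) _)
  rw [barU_T13E2]
  exact hb (IsKWt.E i 0) (hb (IsKWt.E i 2) (IsKWt.E i 1))

theorem rootWt_delta (i : Fin 3) :
    rootWt ![1, 2, 1] i = cartan i 1 + (cartan i 0 + (cartan i 2 + cartan i 1)) := by
  rw [rootWt_eq]
  fin_cases i <;> rfl

theorem isKWt_coreU (i : Fin 3) : IsKWt i (rootWt ![1, 2, 1] i) (coreU k) := by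
  rw [rootWt_delta, ← qcomm_eq_coreU]
  exact ((IsKWt.E i 1).mul (isKWt_T13E2 i)).sub
    (IsKWt.smul (by rw [add_comm (cartan i 1)]; exact (isKWt_T13E2 i).mul (IsKWt.E i 1)) _)

theorem coreU_mem_Uplus : coreU k ∈ Uplus k := by
  have m := fun j => E_mem_Uplus (k := k) j
  have := qbr_mem_Uplus (m 0) (qbr_mem_Uplus (m 2) (m 1))
  exact sub_mem (mul_mem (m 1) this) (Subalgebra.smul_mem _ (mul_mem this (m 1)) _)

open Classical in
/-- The family `X` moved by `α₁ + 2 α₂ + α₃`. -/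
noncomputable def moved {A : Type*} [Zero A] (X : (Fin 3 → ℕ) → A) (μ : Fin 3 → ℕ) : A :=
  if ![1, 2, 1] ≤ μ then X (μ - ![1, 2, 1]) else 0

theorem moved_add {A : Type*} [Zero A] (X : (Fin 3 → ℕ) → A) (μ : Fin 3 → ℕ) :
    moved X (μ + ![1, 2, 1]) = X μ := by
  rw [moved, if_pos (show ![1, 2, 1] ≤ μ + ![1, 2, 1] from fun i => Nat.le_add_left _ _),
    add_tsub_cancel_right]

theorem finsum_moved {A : Type*} [AddCommMonoid A] (X : (Fin 3 → ℕ) → A) :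
    ∑ᶠ μ, moved X μ = ∑ᶠ μ, X μ := by
  have h := finsum_mem_range (f := moved X) (g := fun μ => μ + ![1, 2, 1])
    (add_left_injective _)
  rw [finsum_mem_def, Set.indicator_eq_self.mpr] at h
  · rw [h]
    exact finsum_congr fun μ => moved_add X μ
  · intro μ hμ
    have : ![1, 2, 1] ≤ μ := by
      by_contra h0
      exact hμ (if_neg h0)
    exact ⟨μ - ![1, 2, 1], tsub_add_cancel_of_le this⟩

theorem Homog.moved {ν : Fin 3 → ℤ} {D : (Fin 3 → ℕ) → Uq k} (hD : Homog ν D) :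
    Homog (ν - rootWt ![1, 2, 1]) (moved D) := fun μ i => by
  unfold QSP.moved
  split_ifs with h
  · have h1 := hD (μ - ![1, 2, 1]) i
    have h2 := congrFun (rootWt_add (μ - ![1, 2, 1]) ![1, 2, 1]) i
    rw [tsub_add_cancel_of_le h, Pi.add_apply] at h2
    rwa [h2, Pi.sub_apply, add_assoc, add_sub_cancel]
  · exact IsKWt.zero

/-- The component of weight `μ - α₂` of `B₂ X - X B̄₂`. -/
noncomputable def defect (c : RatFunc k) (X : (Fin 3 → ℕ) → Uq k) (μ : Fin 3 → ℕ) : Uq k :=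
  Uq.F k 1 * X μ - X μ * Uq.F k 1 - (c • (T13E2 k * Uq.Kinv k 1 * moved X μ) -
    barQ k c • (moved X μ * (barU k (T13E2 k) * Uq.K k 1)))

/-- The intertwining equation for `B₂` is equivalent to its weight components, which are equations
in `U` itself. The two summands of `B₂` have weights that differ by `α₁ + 2 α₂ + α₃`. -/
theorem intertwines_B2_iff {c : RatFunc k} {X : (Fin 3 → ℕ) → Uq k} (hX : Homog 0 X) :
    Intertwines X (B2 c) (barU k (B2 c)) ↔ ∀ μ, defect c X μ = 0 := by
  let G : (Fin 3 → ℕ) → Uq k := fun μ => Uq.F k 1 * X μ - X μ * Uq.F k 1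
  let H : (Fin 3 → ℕ) → Uq k := fun μ => c • (T13E2 k * Uq.Kinv k 1 * X μ) -
    barQ k c • (X μ * (barU k (T13E2 k) * Uq.K k 1))
  have hG : Homog (fun i => -cartan i 1) G := fun μ i => by
    have h1 := hX μ i
    rw [Pi.zero_apply, add_zero] at h1
    exact (add_comm (-cartan i 1) _ ▸ (IsKWt.F i 1).mul h1).sub (h1.mul (IsKWt.F i 1))
  have hH : Homog (fun i => cartan i 0 + (cartan i 2 + cartan i 1)) H := fun μ i => by
    have h1 := hX μ i
    rw [Pi.zero_apply, add_zero] at h1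
    have h2 := (((isKWt_T13E2 (k := k) i).mul (IsKWt.of_Kinv i 1)).mul h1).smul c
    have h3 := (h1.mul ((isKWt_barU_T13E2 (k := k) i).mul (IsKWt.K i 1))).smul (barQ k c)
    rw [add_zero, add_comm] at h2
    rw [add_zero] at h3
    exact h2.sub h3
  have hH' : Homog (fun i => -cartan i 1) (moved H) := by
    convert hH.moved using 1
    ext i
    rw [Pi.sub_apply, rootWt_delta]
    ring
  have e : ∀ μ, defect c X μ = G μ - moved H μ := fun μ => by
    simp only [defect, G, H, moved]
    split_ifs
    · rfl
    · simp
  have key : ∀ (M : Type w) [AddCommGroup M] [Module (RatFunc k) M] [Module (Uq k) M]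
      [IsScalarTower (RatFunc k) (Uq k) M], IsTypeOne (k := k) M → ∀ m : M,
      B2 c • act X m - act X (barU k (B2 c) • m) = ∑ᶠ μ, defect c X μ • m := by
    intro M _ _ _ _ hM m
    have s1 : Function.HasFiniteSupport fun μ => (B2 c * X μ) • m :=
      (hX.finite hM m).subset fun μ hμ h0 => hμ (by
        change X μ • m = 0 at h0
        change (B2 c * X μ) • m = 0
        rw [mul_smul, h0, smul_zero])
    have s2 : ∑ᶠ μ, moved H μ • m = ∑ᶠ μ, H μ • m := by
      rw [← finsum_moved fun μ => H μ • m]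
      refine finsum_congr fun μ => ?_
      unfold moved
      split_ifs
      · rfl
      · rw [zero_smul]
    rw [smul_act hX hM, act, ← finsum_sub_distrib s1 (hX.finite hM _)]
    simp only [e, sub_smul]
    rw [finsum_sub_distrib (hG.finite hM m) (hH'.finite hM m), s2,
      ← finsum_sub_distrib (hG.finite hM m) (hH.finite hM m)]
    refine finsum_congr fun μ => ?_
    rw [← mul_smul, ← sub_smul, ← sub_smul]
    congr 1
    rw [barU_B2, B2]
    simp only [G, H, sub_mul, mul_sub, smul_mul_assoc, mul_smul_comm]
    abel
  constructor
  · intro h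
    refine Homog.eq_zero (ν := fun i => -cartan i 1) (fun μ i => ?_) fun M _ _ _ _ hM m => ?_
    · rw [e]; exact (hG μ i).sub (hH' μ i)
    · rw [← key M hM, h M hM, sub_self]
  · intro h M _ _ _ _ hM m
    rw [← sub_eq_zero, key M hM]
    simp [h]

theorem homog_of_isUplusWeight {X : (Fin 3 → ℕ) → Uq k} (h : ∀ μ, IsUplusWeight k μ (X μ)) :
    Homog 0 X := fun μ i => by
  rw [Pi.zero_apply, add_zero, IsKWt.iff_conj]
  exact (h μ).2 i

theorem IsUplusWeight.sub {μ : Fin 3 → ℕ} {x y : Uq k} (hx : IsUplusWeight k μ x)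
    (hy : IsUplusWeight k μ y) : IsUplusWeight k μ (x - y) :=
  ⟨sub_mem hx.1 hy.1, fun i => by rw [mul_sub, sub_mul, hx.2, hy.2, smul_sub]⟩

/-- The equations for `F₁`, `F₃` and `B₂` determine `X`: the difference of the components of lowest
height of two solutions would commute with all `F_i`. -/
theorem eq_of_defect {c : RatFunc k} {X X' : (Fin 3 → ℕ) → Uq k}
    (hX : ∀ μ, IsUplusWeight k μ (X μ)) (hX' : ∀ μ, IsUplusWeight k μ (X' μ)) (h0 : X 0 = X' 0)
    (hF : ∀ i, i ≠ 1 → ∀ μ, Uq.F k i * X μ = X μ * Uq.F k i)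
    (hF' : ∀ i, i ≠ 1 → ∀ μ, Uq.F k i * X' μ = X' μ * Uq.F k i)
    (hd : ∀ μ, defect c X μ = 0) (hd' : ∀ μ, defect c X' μ = 0) : X = X' := by
  suffices h : ∀ (n : ℕ) (μ : Fin 3 → ℕ), ∑ i, μ i = n → X μ = X' μ from
    funext fun μ => h _ μ rfl
  intro n
  induction n using Nat.strong_induction_on with
  | _ n ih =>
    intro μ hμ
    by_cases hz : μ = 0
    · rw [hz, h0]
    have hp : moved X μ = moved X' μ := by
      unfold moved
      split_ifs with hle
      · refine ih _ ?_ _ rfl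
        have h1 := hle 0
        have h2 := hle 1
        simp [Fin.sum_univ_three] at hμ h1 h2 ⊢
        omega
      · rfl
    refine sub_eq_zero.mp (eq_zero_of_commute_F hz ((hX μ).sub (hX' μ)) fun i => ?_)
    by_cases hi : i = 1
    · subst hi
      have e := hd μ
      have e' := hd' μ
      unfold defect at e e'
      rw [hp] at e
      rw [sub_mul, mul_sub, ← sub_eq_zero]
      have := e'.trans e.symm
      rw [sub_left_inj] at this
      rw [← sub_eq_zero.mpr this]
      abel
    · rw [sub_mul, mul_sub, hF i hi, hF' i hi]

/-! ### The quasi `K`-matrix -/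

/-- The family with `(q c)ⁿ / {n}! [E₂, T₁₃(E₂)]ⁿ` at `n (α₁ + 2 α₂ + α₃)` and `0` elsewhere. The
first entry of a multiple of `![1, 2, 1]` is the factor `n`. -/
noncomputable def quasiK (c : RatFunc k) (μ : Fin 3 → ℕ) : Uq k :=
  if μ = μ 0 • ![1, 2, 1] then ((q k * c) ^ μ 0 / qfact k (μ 0)) • coreU k ^ μ 0 else 0

theorem quasiK_nsmul (c : RatFunc k) (n : ℕ) : quasiK c (n • ![1, 2, 1]) =
    ((q k * c) ^ n / qfact k n) • coreU k ^ n := by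
  have : (n • ![1, 2, 1] : Fin 3 → ℕ) 0 = n := by simp
  rw [quasiK, this, if_pos rfl]

theorem quasiK_of_ne (c : RatFunc k) {μ : Fin 3 → ℕ} (h : ∀ n : ℕ, μ ≠ n • ![1, 2, 1]) :
    quasiK c μ = 0 := if_neg (h _)

theorem quasiK_cases (c : RatFunc k) {p : (Fin 3 → ℕ) → Uq k → Prop} (h0 : ∀ μ, p μ 0)
    (h : ∀ n : ℕ, p (n • ![1, 2, 1]) (((q k * c) ^ n / qfact k n) • coreU k ^ n))
    (μ : Fin 3 → ℕ) : p μ (quasiK c μ) := by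
  by_cases e : ∃ n : ℕ, μ = n • ![1, 2, 1]
  · obtain ⟨n, rfl⟩ := e
    rw [quasiK_nsmul]; exact h n
  · rw [quasiK_of_ne c (not_exists.mp e)]; exact h0 μ

theorem quasiK_zero (c : RatFunc k) : quasiK c 0 = 1 := by
  have := quasiK_nsmul c 0
  rw [zero_smul] at this
  rw [this]
  simp [qfact]

theorem isUplusWeight_quasiK (c : RatFunc k) (μ : Fin 3 → ℕ) :
    IsUplusWeight k μ (quasiK c μ) := by
  refine quasiK_cases c (p := fun μ x => IsUplusWeight k μ x)
    (fun μ => ⟨zero_mem _, fun i => by simp⟩)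
    (fun n => ⟨Subalgebra.smul_mem _ (pow_mem coreU_mem_Uplus n) _, fun i => ?_⟩) μ
  have h := ((isKWt_coreU (k := k) i).pow n).smul ((q k * c) ^ n / qfact k n)
  rw [← rootWt_nsmul] at h
  exact IsKWt.iff_conj.mp h

theorem commute_quasiK {a : Uq k} (h : a * coreU k = coreU k * a) (c : RatFunc k)
    (μ : Fin 3 → ℕ) : a * quasiK c μ = quasiK c μ * a := by
  refine quasiK_cases c (p := fun _ x => a * x = x * a) (fun _ => by simp) (fun n => ?_) μ
  rw [mul_smul_comm, smul_mul_assoc, (Commute.pow_right (show Commute a (coreU k) from h) n).eq]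

theorem qfact_ne_zero (n : ℕ) : qfact k n ≠ 0 :=
  Finset.prod_ne_zero_iff.mpr fun j _ => by rw [Ne, qnum_eq_zero]; omega

/-- The formula solves the intertwining equation for `B₂`, by `F_one_mul_core_pow`; this is the only
place where the condition on the parameter enters. -/
theorem defect_quasiK {c : RatFunc k} (hc : barQ k c = (q k)⁻¹ * (q k)⁻¹ * c) (μ : Fin 3 → ℕ) :
    defect c (quasiK c) μ = 0 := by
  obtain ⟨hq, h2, h3⟩ := Uq.q_facts k
  by_cases e : ∃ n : ℕ, μ = n • ![1, 2, 1]
  · obtain ⟨n, rfl⟩ := e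
    have key := (Uq.rel k).F_one_mul_core_pow hq h2 h3 n
    rw [← T13E2_eq, ← barU_T13E2] at key
    rcases n with _ | n
    · have : moved (quasiK c) ((0 : ℕ) • ![1, 2, 1]) = 0 := by
        refine if_neg fun h => ?_
        simpa using h 0
      rw [defect, this, zero_smul, quasiK_zero]
      simp
    · have : moved (quasiK c) ((n + 1) • ![1, 2, 1]) = quasiK c (n • ![1, 2, 1]) := by
        rw [add_smul, one_smul, moved_add]
      rw [defect, this, quasiK_nsmul, quasiK_nsmul, mul_smul_comm, smul_mul_assoc, ← smul_sub, key,
        hc, Nat.add_sub_cancel, mul_smul_comm, smul_mul_assoc, ← mul_assoc (_ ^ n)]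
      have e1 : qfact k (n + 1) = qfact k n * qnum k (n + 1) := Finset.prod_range_succ _ _
      have e2 : qnum k (n + 1) = ∑ j ∈ Finset.range (n + 1), q k ^ (2 * j) := rfl
      have n1 := qfact_ne_zero (k := k) n
      have n2 : qnum k (n + 1) ≠ 0 := by rw [Ne, qnum_eq_zero]; omega
      have e3 : (q k * c) ^ (n + 1) / (qfact k n * qnum k (n + 1)) * ((q k)⁻¹ * qnum k (n + 1)) =
          c * ((q k * c) ^ n / qfact k n) := by
        field_simp
        exact pow_succ' _ _
      rw [← e2, e1, smul_smul, e3, smul_sub, smul_smul, smul_smul, smul_smul,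
        mul_comm _ ((q k)⁻¹ * (q k)⁻¹), mul_assoc _ c, sub_self]
  · have h1 := not_exists.mp e
    have : moved (quasiK c) μ = 0 := by
      unfold moved
      split_ifs with h
      · refine quasiK_of_ne c fun n hn => h1 (n + 1) ?_
        rw [add_smul, one_smul, ← hn, tsub_add_cancel_of_le h]
      · rfl
    rw [defect, this, quasiK_of_ne c h1]
    simp

/-- `[E₂, T₁₃(E₂)]_{q⁻²}` commutes with the subalgebra `M_X`. -/
theorem commute_coreU_of_mem_MX {a : Uq k} (ha : a ∈ MX k) : a * coreU k = coreU k * a := by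
  obtain ⟨hq, h2, h3⟩ := Uq.q_facts k
  have rel := Uq.rel k
  have st := rel.serreTriple
  have hK : ∀ i : Fin 3, i = 0 ∨ i = 2 → rootWt ![1, 2, 1] i = 0 := fun i hi => by
    rw [rootWt_eq]; rcases hi with rfl | rfl <;> rfl
  induction ha using Algebra.adjoin_induction with
  | mem x hx =>
    obtain ⟨i, hi, rfl | rfl | rfl | rfl⟩ := hx
    · rcases hi with rfl | rfl
      · exact st.mul_core hq h2
      · have := st.symm.mul_core hq h2
        rwa [st.core_symm] at this
    · rcases hi with rfl | rfl
      · exact (rel.F_zero_mul_core hq h3).symm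
      · exact (rel.F_two_mul_core hq h3).symm
    · have := isKWt_coreU (k := k) i
      rwa [hK i hi, IsKWt, zpow_zero, one_smul] at this
    · have := (isKWt_coreU (k := k) i).Kinv
      rw [hK i hi, zpow_zero, one_smul] at this
      exact this.symm
  | algebraMap r => exact Algebra.commutes r _
  | add x y _ _ hx hy => rw [add_mul, mul_add, hx, hy]
  | mul x y _ _ hx hy => rw [mul_assoc, hy, ← mul_assoc, hx, mul_assoc]

end

/-! ### The bar involution of `B_c` -/

section
variable {k : Type w} [Field k]

theorem barQ_barQ (r : RatFunc k) : barQ k (barQ k r) = r := by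
  have h : (barQ k).comp (barQ k) = RingHom.id _ := by
    refine IsLocalization.ringHom_ext (nonZeroDivisors (Polynomial k)) (Polynomial.ringHom_ext
      (fun a => ?_) ?_)
    · simp [barQ_C]
    · change barQ k (barQ k (algebraMap _ _ Polynomial.X)) = algebraMap _ _ Polynomial.X
      rw [RatFunc.algebraMap_X, barQ_q, map_inv₀, barQ_q, inv_inv]
  exact RingHom.congr_fun h r

theorem barU_algebraMap (r : RatFunc k) :
    barU k (algebraMap _ _ r) = algebraMap _ _ (barQ k r) := by
  rw [Algebra.algebraMap_eq_smul_one, barU_smul, map_one, ← Algebra.algebraMap_eq_smul_one]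

theorem barU_barU (u : Uq k) : barU k (barU k u) = u := by
  have hu : u ∈ Algebra.adjoin (RatFunc k) (Set.range (Uq.E k) ∪ Set.range (Uq.F k) ∪
      Set.range (Uq.K k) ∪ Set.range (Uq.Kinv k)) := by rw [adjoin_gens]; trivial
  induction hu using Algebra.adjoin_induction with
  | mem x hx =>
    obtain ((⟨i, rfl⟩ | ⟨i, rfl⟩) | ⟨i, rfl⟩) | ⟨i, rfl⟩ := hx
    · simp only [barU_E]
    · simp only [barU_F]
    · rw [barU_K, barU_Kinv]
    · rw [barU_Kinv, barU_K]
  | algebraMap r => rw [barU_algebraMap, barU_algebraMap, barQ_barQ]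
  | add x y _ _ hx hy => rw [map_add, map_add, hx, hy]
  | mul x y _ _ hx hy => rw [map_mul, map_mul, hx, hy]

theorem barU_mem_MX {a : Uq k} (ha : a ∈ MX k) : barU k a ∈ MX k := by
  have mem : ∀ {x : Uq k} (i : Fin 3), (i = 0 ∨ i = 2) →
      (x = Uq.E k i ∨ x = Uq.F k i ∨ x = Uq.K k i ∨ x = Uq.Kinv k i) → x ∈ MX k :=
    fun i hi hx => Algebra.subset_adjoin ⟨i, hi, hx⟩
  induction ha using Algebra.adjoin_induction with
  | mem x hx =>
    obtain ⟨i, hi, rfl | rfl | rfl | rfl⟩ := hx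
    · rw [barU_E]; exact mem i hi (by simp)
    · rw [barU_F]; exact mem i hi (by simp)
    · rw [barU_K]; exact mem i hi (by simp)
    · rw [barU_Kinv]; exact mem i hi (by simp)
  | algebraMap r => rw [barU_algebraMap]; exact Subalgebra.algebraMap_mem _ _
  | add x y _ _ hx hy => rw [map_add]; exact add_mem hx hy
  | mul x y _ _ hx hy => rw [map_mul]; exact mul_mem hx hy

variable (k) in
/-- The weights fixed by `Θ` are spanned by `α₁` and `α₃`. -/
theorem UTheta_le_MX : UTheta k ≤ MX k := by
  refine Algebra.adjoin_le ?_
  rintro _ ⟨l, hl, rfl⟩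
  have h1 : l 1 = 0 := by
    have h := congrFun hl 1
    simp [Theta, refl, form, simpleRoot, cartan, Fin.sum_univ_three, Pi.single_apply] at h
    omega
  have mem : ∀ {x : Uq k} (i : Fin 3), (i = 0 ∨ i = 2) → (x = Uq.K k i ∨ x = Uq.Kinv k i) →
      x ∈ MX k := fun i hi hx => Algebra.subset_adjoin ⟨i, hi, Or.inr (Or.inr hx)⟩
  have h : ∀ i : Fin 3, (i = 0 ∨ i = 2) → ∀ z : ℤ, ((Kunit k i ^ z : (Uq k)ˣ) : Uq k) ∈ MX k :=
    fun i hi z => by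
      rcases z with n | n
      · rw [Int.ofNat_eq_natCast, zpow_natCast, Units.val_pow_eq_pow_val]
        exact pow_mem (mem i hi (Or.inl rfl)) n
      · rw [zpow_negSucc, ← inv_pow, Units.val_pow_eq_pow_val]
        exact pow_mem (mem i hi (Or.inr rfl)) _
  rw [Klam, h1, zpow_zero, mul_one, Units.val_mul]
  exact mul_mem (h 0 (Or.inl rfl) _) (h 2 (Or.inr rfl) _)

theorem MX_sup_UTheta : MX k ⊔ UTheta k = MX k := sup_eq_left.mpr (UTheta_le_MX k)

section
variable {M : Type*} [AddCommGroup M] [Module (RatFunc k) M] [Module (Uq k) M]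
  [IsScalarTower (RatFunc k) (Uq k) M]

/-- The operator given by the formula is bijective on modules of type `1`, because
`[E₂, T₁₃(E₂)]` acts nilpotently and only the identity survives on the kernel of this element. -/
theorem bijective_act_quasiK {c : RatFunc k} (hc : c ≠ 0) (hM : IsTypeOne (k := k) M) :
    Function.Bijective (act (M := M) (quasiK c)) := by
  have hX := homog_of_isUplusWeight (isUplusWeight_quasiK c)
  have := hM.finite
  let f : M →ₗ[RatFunc k] M :=
    { toFun := act (quasiK c)
      map_add' := act_add hX hM
      map_smul' := act_smul }
  have hinj : Function.Injective f := by
    refine (injective_iff_map_eq_zero f).mpr fun m hm => ?_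
    by_contra h0
    have nil : ∃ n : ℕ, coreU k ^ n • m = 0 := by
      by_contra! h
      refine (Set.infinite_range_of_injective (f := fun n : ℕ => (n • ![1, 2, 1] : Fin 3 → ℕ))
        fun n n' e => ?_) ((hX.finite hM m).subset ?_)
      · simpa using congrFun e 0
      · rintro _ ⟨n, rfl⟩
        change quasiK c (n • ![1, 2, 1]) • m ≠ 0
        rw [quasiK_nsmul, smul_assoc]
        exact smul_ne_zero (div_ne_zero (pow_ne_zero _ (mul_ne_zero (Uq.q_facts k).1 hc))
          (qfact_ne_zero n)) (h n)
    classical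
    obtain ⟨n, hn⟩ : ∃ n, Nat.find nil = n + 1 :=
      Nat.exists_eq_succ_of_ne_zero fun h => h0 (by simpa [h] using Nat.find_spec nil)
    -- `coreU k ^ n • m` is nonzero and killed by `coreU k`, hence fixed by the operator, which
    -- on the other hand commutes with `coreU k` and kills `m`
    have h1 : coreU k ^ n • m ≠ 0 := Nat.find_min nil (by omega)
    have h2 : coreU k • coreU k ^ n • m = 0 := by
      rw [smul_smul, ← pow_succ', ← hn]
      exact Nat.find_spec nil
    have h3 : act (quasiK c) (coreU k ^ n • m) = coreU k ^ n • m := by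
      refine (finsum_eq_single _ 0 fun μ hμ => ?_).trans (by rw [quasiK_zero, one_smul])
      refine quasiK_cases c (p := fun μ x => μ ≠ 0 → x • coreU k ^ n • m = 0)
        (fun _ _ => zero_smul _ _) (fun j hj => ?_) μ hμ
      rcases j with _ | j
      · simp at hj
      · rw [smul_assoc, pow_succ (coreU k) j, mul_smul, h2, smul_zero, smul_zero]
    refine h1 (h3.symm.trans ?_)
    rw [act, ← (finsum_congr fun μ => ?_ : ∑ᶠ μ, (coreU k ^ n * quasiK c μ) • m = _),
      ← smul_act hX hM]
    · exact (congrArg (coreU k ^ n • ·) hm).trans (smul_zero _)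
    · rw [commute_quasiK (Commute.pow_left rfl n), mul_smul]
  exact ⟨hinj, LinearMap.injective_iff_surjective.mp hinj⟩

end

/-- The first argument of `Intertwines` is determined by the second one. -/
theorem Intertwines.left_unique {c : RatFunc k} (hc : c ≠ 0) {a a' b : Uq k}
    (h : Intertwines (quasiK c) a b) (h' : Intertwines (quasiK c) a' b) : a = a' :=
  sub_eq_zero.mp <| eq_zero_of_isTypeOne fun M _ _ _ _ hM m => by
    obtain ⟨m, rfl⟩ := (bijective_act_quasiK hc hM).2 m
    rw [sub_smul, h M hM, h' M hM, sub_self]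

/-- The second argument of `Intertwines` is determined by the first one. -/
theorem Intertwines.right_unique {c : RatFunc k} (hc : c ≠ 0) {a b b' : Uq k}
    (h : Intertwines (quasiK c) a b) (h' : Intertwines (quasiK c) a b') : b = b' :=
  sub_eq_zero.mp <| eq_zero_of_isTypeOne fun M _ _ _ _ hM m => by
    rw [sub_smul, sub_eq_zero]
    exact (bijective_act_quasiK hc hM).1 ((h M hM m).symm.trans (h' M hM m))

theorem intertwines_of_mem_MX (c : RatFunc k) {a : Uq k} (ha : a ∈ MX k) :
    Intertwines (quasiK c) a a :=
  .of_commute (homog_of_isUplusWeight (isUplusWeight_quasiK c))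
    (commute_quasiK (commute_coreU_of_mem_MX ha) c)

theorem B2_mem_Bc (c : RatFunc k) : B2 c ∈ Bc c := Algebra.subset_adjoin (Or.inr rfl)

theorem MX_le_Bc (c : RatFunc k) : MX k ≤ Bc c :=
  fun _ h => Algebra.subset_adjoin (Or.inl (Or.inl h))

theorem Bc_induction {c : RatFunc k} {p : Uq k → Prop} (hM : ∀ a ∈ MX k, p a) (hB : p (B2 c))
    (hadd : ∀ a b, p a → p b → p (a + b)) (hmul : ∀ a b, p a → p b → p (a * b)) {a : Uq k}
    (ha : a ∈ Bc c) : p a := by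
  induction ha using Algebra.adjoin_induction with
  | mem x hx =>
    obtain (hx | hx) | rfl := hx
    · exact hM x hx
    · exact hM x (UTheta_le_MX k hx)
    · exact hB
  | algebraMap r => exact hM _ (Subalgebra.algebraMap_mem _ r)
  | add x y _ _ hx hy => exact hadd x y hx hy
  | mul x y _ _ hx hy => exact hmul x y hx hy

/-- The elements that intertwine form a subring, so it suffices to consider generators. -/
theorem exists_intertwines_left {c : RatFunc k} (hc : barQ k c = (q k)⁻¹ * (q k)⁻¹ * c) {b : Uq k}
    (hb : b ∈ Bc c) : ∃ a ∈ Bc c, Intertwines (quasiK c) a (barU k b) := by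
  have hX := homog_of_isUplusWeight (isUplusWeight_quasiK c)
  refine Bc_induction (p := fun b => ∃ a ∈ Bc c, Intertwines (quasiK c) a (barU k b)) ?_ ?_ ?_ ?_ hb
  · exact fun a ha => ⟨barU k a, MX_le_Bc c (barU_mem_MX ha),
      intertwines_of_mem_MX c (barU_mem_MX ha)⟩
  · exact ⟨_, B2_mem_Bc c, (intertwines_B2_iff hX).mpr (defect_quasiK hc)⟩
  · rintro b b' ⟨a, ha, h⟩ ⟨a', ha', h'⟩
    exact ⟨_, add_mem ha ha', by rw [map_add]; exact h.add hX h'⟩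
  · rintro b b' ⟨a, ha, h⟩ ⟨a', ha', h'⟩
    exact ⟨_, mul_mem ha ha', by rw [map_mul]; exact h.mul h'⟩

theorem exists_intertwines_right {c : RatFunc k} (hc : barQ k c = (q k)⁻¹ * (q k)⁻¹ * c) {a : Uq k}
    (ha : a ∈ Bc c) : ∃ b ∈ Bc c, Intertwines (quasiK c) a (barU k b) := by
  have hX := homog_of_isUplusWeight (isUplusWeight_quasiK c)
  refine Bc_induction (p := fun a => ∃ b ∈ Bc c, Intertwines (quasiK c) a (barU k b)) ?_ ?_ ?_ ?_ ha
  · exact fun a ha => ⟨barU k a, MX_le_Bc c (barU_mem_MX ha), by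
      rw [barU_barU]; exact intertwines_of_mem_MX c ha⟩
  · exact ⟨_, B2_mem_Bc c, (intertwines_B2_iff hX).mpr (defect_quasiK hc)⟩
  · rintro a a' ⟨b, hb, h⟩ ⟨b', hb', h'⟩
    exact ⟨_, add_mem hb hb', by rw [map_add]; exact h.add hX h'⟩
  · rintro a a' ⟨b, hb, h⟩ ⟨b', hb', h'⟩
    exact ⟨_, mul_mem hb hb', by rw [map_mul]; exact h.mul h'⟩

/-- Conjugating the bar involution of `U` by the operator given by the formula yields a ring
automorphism of `B_c`. -/
theorem exists_ringEquiv_intertwines {c : RatFunc k} (hc0 : c ≠ 0)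
    (hc : barQ k c = (q k)⁻¹ * (q k)⁻¹ * c) :
    ∃ β : Bc c ≃+* Bc c, ∀ b : Bc c, Intertwines (quasiK c) (β b : Uq k) (barU k b) := by
  have hX := homog_of_isUplusWeight (isUplusWeight_quasiK c)
  choose f hf hfi using fun b : Bc c => exists_intertwines_left hc b.2
  have uniq : ∀ (b : Bc c) {a : Uq k}, Intertwines (quasiK c) a (barU k b) → f b = a :=
    fun b a h => (hfi b).left_unique hc0 h
  let φ : Bc c →+* Bc c :=
    { toFun := fun b => ⟨f b, hf b⟩
      map_one' := Subtype.ext (uniq _ (by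
        simpa using intertwines_of_mem_MX c (one_mem (MX k))))
      map_zero' := Subtype.ext (uniq _ (by
        simpa using intertwines_of_mem_MX c (zero_mem (MX k))))
      map_add' := fun b b' => Subtype.ext (uniq _ (by
        have := (hfi b).add hX (hfi b')
        rwa [← map_add] at this))
      map_mul' := fun b b' => Subtype.ext (uniq _ (by
        have := (hfi b).mul (hfi b')
        rwa [← map_mul] at this)) }
  refine ⟨RingEquiv.ofBijective φ ⟨fun b b' h => Subtype.ext ?_, fun a => ?_⟩, hfi⟩
  · have e : f b = f b' := congrArg Subtype.val h
    have := (hfi b).right_unique hc0 (e ▸ hfi b')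
    rw [← barU_barU (b : Uq k), this, barU_barU]
  · obtain ⟨b, hb, h⟩ := exists_intertwines_right hc a.2
    exact ⟨⟨b, hb⟩, Subtype.ext (uniq ⟨b, hb⟩ h)⟩

theorem isQuasiK_quasiK {c : RatFunc k} (hc0 : c ≠ 0)
    (hc : barQ k c = (q k)⁻¹ * (q k)⁻¹ * c) : IsQuasiK c (quasiK c) := by
  obtain ⟨β, hβ⟩ := exists_ringEquiv_intertwines hc0 hc
  refine ⟨isUplusWeight_quasiK c, quasiK_zero c, β, ⟨fun b hb => ?_, fun b hb => ?_⟩,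
    fun M _ _ _ _ hM b m => hβ b M hM m⟩
  · rw [MX_sup_UTheta] at hb
    exact (hβ b).left_unique hc0 (intertwines_of_mem_MX c (barU_mem_MX hb))
  · have := hβ b
    rw [hb] at this
    exact this.left_unique hc0 ((intertwines_B2_iff
      (homog_of_isUplusWeight (isUplusWeight_quasiK c))).mpr (defect_quasiK hc))

theorem eq_quasiK_of_isQuasiK {c : RatFunc k} (hc : barQ k c = (q k)⁻¹ * (q k)⁻¹ * c)
    {X : (Fin 3 → ℕ) → Uq k} (h : IsQuasiK c X) : X = quasiK c := by
  obtain ⟨hw, h0, β, hβ, hi⟩ := h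
  have hX := homog_of_isUplusWeight hw
  have hi' : ∀ b : Bc c, Intertwines X (β b : Uq k) (barU k b) :=
    fun b M _ _ _ _ hM m => hi M hM b m
  have F_mem : ∀ i : Fin 3, i ≠ 1 → Uq.F k i ∈ MX k := fun i h1 =>
    Algebra.subset_adjoin ⟨i, by fin_cases i <;> simp_all, Or.inr (Or.inl rfl)⟩
  refine eq_of_defect hw (isUplusWeight_quasiK c) (h0.trans (quasiK_zero c).symm)
    (fun i h1 μ => ?_) (fun i h1 => commute_quasiK (commute_coreU_of_mem_MX (F_mem i h1)) c) ?_
    (defect_quasiK hc)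
  · have h2 := hi' ⟨Uq.F k i, MX_le_Bc c (F_mem i h1)⟩
    rw [hβ.on_MU _ (by rw [MX_sup_UTheta]; exact F_mem i h1), barU_F] at h2
    exact h2.commute (ν := fun j => -cartan j i) hX (fun j => IsKWt.F j i) μ
  · have h2 := hi' ⟨B2 c, B2_mem_Bc c⟩
    rw [hβ.on_B _ rfl] at h2
    exact (intertwines_B2_iff hX).mp h2

end

end QSP

theorem mainTheorem8 {k : Type*} [Field k] [CharZero k] (c : RatFunc k) (hc : c ≠ 0)
    (hbar : c = q k ^ form (simpleRoot 1) (Theta (simpleRoot 1) - twoRhoX) * barQ k c)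
    (X : (Fin 3 → ℕ) → Uq k) :
    IsQuasiK c X ↔
      (∀ n : ℕ, X (n • ![1, 2, 1]) =
        ((q k * c) ^ n / qfact k n) • qcomm (Uq.E k 1) (T13E2 k) (q k ^ (-2 : ℤ)) ^ n) ∧
      (∀ μ : Fin 3 → ℕ, (∀ n : ℕ, μ ≠ n • ![1, 2, 1]) → X μ = 0) := by
  have hq := (Uq.q_facts k).1
  have hc' : barQ k c = (q k)⁻¹ * (q k)⁻¹ * c := by
    have e : form (simpleRoot 1) (Theta (simpleRoot 1) - twoRhoX) = 2 := by decide
    rw [e] at hbar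
    rw [← mul_inv, eq_inv_mul_iff_mul_eq₀ (mul_ne_zero hq hq), ← sq]
    exact hbar.symm
  rw [qcomm_eq_coreU]
  constructor
  · intro h
    rw [eq_quasiK_of_isQuasiK hc' h]
    exact ⟨quasiK_nsmul c, fun μ => quasiK_of_ne c⟩
  · rintro ⟨h1, h2⟩
    have : X = quasiK c := funext fun μ => by
      by_cases e : ∃ n : ℕ, μ = n • ![1, 2, 1]
      · obtain ⟨n, rfl⟩ := e
        rw [h1, quasiK_nsmul]
      · rw [h2 μ (not_exists.mp e), quasiK_of_ne c (not_exists.mp e)]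
    rw [this]
    exact isQuasiK_quasiK hc hc'
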